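/- Let $k$ be an algebraically closed field (of arbitrary characteristic), let $F$ be a $5$-dimensional $k$-vector space, and let $f_1^*,\ldots,f_5^*$ be a basis of $F^*$. Let $GL_2\times GL(F)$ act on the $20$-dimensional space $\mathrm{Hom}(k^2,\wedge^2F^*)$ by $(g,a)\cdot f=\wedge^2({}^ta^{-1})\circ f\circ g^{-1}$, and put $$\omega_1=f_2^*\wedge f_4^*+f_3^*\wedge f_5^*,\qquad \omega_2=f_1^*\wedge f_5^*+f_3^*\wedge f_4^*.$$ There are exactly eight $GL_2\times GL(F)$-orbits in $\mathrm{Hom}(k^2,\wedge^2F^*)$. Each of them contains exactly one of the eight elements $f$ given by the following table, which also gives a label of the orbit and its dimension: $$ \begin{array}{|c|c|c|c|} \hline \text{label} & f((1,0)) & f((0,1)) & \dim \\ \hline A_2 + 2A_1 & \omega_1 & \omega_2 & 20 \\ A_2 + A_1 & \omega_1 & f_1^* \wedge f_2^* & 18 \\ A_2 & \omega_1 & f_2^* \wedge f_4^* & 16 \\ 3A_{1,a} & \omega_1 & f_2^* \wedge f_3^* & 15 \\ 3A_{1,b} & f_1^* \wedge f_2^* & f_1^* \wedge f_3^* & 12\\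 3A_{1,c} & \omega_1 & \omega_1 & 11\\ 2A_1 & f_1^* \wedge f_2^* & f_1^* \wedge f_2^* & 8\\ A_1 & 0 & 0 & 0\\ \hline \end{array} $$ For two of these orbits $\mathcal O,\mathcal O'$, the Zariski closure of $\mathcal O$ contains $\mathcal O'$ if and only if $\mathcal O=\mathcal O'$ or $\mathcal O$ lies above $\mathcal O'$ in this table, with the single exception that the closure of the orbit labelled $3A_{1,b}$ does not contain the orbit labelled $3A_{1,c}$. -/

import Mathlib

noncomputable section

namespace SkewPencil

section Zariski

variable (k : Type*) [Field k] (V : Type*) [AddCommGroup V] [Module k V]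

/-- The algebra of polynomial functions on the vector space `V`: the algebra of functions generated
by the linear forms. -/
def polynomialFunctions : Subalgebra k (V → k) :=
  Algebra.adjoin k (Set.range fun φ : Module.Dual k V => (φ : V → k))

/-- The common zero locus in `V` of a set of functions. -/
def zeroLocus (P : Set (V → k)) : Set V := {v | ∀ p ∈ P, p v = 0}

/-- The Zariski topology on `V`: the closed sets are the zero loci of sets of polynomial
functions. -/
@[reducible] def zariskiTopology : TopologicalSpace V :=
  TopologicalSpace.ofClosed
    {Z | ∃ P ⊆ (polynomialFunctions k V : Set (V → k)), Z = zeroLocus k V P}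
    ⟨{1}, by simp, by
      ext v; simp [zeroLocus]⟩
    (by
      intro A hA
      refine ⟨{p | p ∈ polynomialFunctions k V ∧ ∃ Z ∈ A, ∀ v ∈ Z, p v = 0},
        fun p hp => hp.1, ?_⟩
      ext v
      constructor
      · rintro hv p ⟨-, Z, hZ, h⟩
        exact h v (hv Z hZ)
      · intro hv Z hZ
        obtain ⟨P, hP, rfl⟩ := hA hZ
        exact fun p hp => hv p ⟨hP hp, _, hZ, fun w hw => hw p hp⟩)
    (by
      rintro _ ⟨P, hP, rfl⟩ _ ⟨Q, hQ, rfl⟩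
      refine ⟨{r | ∃ p ∈ P, ∃ q ∈ Q, r = p * q}, ?_, ?_⟩
      · rintro _ ⟨p, hp, q, hq, rfl⟩
        exact (polynomialFunctions k V).mul_mem (hP hp) (hQ hq)
      · ext v
        constructor
        · rintro (h | h) _ ⟨p, hp, q, hq, rfl⟩
          · simp [h p hp]
          · simp [h q hq]
        · intro h
          by_contra hn
          simp only [zeroLocus, Set.mem_union, Set.mem_ofPred_eq, not_or, not_forall] at hn
          obtain ⟨⟨p, hp, hpv⟩, ⟨q, hq, hqv⟩⟩ := hn
          exact mul_ne_zero hpv hqv (h _ ⟨p, hp, q, hq, rfl⟩))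

variable {V}

/-- The closure of a subset of `V` in the Zariski topology. -/
def zariskiClosure (S : Set V) : Set V :=
  @closure V (zariskiTopology k V) S

/-- The dimension of a subset of `V`: the Krull dimension of the subset as a topological space, for
the topology induced by the Zariski topology of `V`. -/
def zariskiDim (S : Set V) : WithBot ℕ∞ :=
  @topologicalKrullDim S ((zariskiTopology k V).induced Subtype.val)

end Zariski

section Pencils

variable (k : Type*) [Field k] (F : Type*) [AddCommGroup F] [Module k F]

/-- `Hom(k², ∧² F*)`. -/
abbrev PencilSpace : Type _ := (Fin 2 → k) →ₗ[k] ⋀[k]^2 (Module.Dual k F)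

/-- The group `GL₂ × GL(F)`. -/
abbrev PencilGroup : Type _ :=
  LinearMap.GeneralLinearGroup k (Fin 2 → k) × LinearMap.GeneralLinearGroup k F

/-- The natural action of `GL₂` on `k²`, as a representation of `GL₂ × GL(F)`. -/
def planeRep : Representation k (PencilGroup k F) (Fin 2 → k) :=
  (Units.coeHom _).comp (MonoidHom.fst _ _)

/-- The natural action of `GL(F)` on `F`, as a representation of `GL₂ × GL(F)`. -/
def spaceRep : Representation k (PencilGroup k F) F :=
  (Units.coeHom _).comp (MonoidHom.snd _ _)

/-- The action on `∧² F*` induced by the dual action on `F*`. -/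
def formRep : Representation k (PencilGroup k F) (⋀[k]^2 (Module.Dual k F)) where
  toFun g := exteriorPower.map 2 ((spaceRep k F).dual g)
  map_one' := by
    rw [map_one]
    exact exteriorPower.map_id
  map_mul' g h := by
    rw [map_mul]
    exact exteriorPower.map_comp _ _

/-- The natural action of `GL₂ × GL(F)` on `Hom(k², ∧² F*)`:
`(g, a) • f = ∧²(ᵗa⁻¹) ∘ f ∘ g⁻¹`. -/
def pencilRep : Representation k (PencilGroup k F) (PencilSpace k F) :=
  (planeRep k F).linHom (formRep k F)

variable {F}

/-- The `GL₂ × GL(F)`-orbit of `f`. -/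
def orbit (f : PencilSpace k F) : Set (PencilSpace k F) :=
  Set.range fun x : PencilGroup k F => pencilRep k F x f

variable {k}

/-- The element `φ ∧ ψ` of `∧² F*`. -/
def wedge (φ ψ : Module.Dual k F) : ⋀[k]^2 (Module.Dual k F) :=
  exteriorPower.ιMulti k 2 ![φ, ψ]

/-- The linear map `f : k² → ∧² F*` with `f (1, 0) = α` and `f (0, 1) = β`. -/
def pencil (α β : ⋀[k]^2 (Module.Dual k F)) : PencilSpace k F :=
  (Pi.basisFun k (Fin 2)).constr k ![α, β]

/-- The labels of the eight orbits, in the order of the table. -/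
inductive OrbitLabel : Type
  /-- `A₂ + 2A₁` -/
  | A2_2A1
  /-- `A₂ + A₁` -/
  | A2_A1
  /-- `A₂` -/
  | A2
  /-- `3A_{1,a}` -/
  | threeA1a
  /-- `3A_{1,b}` -/
  | threeA1b
  /-- `3A_{1,c}` -/
  | threeA1c
  /-- `2A₁` -/
  | twoA1
  /-- `A₁` -/
  | A1

namespace OrbitLabel

/-- The row of the table (numbered downwards) in which a label stands. -/
def row : OrbitLabel → ℕ
  | A2_2A1 => 1
  | A2_A1 => 2
  | A2 => 3
  | threeA1a => 4
  | threeA1b => 5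
  | threeA1c => 6
  | twoA1 => 7
  | A1 => 8

/-- The dimension listed in the table. -/
def dim : OrbitLabel → ℕ
  | A2_2A1 => 20
  | A2_A1 => 18
  | A2 => 16
  | threeA1a => 15
  | threeA1b => 12
  | threeA1c => 11
  | twoA1 => 8
  | A1 => 0

/-- The representative listed in the table, for a basis `f₁*, …, f₅*` of `F*`; the vector `fᵢ*` is
`e (i - 1)`. -/
def rep (e : Module.Basis (Fin 5) k (Module.Dual k F)) : OrbitLabel → PencilSpace k F :=
  let ω₁ := wedge (e 1) (e 3) + wedge (e 2) (e 4)
  let ω₂ := wedge (e 0) (e 4) + wedge (e 2) (e 3)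
  fun
  | A2_2A1 => pencil ω₁ ω₂
  | A2_A1 => pencil ω₁ (wedge (e 0) (e 1))
  | A2 => pencil ω₁ (wedge (e 1) (e 3))
  | threeA1a => pencil ω₁ (wedge (e 1) (e 2))
  | threeA1b => pencil (wedge (e 0) (e 1)) (wedge (e 0) (e 2))
  | threeA1c => pencil ω₁ ω₁
  | twoA1 => pencil (wedge (e 0) (e 1)) (wedge (e 0) (e 1))
  | A1 => pencil 0 0

end OrbitLabel

end Pencils

end SkewPencil

end

noncomputable section

namespace SkewPencil

/-! ### Polynomial maps, Zariski closures and density of principal open sets -/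

section PolynomialMaps

variable {k : Type*} [Field k] {U V W : Type*} [AddCommGroup U] [Module k U]
  [AddCommGroup V] [Module k V] [AddCommGroup W] [Module k W]

/-! In the basis `e` an element of Hom(k², ∧²F*) is a pair of alternating 5 × 5 matrices. The orbit
of the representative with label `i` consists of the pairs `skewPair i m φ` with `m` an invertible 2
× 2 matrix and `φ` a basis of k⁵ (`mem_orbit_rep_iff`). The theorem thus concerns the
parametrizations (m, φ) ↦ `skewPair i m φ`.

Every pair (A, B) has one of the eight shapes (`isTabulated`). If some nonzero combination has rank
at most two, the other member is reduced relative to it by Gaussian elimination. Otherwise A may be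
taken of rank four, and B is contracted with the kernel of A. If the contraction is nonzero, an
elimination preserving A leads to the generic shape or to a combination of rank at most two. If it
vanishes, A and B are forms in four variables, and the Pfaffian of B - tA is quadratic in t, so a
root gives a combination of rank at most two. This root is the only use of algebraic closedness
beyond k being infinite.

Dimensions are bounded from both sides. If a set lies in the closure of the image of a polynomial
map from kᵈ, its dimension is at most d, by Noether normalization and transcendence degree
(`zariskiDim_le`). Conversely, a chart whose coordinate flag is separated step by step by polynomial
functions gives a chain of d + 1 irreducible closed sets (`le_zariskiDim`). Explicit charts do this
for the labels other than `A2_2A1`, the zero orbit being trivial. The seven smaller orbits then lie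
in proper closed sets, so the generic orbit contains a nonempty principal open set; hence it is
dense and has dimension 20.

The eight dimensions are distinct, so the representatives lie in distinct orbits and no further
invariants are needed. A closure relation forces the inequality of dimensions, hence of rows. A 4 ×
4 Pfaffian excludes the one exceptional pair. The remaining relations follow by transitivity from
degenerate values of (m, φ), from density of the generic orbit, and from one limit: a tangent line
to the Grassmannian is a limit of secants (`orbit_threeA1a_subset_closure`). -/

theorem linear_mem_polynomialFunctions (φ : Module.Dual k V) :
    (φ : V → k) ∈ polynomialFunctions k V :=
  Algebra.subset_adjoin ⟨φ, rfl⟩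

theorem const_mem_polynomialFunctions (c : k) :
    (fun _ : V => c) ∈ polynomialFunctions k V :=
  (polynomialFunctions k V).algebraMap_mem c

/-- Maps between vector spaces whose composites with all linear forms are polynomial functions. -/
def IsPolynomialMap (k : Type*) [Field k] {V W : Type*} [AddCommGroup V] [Module k V]
    [AddCommGroup W] [Module k W] (P : W → V) : Prop :=
  ∀ φ : Module.Dual k V, (fun w => φ (P w)) ∈ polynomialFunctions k W

theorem IsPolynomialMap.comp_mem {P : W → V} (hP : IsPolynomialMap k P) {f : V → k}
    (hf : f ∈ polynomialFunctions k V) : (fun w => f (P w)) ∈ polynomialFunctions k W := by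
  induction hf using Algebra.adjoin_induction with
  | mem x hx => obtain ⟨φ, rfl⟩ := hx; exact hP φ
  | algebraMap r => exact const_mem_polynomialFunctions r
  | add x y _ _ hx hy => exact (polynomialFunctions k W).add_mem hx hy
  | mul x y _ _ hx hy => exact (polynomialFunctions k W).mul_mem hx hy

theorem IsPolynomialMap.comp {P : W → V} (hP : IsPolynomialMap k P) {Q : U → W}
    (hQ : IsPolynomialMap k Q) : IsPolynomialMap k fun u => P (Q u) :=
  fun φ => hQ.comp_mem (hP φ)

theorem isPolynomialMap_of_mem {f : V → k} (hf : f ∈ polynomialFunctions k V) :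
    IsPolynomialMap k f := by
  intro φ
  have h : (fun w => φ (f w)) = φ 1 • f := by
    ext w
    have := φ.map_smul (f w) 1
    simp only [smul_eq_mul, mul_one] at this
    simp [this, mul_comm]
  rw [h]
  exact (polynomialFunctions k V).smul_mem hf _

theorem IsPolynomialMap.mem {f : V → k} (hf : IsPolynomialMap k f) :
    f ∈ polynomialFunctions k V :=
  hf LinearMap.id

theorem isPolynomialMap_const (v : V) : IsPolynomialMap k fun _ : W => v :=
  fun φ => const_mem_polynomialFunctions (φ v)

theorem isPolynomialMap_linear (L : W →ₗ[k] V) : IsPolynomialMap k L :=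
  fun φ => linear_mem_polynomialFunctions (φ.comp L)

theorem IsPolynomialMap.add {P Q : W → V} (hP : IsPolynomialMap k P) (hQ : IsPolynomialMap k Q) :
    IsPolynomialMap k fun w => P w + Q w := fun φ => by
  simp only [map_add]
  exact (polynomialFunctions k W).add_mem (hP φ) (hQ φ)

theorem IsPolynomialMap.neg {P : W → V} (hP : IsPolynomialMap k P) :
    IsPolynomialMap k fun w => -P w := fun φ => by
  simp only [map_neg]
  exact (polynomialFunctions k W).neg_mem (hP φ)

theorem IsPolynomialMap.sub {P Q : W → V} (hP : IsPolynomialMap k P) (hQ : IsPolynomialMap k Q) :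
    IsPolynomialMap k fun w => P w - Q w := fun φ => by
  simp only [map_sub]
  exact (polynomialFunctions k W).sub_mem (hP φ) (hQ φ)

theorem IsPolynomialMap.smul {f : W → k} {P : W → V} (hf : IsPolynomialMap k f)
    (hP : IsPolynomialMap k P) : IsPolynomialMap k fun w => f w • P w := fun φ => by
  simp only [map_smul, smul_eq_mul]
  exact (polynomialFunctions k W).mul_mem hf.mem (hP φ)

theorem IsPolynomialMap.mul {f g : W → k} (hf : IsPolynomialMap k f)
    (hg : IsPolynomialMap k g) : IsPolynomialMap k fun w => f w * g w :=
  hf.smul hg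

theorem IsPolynomialMap.sum {ι : Type*} {s : Finset ι} {P : ι → W → V}
    (hP : ∀ i ∈ s, IsPolynomialMap k (P i)) : IsPolynomialMap k fun w => ∑ i ∈ s, P i w := fun φ => by
  have : (fun w => φ (∑ i ∈ s, P i w)) = ∑ i ∈ s, fun w => φ (P i w) := by
    ext w; simp
  rw [this]
  exact (polynomialFunctions k W).sum_mem fun i hi => hP i hi φ

theorem IsPolynomialMap.prod {ι : Type*} {s : Finset ι} {f : ι → W → k}
    (hf : ∀ i ∈ s, IsPolynomialMap k (f i)) : IsPolynomialMap k fun w => ∏ i ∈ s, f i w := by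
  refine isPolynomialMap_of_mem ?_
  have : (fun w => ∏ i ∈ s, f i w) = ∏ i ∈ s, f i := by ext w; simp
  rw [this]
  exact (polynomialFunctions k W).prod_mem fun i hi => (hf i hi).mem

theorem isPolynomialMap_apply {ι : Type*} (i : ι) : IsPolynomialMap k fun x : ι → k => x i :=
  isPolynomialMap_linear (LinearMap.proj (R := k) (φ := fun _ : ι => k) i)

theorem IsPolynomialMap.det {n : ℕ} {A : W → Matrix (Fin n) (Fin n) k}
    (hA : ∀ i j, IsPolynomialMap k fun w => A w i j) : IsPolynomialMap k fun w => (A w).det := by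
  simp only [Matrix.det_apply]
  refine .sum fun σ _ => ?_
  have h := IsPolynomialMap.prod (k := k) (s := Finset.univ) (f := fun i w => A w (σ i) i)
    fun i _ => hA _ _
  obtain hs | hs := Int.units_eq_one_or (Equiv.Perm.sign σ) <;> rw [hs]
  · simpa using h
  · simpa using h.neg

theorem exists_polynomial_on_line {f : V → k} (hf : f ∈ polynomialFunctions k V) (v w : V) :
    ∃ p : Polynomial k, ∀ t, f (v + t • w) = p.eval t := by
  induction hf using Algebra.adjoin_induction with
  | mem x hx =>
    obtain ⟨φ, rfl⟩ := hx
    exact ⟨.C (φ v) + .X * .C (φ w), fun t => by simp; exact mul_comm _ _⟩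
  | algebraMap r => exact ⟨.C r, fun t => (Polynomial.eval_C).symm⟩
  | add x y _ _ hx hy =>
    obtain ⟨p, hp⟩ := hx
    obtain ⟨q, hq⟩ := hy
    exact ⟨p + q, fun t => by simp [hp, hq]⟩
  | mul x y _ _ hx hy =>
    obtain ⟨p, hp⟩ := hx
    obtain ⟨q, hq⟩ := hy
    exact ⟨p * q, fun t => by simp [hp, hq]⟩

/-- On the line joining `v` to `v₀` the functions become univariate polynomials with product zero.
The one coming from `g` is nonzero, since it does not vanish at `v₀`. This density of principal open
sets replaces all irreducibility arguments about affine space. -/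
theorem eq_zero_of_forall_ne_zero [Infinite k] {f g : V → k} (hf : f ∈ polynomialFunctions k V)
    (hg : g ∈ polynomialFunctions k V) {v₀ : V} (h₀ : g v₀ ≠ 0)
    (h : ∀ v, g v ≠ 0 → f v = 0) (v : V) : f v = 0 := by
  obtain ⟨p, hp⟩ := exists_polynomial_on_line hf v (v₀ - v)
  obtain ⟨q, hq⟩ := exists_polynomial_on_line hg v (v₀ - v)
  have hq0 : q ≠ 0 := by
    rintro rfl
    have := hq 1
    simp at this
    exact h₀ this
  have hpq : p * q = 0 := by
    refine Polynomial.funext fun t => ?_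
    rw [Polynomial.eval_mul, ← hp, ← hq, Polynomial.eval_zero]
    by_cases h' : g (v + t • (v₀ - v)) = 0
    · rw [h', mul_zero]
    · rw [h _ h', zero_mul]
  have := hp 0
  rw [(mul_eq_zero.mp hpq).resolve_right hq0] at this
  simpa using this

theorem isClosed_zariskiTopology_iff {Z : Set V} :
    @IsClosed V (zariskiTopology k V) Z ↔
      ∃ P ⊆ (polynomialFunctions k V : Set (V → k)), Z = zeroLocus k V P := by
  rw [← @isOpen_compl_iff V Z (zariskiTopology k V)]
  change Zᶜᶜ ∈ _ ↔ _
  rw [compl_compl]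
  rfl

theorem mem_zariskiClosure {S : Set V} {v : V} :
    v ∈ zariskiClosure k S ↔
      ∀ f ∈ polynomialFunctions k V, (∀ s ∈ S, f s = 0) → f v = 0 := by
  let _ : TopologicalSpace V := zariskiTopology k V
  change v ∈ closure S ↔ _
  rw [closure, Set.mem_sInter]
  constructor
  · intro h f hf hS
    have hc : @IsClosed V (zariskiTopology k V) (zeroLocus k V {f}) :=
      isClosed_zariskiTopology_iff.mpr ⟨{f}, by simpa using hf, rfl⟩
    exact h _ ⟨hc, fun s hs p hp => by rw [Set.mem_singleton_iff.mp hp]; exact hS s hs⟩ f rfl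
  · rintro h Z ⟨hZ, hSZ⟩
    obtain ⟨P, hP, rfl⟩ := isClosed_zariskiTopology_iff.mp hZ
    exact fun p hp => h p (hP hp) fun s hs => hSZ hs p hp

theorem zariskiClosure_subset_of_subset {S T : Set V} (h : S ⊆ zariskiClosure k T) :
    zariskiClosure k S ⊆ zariskiClosure k T := fun v hv => by
  rw [mem_zariskiClosure] at hv ⊢
  exact fun f hf hT => hv f hf fun s hs => mem_zariskiClosure.mp (h hs) f hf hT

theorem subset_zariskiClosure (S : Set V) : S ⊆ zariskiClosure k S := fun v hv =>
  mem_zariskiClosure.mpr fun _ _ h => h v hv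

/-- A polynomial map sends everything into the closure of the image of a nonempty principal
open set. -/
theorem IsPolynomialMap.mem_zariskiClosure_of_forall [Infinite k] {P : W → V}
    (hP : IsPolynomialMap k P) {g : W → k} (hg : IsPolynomialMap k g) {w₀ : W} (h₀ : g w₀ ≠ 0)
    {S : Set V} (h : ∀ w, g w ≠ 0 → P w ∈ zariskiClosure k S) (w : W) :
    P w ∈ zariskiClosure k S := by
  rw [mem_zariskiClosure]
  intro f hf hS
  exact eq_zero_of_forall_ne_zero (hP.comp_mem hf) hg.mem h₀
    (fun w hw => mem_zariskiClosure.mp (h w hw) f hf hS) w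

end PolynomialMaps

/-! ### Upper and lower bounds for Krull dimension from polynomial parametrizations -/

section KrullDimension

/-- Incomparability for integral extensions: contraction keeps strict inclusions of primes strict.
-/
theorem ringKrullDim_le_of_isIntegral {R S : Type*} [CommRing R] [CommRing S] (g : R →+* S)
    (hg : g.IsIntegral) : ringKrullDim S ≤ ringKrullDim R := by
  algebraize [g]
  refine Order.krullDim_le_of_strictMono (PrimeSpectrum.comap (algebraMap R S)) fun p q hpq => ?_
  exact Ideal.IsIntegral.comap_lt_comap hpq

/-- The Krull dimension of a quotient of a polynomial ring that embeds into a polynomial ring in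
`d` variables is at most `d`. -/
theorem ringKrullDim_quotient_ker_le {k : Type*} [Field k] {n d : ℕ}
    (θ : MvPolynomial (Fin n) k →ₐ[k] MvPolynomial (Fin d) k) :
    ringKrullDim (MvPolynomial (Fin n) k ⧸ RingHom.ker θ) ≤ d := by
  have : Nontrivial (MvPolynomial (Fin n) k ⧸ RingHom.ker θ) :=
    Ideal.Quotient.nontrivial_iff.mpr (RingHom.ker_ne_top _)
  -- Noether normalization: the quotient is integral over a polynomial ring in `s` variables. That
  -- ring embeds into the one in `d` variables, so `s ≤ d` by transcendence degree.
  obtain ⟨s, g, hg, hgi⟩ :=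
    exists_integral_inj_algHom_of_fg k (MvPolynomial (Fin n) k ⧸ RingHom.ker θ)
  have h1 := ringKrullDim_le_of_isIntegral _ hgi
  have hinj : Function.Injective ((Ideal.kerLiftAlg θ).comp g) := by
    rw [AlgHom.coe_comp]
    exact (Ideal.kerLiftAlg_injective θ).comp hg
  have h2 := trdeg_le_of_injective _ hinj
  rw [MvPolynomial.trdeg_of_isDomain, MvPolynomial.trdeg_of_isDomain] at h2
  simp only [Cardinal.mk_fin, Cardinal.lift_natCast, Nat.cast_le] at h2
  rw [MvPolynomial.ringKrullDim_of_isNoetherianRing, ringKrullDim_eq_zero_of_field] at h1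
  refine h1.trans ?_
  simpa using mod_cast h2

variable {k : Type*} [Field k] {V : Type*} [AddCommGroup V] [Module k V]

theorem exists_mvPolynomial {ι : Type*} [Finite ι] (b : Module.Basis ι k V) {f : V → k}
    (hf : f ∈ polynomialFunctions k V) :
    ∃ p : MvPolynomial ι k, ∀ v, f v = MvPolynomial.eval (fun i => b.repr v i) p := by
  have := Fintype.ofFinite ι
  induction hf using Algebra.adjoin_induction with
  | mem x hx =>
    obtain ⟨φ, rfl⟩ := hx
    refine ⟨∑ i, .X i * .C (φ (b i)), fun v => ?_⟩
    change φ v = _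
    conv_lhs => rw [← b.sum_repr v, map_sum]
    simp
  | algebraMap r => exact ⟨.C r, fun v => (MvPolynomial.eval_C _).symm⟩
  | add x y _ _ hx hy =>
    obtain ⟨p, hp⟩ := hx
    obtain ⟨q, hq⟩ := hy
    exact ⟨p + q, fun v => by simp [hp, hq]⟩
  | mul x y _ _ hx hy =>
    obtain ⟨p, hp⟩ := hx
    obtain ⟨q, hq⟩ := hy
    exact ⟨p * q, fun v => by simp [hp, hq]⟩

theorem eval_repr_mem_polynomialFunctions {ι : Type*} (b : Module.Basis ι k V)
    (p : MvPolynomial ι k) :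
    (fun v => MvPolynomial.eval (fun i => b.repr v i) p) ∈ polynomialFunctions k V := by
  induction p using MvPolynomial.induction_on with
  | C a => simpa using const_mem_polynomialFunctions a
  | add p q hp hq =>
    simp only [map_add]
    exact (polynomialFunctions k V).add_mem hp hq
  | mul_X p i hp =>
    simp only [map_mul, MvPolynomial.eval_X]
    exact (polynomialFunctions k V).mul_mem hp (linear_mem_polynomialFunctions (b.coord i))

/-- The polynomials in the coordinates that vanish on a set. -/
def coordinateVanishingIdeal {ι : Type*} (b : Module.Basis ι k V) (S : Set V) :
    Ideal (MvPolynomial ι k) where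
  carrier := {p | ∀ v ∈ S, MvPolynomial.eval (fun i => b.repr v i) p = 0}
  add_mem' hp hq v hv := by rw [map_add, hp v hv, hq v hv, add_zero]
  zero_mem' v _ := map_zero _
  smul_mem' p q hq v hv := by rw [smul_eq_mul, map_mul, hq v hv, mul_zero]

theorem isClosed_induced_zeroLocus (S : Set V) {f : V → k} (hf : f ∈ polynomialFunctions k V) :
    @IsClosed S ((zariskiTopology k V).induced Subtype.val) {s | f s = 0} := by
  let _ : TopologicalSpace V := zariskiTopology k V
  refine isClosed_induced_iff.mpr ⟨zeroLocus k V {f}, ?_, ?_⟩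
  · exact isClosed_zariskiTopology_iff.mpr ⟨{f}, by simpa using hf, rfl⟩
  · ext s; simp [zeroLocus]

/-- Irreducible closed subsets of `S` have prime vanishing ideals, which contain the kernel of the
comorphism `θ` of `P` because `S` lies in the closure of the image. The assignment reverses strict
inclusions, so chains in `S` are bounded by the dimension of the coordinate ring modulo that kernel.
No Nullstellensatz is involved. -/
theorem zariskiDim_le [Infinite k] [FiniteDimensional k V] {d : ℕ} {P : (Fin d → k) → V}
    (hP : IsPolynomialMap k P) {S : Set V} (hS : S ⊆ zariskiClosure k (Set.range P)) :
    zariskiDim k S ≤ d := by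
  let b := Module.finBasis k V
  have hp : ∀ i, ∃ p : MvPolynomial (Fin d) k, ∀ x, b.repr (P x) i = MvPolynomial.eval x p := by
    intro i
    obtain ⟨p, hp⟩ := exists_mvPolynomial (Pi.basisFun k (Fin d)) (hP (b.coord i))
    exact ⟨p, fun x => by simpa using hp x⟩
  choose p hp using hp
  let θ : MvPolynomial _ k →ₐ[k] MvPolynomial (Fin d) k := MvPolynomial.aeval p
  have hθ : ∀ f x, MvPolynomial.eval (fun i => b.repr (P x) i) f = MvPolynomial.eval x (θ f) := by
    intro f x
    induction f using MvPolynomial.induction_on with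
    | C a => simp [θ]
    | add f g hf hg => simp only [map_add, hf, hg]
    | mul_X f i hf =>
      rw [map_mul, hf, map_mul, map_mul]
      simp [θ, hp]
  refine le_trans ?_ (ringKrullDim_quotient_ker_le θ)
  rw [ringKrullDim_quotient, ← Order.krullDim_orderDual]
  let _ : TopologicalSpace V := zariskiTopology k V
  let I : TopologicalSpace.IrreducibleCloseds S → Ideal (MvPolynomial _ k) := fun Z =>
    coordinateVanishingIdeal b (Subtype.val '' (Z : Set S))
  have hprime : ∀ Z, (I Z).IsPrime := by
    intro Z
    refine ⟨fun h => ?_, fun {f g} hfg => ?_⟩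
    · obtain ⟨z, hz⟩ := Z.isIrreducible.nonempty
      have : (1 : MvPolynomial _ k) ∈ I Z := h ▸ Submodule.mem_top
      simpa using this z ⟨z, hz, rfl⟩
    · have := isPreirreducible_iff_isClosed_union_isClosed.mp Z.isIrreducible.isPreirreducible
        _ _ (isClosed_induced_zeroLocus S (eval_repr_mem_polynomialFunctions b f))
        (isClosed_induced_zeroLocus S (eval_repr_mem_polynomialFunctions b g)) (fun z hz => by
          have := hfg z ⟨z, hz, rfl⟩
          rw [map_mul] at this
          exact mul_eq_zero.mp this)
      refine this.imp (fun h => ?_) fun h => ?_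
      · rintro _ ⟨z, hz, rfl⟩
        exact h hz
      · rintro _ ⟨z, hz, rfl⟩
        exact h hz
  have hker : ∀ Z, RingHom.ker θ ≤ I Z := by
    rintro Z f hf _ ⟨z, -, rfl⟩
    refine mem_zariskiClosure.mp (hS z.2) _ (eval_repr_mem_polynomialFunctions b f) ?_
    rintro _ ⟨x, rfl⟩
    rw [hθ, (RingHom.mem_ker).mp hf, map_zero]
  refine Order.krullDim_le_of_strictMono
    (fun Z => OrderDual.toDual ⟨⟨I Z, hprime Z⟩, hker Z⟩) fun Z Z' hZ => ?_
  rw [OrderDual.toDual_lt_toDual]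
  have h1 : I Z' ≤ I Z := by
    rintro f hf _ ⟨z, hz, rfl⟩
    exact hf z ⟨z, hZ.le hz, rfl⟩
  -- A closed set is cut out by its own vanishing ideal, so equal ideals would force equal sets.
  refine lt_of_le_of_ne h1 fun h => hZ.not_ge fun z hz => ?_
  have h2 : I Z' = I Z := congrArg (fun x => x.1.asIdeal) h
  obtain ⟨C, hC, hCZ⟩ := isClosed_induced_iff.mp Z.isClosed
  obtain ⟨Q, hQ, rfl⟩ := isClosed_zariskiTopology_iff.mp hC
  change z ∈ (Z : Set S)
  rw [← hCZ]
  intro q hq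
  obtain ⟨f, hf⟩ := exists_mvPolynomial b (hQ hq)
  have hfZ : f ∈ I Z := by
    rintro _ ⟨y, hy, rfl⟩
    rw [← hf]
    change y ∈ (Z : Set S) at hy
    rw [← hCZ] at hy
    exact hy q hq
  rw [← h2] at hfZ
  rw [hf]
  exact hfZ z ⟨z, hz, rfl⟩

/-- If the image is covered by two closed sets and `q₁` from the first does not vanish on it, then
every `q₂` from the second vanishes where `g` times the pullback of `q₁` is nonzero, hence
everywhere by density. -/
theorem isIrreducible_induced_range [Infinite k] {W : Type*} [AddCommGroup W] [Module k W]
    {P : W → V} (hP : IsPolynomialMap k P) {g : W → k} (hg : IsPolynomialMap k g) {w₀ : W}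
    (h₀ : g w₀ ≠ 0) {S : Set V} (hS : ∀ w, g w ≠ 0 → P w ∈ S) :
    @IsIrreducible S ((zariskiTopology k V).induced Subtype.val)
      (Set.range fun w : {w // g w ≠ 0} => (⟨P w, hS w w.2⟩ : S)) := by
  let _ : TopologicalSpace V := zariskiTopology k V
  refine ⟨⟨_, ⟨w₀, h₀⟩, rfl⟩, ?_⟩
  rw [isPreirreducible_iff_isClosed_union_isClosed]
  intro Z₁ Z₂ hZ₁ hZ₂ h
  by_contra! hn
  obtain ⟨C₁, hC₁, rfl⟩ := isClosed_induced_iff.mp hZ₁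
  obtain ⟨C₂, hC₂, rfl⟩ := isClosed_induced_iff.mp hZ₂
  obtain ⟨Q₁, hQ₁, rfl⟩ := isClosed_zariskiTopology_iff.mp hC₁
  obtain ⟨Q₂, hQ₂, rfl⟩ := isClosed_zariskiTopology_iff.mp hC₂
  simp only [Set.not_subset, Set.mem_preimage, zeroLocus, Set.mem_ofPred_eq, not_forall] at hn
  obtain ⟨⟨_, ⟨⟨w₁, h₁⟩, rfl⟩, q₁, hq₁, hw₁⟩, ⟨_, ⟨⟨w₂, h₂⟩, rfl⟩, q₂, hq₂, hw₂⟩⟩ := hn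
  refine hw₂ (eq_zero_of_forall_ne_zero (hP.comp_mem (hQ₂ hq₂))
    (hg.mul (isPolynomialMap_of_mem (hP.comp_mem (hQ₁ hq₁)))).mem
    (v₀ := w₁) (mul_ne_zero h₁ hw₁) (fun w hw => ?_) w₂)
  have hgw := left_ne_zero_of_mul hw
  rcases h ⟨⟨w, hgw⟩, rfl⟩ with h' | h'
  · exact absurd (h' q₁ hq₁) (right_ne_zero_of_mul hw)
  · exact h' q₂ hq₂

/-- A lower bound for the dimension of a set that contains the image of a principal open
neighbourhood of `0` under a polynomial map, which is injective on a complete flag in the weak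
sense that polynomial functions `N i` distinguish the steps of the flag. -/
theorem le_zariskiDim [Infinite k] {d : ℕ} {P : (Fin d → k) → V}
    (hP : IsPolynomialMap k P) {g : (Fin d → k) → k} (hg : IsPolynomialMap k g) (h₀ : g 0 ≠ 0)
    {S : Set V} (hS : ∀ x, g x ≠ 0 → P x ∈ S)
    (hN : ∀ i : Fin d, ∃ N : V → k, IsPolynomialMap k N ∧
      (∀ x : Fin d → k, (∀ j, i ≤ j → x j = 0) → N (P x) = 0) ∧
      N (P (Pi.single i 1)) ≠ 0) :
    d ≤ zariskiDim k S := by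
  let _ : TopologicalSpace V := zariskiTopology k V
  -- Truncation to the first `m` coordinates. The images of the truncated charts, `m = 0, …, d`,
  -- have the closures that form the chain.
  let τ : ℕ → (Fin d → k) →ₗ[k] (Fin d → k) := fun m =>
    LinearMap.pi fun j => if (j : ℕ) < m then LinearMap.proj j else 0
  have hτ : ∀ m x j, τ m x j = if (j : ℕ) < m then x j else 0 := by
    intro m x j
    simp only [τ, LinearMap.pi_apply]
    split_ifs <;> simp
  have hττ : ∀ m m' x, m ≤ m' → τ m' (τ m x) = τ m x := by
    intro m m' x h
    ext j
    simp only [hτ]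
    split_ifs <;> first | rfl | omega
  have hgτ : ∀ m, IsPolynomialMap k fun x => g (τ m x) := fun m =>
    hg.comp (isPolynomialMap_linear (τ m))
  have hPτ : ∀ m, IsPolynomialMap k fun x => P (τ m x) := fun m =>
    hP.comp (isPolynomialMap_linear (τ m))
  have hg0 : ∀ m, g (τ m 0) ≠ 0 := fun m => by rwa [map_zero]
  let R : ℕ → Set S := fun m =>
    Set.range fun x : {x // g (τ m x) ≠ 0} => (⟨P (τ m x), hS _ x.2⟩ : S)
  have hR : ∀ m, IsIrreducible (R m) := fun m =>
    isIrreducible_induced_range (hPτ m) (hgτ m) (hg0 m) (fun x hx => hS _ hx)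
  let Z : Fin (d + 1) → TopologicalSpace.IrreducibleCloseds S := fun m =>
    ⟨closure (R m), (hR m).closure, isClosed_closure⟩
  have hZ : StrictMono Z := by
    refine Fin.strictMono_iff_lt_succ.mpr fun i => lt_of_le_not_ge ?_ fun h => ?_
    · refine closure_mono ?_
      rintro _ ⟨⟨x, hx⟩, rfl⟩
      refine ⟨⟨τ i x, ?_⟩, ?_⟩
      · simp only [Fin.val_succ]
        rw [hττ _ _ _ (Nat.le_succ _)]
        exact hx
      · simp only [Fin.val_succ, Fin.val_castSucc]
        simp only [hττ _ _ _ (Nat.le_succ _)]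
    -- `N` vanishes on stage `i`. Were the closures equal, it would vanish on stage `i + 1`, and by
    -- density at the `i`-th unit vector too, even if `g` is zero there.
    · obtain ⟨N, hN, h1, h2⟩ := hN i
      have hsub : R (i + 1) ⊆ {s : S | N s = 0} := by
        refine subset_closure.trans (Set.Subset.trans (fun s hs => h hs)
          (closure_minimal ?_ (isClosed_induced_zeroLocus S hN.mem)))
        rintro _ ⟨⟨x, hx⟩, rfl⟩
        refine h1 _ fun j hj => ?_
        rw [hτ, if_neg]
        simpa using hj
      refine h2 ?_
      have := eq_zero_of_forall_ne_zero ((hPτ (i + 1)).comp_mem hN.mem) (hgτ (i + 1)).mem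
        (hg0 _) (fun x hx => hsub ⟨⟨x, hx⟩, rfl⟩) (Pi.single i 1)
      have h3 : τ (i + 1) (Pi.single i 1) = Pi.single i 1 := by
        ext j
        rw [hτ]
        split_ifs with hj
        · rfl
        · rw [Pi.single_eq_of_ne]
          rintro rfl
          omega
      rwa [h3] at this
  exact Order.LTSeries.length_le_krullDim (LTSeries.mk d Z hZ)

end KrullDimension

/-! ### Bases of k⁵, expansion of alternating matrices, the notion of a tabulated pair -/

section Classification

variable {k : Type*} [Field k]

/-- The alternating matrix of `x ∧ y`. -/
def skew (x y : Fin 5 → k) : Fin 5 → Fin 5 → k := fun i j => x i * y j - x j * y i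

theorem skew_apply (x y : Fin 5 → k) (i j : Fin 5) : skew x y i j = x i * y j - x j * y i := rfl

/-- Five vectors spanning `k⁵`. -/
def IsFrame (φ : Fin 5 → Fin 5 → k) : Prop := Submodule.span k (Set.range φ) = ⊤

/-- Changes of basis are certified by writing the old vectors in terms of the new ones: row `i` of
`C` holds the coefficients of `φ i`. No determinant has to be computed. -/
theorem IsFrame.of_coeff {φ ψ : Fin 5 → Fin 5 → k} (h : IsFrame φ) (C : Fin 5 → Fin 5 → k)
    (hC : ∀ i l, ∑ j, C i j * ψ j l = φ i l) : IsFrame ψ := by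
  rw [IsFrame, eq_top_iff, ← h, Submodule.span_le]
  rintro _ ⟨i, rfl⟩
  refine Submodule.mem_span_range_iff_exists_fun k |>.mpr ⟨C i, ?_⟩
  ext l
  simp [← hC i l]

theorem IsFrame.of_forall_exists {φ ψ : Fin 5 → Fin 5 → k} (h : IsFrame φ)
    (hψ : ∀ i, ∃ j, ψ j = φ i) : IsFrame ψ := by
  rw [IsFrame, eq_top_iff, ← h]
  refine Submodule.span_mono ?_
  rintro _ ⟨i, rfl⟩
  exact hψ i

theorem isFrame_iff_det_ne_zero {φ : Fin 5 → Fin 5 → k} :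
    IsFrame φ ↔ (Matrix.of φ).det ≠ 0 := by
  rw [← isUnit_iff_ne_zero, ← Matrix.isUnit_iff_isUnit_det,
    ← Matrix.linearIndependent_rows_iff_isUnit]
  change _ ↔ LinearIndependent k φ
  rw [linearIndependent_iff_card_eq_finrank_span, IsFrame]
  constructor
  · intro h
    rw [Set.finrank, h]
    simp
  · intro h
    refine Submodule.eq_top_of_finrank_eq ?_
    rw [Set.finrank] at h
    rw [← h]
    simp

theorem exists_isFrame_of_skew_ne_zero {y z : Fin 5 → k} (h : skew y z ≠ 0) :
    ∃ x₂ x₃ x₄ : Fin 5 → k, IsFrame ![y, z, x₂, x₃, x₄] := by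
  have h2 : LinearIndependent k ![z, y] := by
    refine LinearIndependent.pair_iff.mpr fun s t hst => ?_
    have hs : ∀ i, s * z i + t * y i = 0 := fun i => by simpa using congrFun hst i
    by_contra hn
    refine h ?_
    ext i j
    rw [skew_apply, Pi.zero_apply, Pi.zero_apply]
    by_cases h' : s = 0
    · have ht : t ≠ 0 := fun ht => hn ⟨h', ht⟩
      refine mul_left_cancel₀ ht ?_
      linear_combination z j * hs i - z i * hs j
    · refine mul_left_cancel₀ h' ?_
      linear_combination y i * hs j - y j * hs i
  obtain ⟨a, ha⟩ := exists_linearIndependent_cons_of_lt_finrank h2 (by simp)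
  obtain ⟨b, hb⟩ := exists_linearIndependent_cons_of_lt_finrank ha (by simp)
  obtain ⟨c, hc⟩ := exists_linearIndependent_cons_of_lt_finrank hb (by simp)
  refine ⟨a, b, c, IsFrame.of_forall_exists
    (hc.span_eq_top_of_card_eq_finrank' (by simp)) fun i => ?_⟩
  fin_cases i
  exacts [⟨4, rfl⟩, ⟨3, rfl⟩, ⟨2, rfl⟩, ⟨1, rfl⟩, ⟨0, rfl⟩]

/-- The zero diagonal is a separate hypothesis because antisymmetry does not imply it in
characteristic two. -/
theorem exists_skew_expansion {φ : Fin 5 → Fin 5 → k} (hφ : IsFrame φ)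
    {A : Fin 5 → Fin 5 → k} (h₀ : ∀ i, A i i = 0) (h₁ : ∀ i j, A j i = -A i j) :
    ∃ c₀₁ c₀₂ c₀₃ c₀₄ c₁₂ c₁₃ c₁₄ c₂₃ c₂₄ c₃₄ : k,
      A = c₀₁ • skew (φ 0) (φ 1) + c₀₂ • skew (φ 0) (φ 2) + c₀₃ • skew (φ 0) (φ 3)
        + c₀₄ • skew (φ 0) (φ 4) + c₁₂ • skew (φ 1) (φ 2) + c₁₃ • skew (φ 1) (φ 3)
        + c₁₄ • skew (φ 1) (φ 4) + c₂₃ • skew (φ 2) (φ 3) + c₂₄ • skew (φ 2) (φ 4)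
        + c₃₄ • skew (φ 3) (φ 4) := by
  have hc : ∀ i : Fin 5, ∃ c : Fin 5 → k, ∑ a, c a • φ a = Pi.single i 1 := fun i =>
    Submodule.mem_span_range_iff_exists_fun k |>.mp (by rw [hφ]; exact Submodule.mem_top)
  choose c hc using hc
  have hc' : ∀ i j, ∑ a, c i a * φ a j = Pi.single (M := fun _ => k) i 1 j := by
    intro i j
    simpa using congrFun (hc i) j
  -- The matrix of the form in the new basis, CᵀAC, where `c` expresses the standard vectors through
  -- `φ`.
  let D : Fin 5 → Fin 5 → k := fun a b =>
    A 0 1 * skew (c · a) (c · b) 0 1 + A 0 2 * skew (c · a) (c · b) 0 2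
      + A 0 3 * skew (c · a) (c · b) 0 3 + A 0 4 * skew (c · a) (c · b) 0 4
      + A 1 2 * skew (c · a) (c · b) 1 2 + A 1 3 * skew (c · a) (c · b) 1 3
      + A 1 4 * skew (c · a) (c · b) 1 4 + A 2 3 * skew (c · a) (c · b) 2 3
      + A 2 4 * skew (c · a) (c · b) 2 4 + A 3 4 * skew (c · a) (c · b) 3 4
  refine ⟨D 0 1, D 0 2, D 0 3, D 0 4, D 1 2, D 1 3, D 1 4, D 2 3, D 2 4, D 3 4, ?_⟩
  have hA : A = A 0 1 • skew (Pi.single 0 1) (Pi.single 1 1)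
      + A 0 2 • skew (Pi.single 0 1) (Pi.single 2 1) + A 0 3 • skew (Pi.single 0 1) (Pi.single 3 1)
      + A 0 4 • skew (Pi.single 0 1) (Pi.single 4 1) + A 1 2 • skew (Pi.single 1 1) (Pi.single 2 1)
      + A 1 3 • skew (Pi.single 1 1) (Pi.single 3 1) + A 1 4 • skew (Pi.single 1 1) (Pi.single 4 1)
      + A 2 3 • skew (Pi.single 2 1) (Pi.single 3 1) + A 2 4 • skew (Pi.single 2 1) (Pi.single 4 1)
      + A 3 4 • skew (Pi.single 3 1) (Pi.single 4 1) := by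
    ext i j
    fin_cases i <;> fin_cases j <;> simp [skew, h₀] <;> exact h₁ _ _
  rw [hA]
  ext i j
  simp only [Pi.add_apply, Pi.smul_apply, smul_eq_mul, skew_apply, ← hc', Fin.sum_univ_five, D]
  ring

/-- The pair of alternating matrices with the shape of the given row of the table. -/
def skewRep (φ : Fin 5 → Fin 5 → k) : OrbitLabel → Fin 2 → Fin 5 → Fin 5 → k
  | .A2_2A1 => ![skew (φ 1) (φ 3) + skew (φ 2) (φ 4), skew (φ 0) (φ 4) + skew (φ 2) (φ 3)]
  | .A2_A1 => ![skew (φ 1) (φ 3) + skew (φ 2) (φ 4), skew (φ 0) (φ 1)]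
  | .A2 => ![skew (φ 1) (φ 3) + skew (φ 2) (φ 4), skew (φ 1) (φ 3)]
  | .threeA1a => ![skew (φ 1) (φ 3) + skew (φ 2) (φ 4), skew (φ 1) (φ 2)]
  | .threeA1b => ![skew (φ 0) (φ 1), skew (φ 0) (φ 2)]
  | .threeA1c =>
    ![skew (φ 1) (φ 3) + skew (φ 2) (φ 4), skew (φ 1) (φ 3) + skew (φ 2) (φ 4)]
  | .twoA1 => ![skew (φ 0) (φ 1), skew (φ 0) (φ 1)]
  | .A1 => ![0, 0]

/-- The pair `skewRep φ i` transformed by a `2 × 2` matrix. -/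
def skewPair (i : OrbitLabel) (m : Matrix (Fin 2) (Fin 2) k) (φ : Fin 5 → Fin 5 → k) (r : Fin 2) :
    Fin 5 → Fin 5 → k :=
  m r 0 • skewRep φ i 0 + m r 1 • skewRep φ i 1

/-- The pair of matrices has one of the shapes in the table. -/
def IsTabulated (A B : Fin 5 → Fin 5 → k) : Prop :=
  ∃ i m φ, Matrix.det m ≠ 0 ∧ IsFrame φ ∧ skewPair i m φ 0 = A ∧ skewPair i m φ 1 = B

theorem IsTabulated.of_mix {A B : Fin 5 → Fin 5 → k} (a b c d : k) (h : a * d - b * c ≠ 0)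
    (ht : IsTabulated (a • A + b • B) (c • A + d • B)) : IsTabulated A B := by
  obtain ⟨i, m, φ, hm, hφ, hA, hB⟩ := ht
  obtain ⟨e, he⟩ : ∃ e, e * (a * d - b * c) = 1 := ⟨_, inv_mul_cancel₀ h⟩
  -- The left factor is the inverse of the mixing matrix, `e` being the inverse of its determinant.
  refine ⟨i, !![d * e, -b * e; -c * e, a * e] * m, φ, ?_, hφ, ?_, ?_⟩
  · rw [Matrix.det_mul]
    refine mul_ne_zero ?_ hm
    rw [Matrix.det_fin_two_of]
    have : d * e * (a * e) - -b * e * (-c * e) = e := by linear_combination e * he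
    rw [this]
    exact left_ne_zero_of_mul_eq_one he
  all_goals
    ext x y
    have h1 := congrFun (congrFun hA x) y
    have h2 := congrFun (congrFun hB x) y
    simp only [skewPair, Pi.add_apply, Pi.smul_apply, smul_eq_mul] at h1 h2
    simp only [skewPair, Pi.add_apply, Pi.smul_apply, smul_eq_mul, Matrix.mul_apply,
      Fin.sum_univ_two, Matrix.of_apply, Matrix.cons_val_zero, Matrix.cons_val_one,
      Matrix.cons_val', Matrix.cons_val_fin_one]
  · linear_combination e * d * h1 - e * b * h2 + A x y * he
  · linear_combination e * a * h2 - e * c * h1 + B x y * he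

theorem isTabulated_smul_smul {ω : Fin 5 → Fin 5 → k} (p q : k) {i : OrbitLabel}
    {φ : Fin 5 → Fin 5 → k} (hφ : IsFrame φ) (h₀ : skewRep φ i 0 = ω) (h₁ : skewRep φ i 1 = ω) :
    IsTabulated (p • ω) (q • ω) := by
  by_cases hp : p = 0
  · by_cases hq : q = 0
    · refine ⟨.A1, 1, φ, by simp, hφ, ?_, ?_⟩ <;> simp [skewPair, skewRep, hp, hq]
    -- Both forms of the shape equal `ω`, so only row sums matter. The remaining freedom makes the
    -- matrix invertible.
    · refine ⟨i, !![-1, 1; q, 0], φ, by simpa [Matrix.det_fin_two_of], hφ, ?_, ?_⟩ <;>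
        simp [skewPair, h₀, h₁, hp]
  · refine ⟨i, !![p, 0; q - 1, 1], φ, by simpa [Matrix.det_fin_two_of], hφ, ?_, ?_⟩
    · simp [skewPair, h₀]
    · simp [skewPair, h₀, h₁, sub_smul]

end Classification

/-! ### Pairs containing a form of rank two -/

section Classification

variable {k : Type*} [Field k]

/-- The first form lies in the ideal generated by the plane of the second. If `e₃` and `e₄` vanish,
the two forms share the factor `x₀ + l • x₁` modulo the second form, giving `threeA1b`. Otherwise
`e₃ • x₃ + e₄ • x₄` is a new direction, giving `threeA1a`. -/
theorem isTabulated_of_pivot_aux {x₀ x₁ x₂ x₃ x₄ : Fin 5 → k}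
    (hx : IsFrame ![x₀, x₁, x₂, x₃, x₄]) (c l e₃ e₄ : k) :
    IsTabulated (c • skew x₀ x₁ + skew (x₀ + l • x₁) x₂ + e₃ • skew x₁ x₃ + e₄ • skew x₁ x₄)
      (skew x₀ x₁) := by
  by_cases h₃ : e₃ = 0
  · by_cases h₄ : e₄ = 0
    · refine ⟨.threeA1b, !![1, c; 0, 1], ![x₀ + l • x₁, x₂, x₁, x₃, x₄], by simp, ?_, ?_, ?_⟩
      · refine hx.of_coeff ![![1, 0, -l, 0, 0], ![0, 0, 1, 0, 0], ![0, 1, 0, 0, 0],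
          ![0, 0, 0, 1, 0], ![0, 0, 0, 0, 1]] fun i l => ?_
        fin_cases i <;> simp [Fin.sum_univ_five]
      · ext i j
        simp [skewPair, skewRep, skew_apply, h₃, h₄]
        ring
      · ext i j
        simp [skewPair, skewRep, skew_apply]
        ring
    · refine ⟨.threeA1a, !![1, c; 0, 1], ![x₃, x₀ + l • x₁, x₁, x₂, e₃ • x₃ + e₄ • x₄],
        by simp, ?_, ?_, ?_⟩
      · refine hx.of_coeff ![![0, 1, -l, 0, 0], ![0, 0, 1, 0, 0], ![0, 0, 0, 1, 0],
          ![1, 0, 0, 0, 0], ![-e₃ / e₄, 0, 0, 0, 1 / e₄]] fun i l => ?_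
        fin_cases i <;> simp [Fin.sum_univ_five]
        field_simp
        ring
      · ext i j
        simp [skewPair, skewRep, skew_apply]
        ring
      · ext i j
        simp [skewPair, skewRep, skew_apply]
        ring
  · refine ⟨.threeA1a, !![1, c; 0, 1], ![x₄, x₀ + l • x₁, x₁, x₂, e₃ • x₃ + e₄ • x₄],
        by simp, ?_, ?_, ?_⟩
    · refine hx.of_coeff ![![0, 1, -l, 0, 0], ![0, 0, 1, 0, 0], ![0, 0, 0, 1, 0],
          ![-e₄ / e₃, 0, 0, 0, 1 / e₃], ![1, 0, 0, 0, 0]] fun i l => ?_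
      fin_cases i <;> simp [Fin.sum_univ_five]
      field_simp
      ring
    · ext i j
      simp [skewPair, skewRep, skew_apply]
      ring
    · ext i j
      simp [skewPair, skewRep, skew_apply]
      ring

theorem isTabulated_of_pivot {x₀ x₁ x₂ x₃ x₄ : Fin 5 → k}
    (hx : IsFrame ![x₀, x₁, x₂, x₃, x₄]) (c₀₁ c₀₂ c₀₃ c₀₄ c₁₂ c₁₃ c₁₄ : k) (h : c₀₂ ≠ 0) :
    IsTabulated (c₀₁ • skew x₀ x₁ + c₀₂ • skew x₀ x₂ + c₀₃ • skew x₀ x₃ + c₀₄ • skew x₀ x₄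
      + c₁₂ • skew x₁ x₂ + c₁₃ • skew x₁ x₃ + c₁₄ • skew x₁ x₄) (skew x₀ x₁) := by
  have hy : IsFrame ![x₀, x₁, c₀₂ • x₂ + c₀₃ • x₃ + c₀₄ • x₄, x₃, x₄] := by
    refine hx.of_coeff ![![1, 0, 0, 0, 0], ![0, 1, 0, 0, 0],
      ![0, 0, 1 / c₀₂, -c₀₃ / c₀₂, -c₀₄ / c₀₂],
      ![0, 0, 0, 1, 0], ![0, 0, 0, 0, 1]] fun i l => ?_
    fin_cases i <;> simp [Fin.sum_univ_five]
    field_simp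
    ring
  convert isTabulated_of_pivot_aux hy c₀₁ (c₁₂ / c₀₂) (c₁₃ - c₁₂ * c₀₃ / c₀₂)
    (c₁₄ - c₁₂ * c₀₄ / c₀₂) using 1
  ext i j
  simp [skew_apply]
  field_simp
  ring

/-- Here the first form is nonzero modulo the plane of the second. Splitting off a product `skew p
q` leaves a form in `x₀, x₁, x₄`. Its part involving `x₄` decides between `A2` and `A2_A1`. -/
theorem isTabulated_of_pivot_complement {x₀ x₁ x₂ x₃ x₄ : Fin 5 → k}
    (hx : IsFrame ![x₀, x₁, x₂, x₃, x₄]) (c₀₁ c₀₂ c₀₃ c₀₄ c₁₂ c₁₃ c₁₄ c₂₃ c₂₄ c₃₄ : k)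
    (h : c₂₃ ≠ 0) :
    IsTabulated (c₀₁ • skew x₀ x₁ + c₀₂ • skew x₀ x₂ + c₀₃ • skew x₀ x₃ + c₀₄ • skew x₀ x₄
      + c₁₂ • skew x₁ x₂ + c₁₃ • skew x₁ x₃ + c₁₄ • skew x₁ x₄ + c₂₃ • skew x₂ x₃
      + c₂₄ • skew x₂ x₄ + c₃₄ • skew x₃ x₄) (skew x₀ x₁) := by
  -- `p` and `q` are the contractions with the dual vectors of `x₂` and `x₃`, the first divided by
  -- the pivot.
  obtain ⟨p, hp⟩ : ∃ p, p = (1 / c₂₃) • (-c₀₂ • x₀ + -c₁₂ • x₁ + c₂₃ • x₃ + c₂₄ • x₄) := ⟨_, rfl⟩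
  obtain ⟨q, hq⟩ : ∃ q, q = -c₀₃ • x₀ + -c₁₃ • x₁ + -c₂₃ • x₂ + c₃₄ • x₄ := ⟨_, rfl⟩
  obtain ⟨d₀₁, d₀₄, d₁₄, hA⟩ : ∃ d₀₁ d₀₄ d₁₄ : k,
      c₀₁ • skew x₀ x₁ + c₀₂ • skew x₀ x₂ + c₀₃ • skew x₀ x₃ + c₀₄ • skew x₀ x₄
      + c₁₂ • skew x₁ x₂ + c₁₃ • skew x₁ x₃ + c₁₄ • skew x₁ x₄ + c₂₃ • skew x₂ x₃
      + c₂₄ • skew x₂ x₄ + c₃₄ • skew x₃ x₄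
      = skew p q + d₀₁ • skew x₀ x₁ + d₀₄ • skew x₀ x₄ + d₁₄ • skew x₁ x₄ := by
    refine ⟨c₀₁ - (c₀₂ * c₁₃ - c₁₂ * c₀₃) / c₂₃, c₀₄ + (c₀₂ * c₃₄ - c₂₄ * c₀₃) / c₂₃,
      c₁₄ + (c₁₂ * c₃₄ - c₂₄ * c₁₃) / c₂₃, ?_⟩
    ext i j
    simp [skew_apply, hp, hq]
    field_simp
    ring
  rw [hA]
  have hy : IsFrame ![x₀, x₁, p, q, x₄] := by
    refine hx.of_coeff ![![1, 0, 0, 0, 0], ![0, 1, 0, 0, 0],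
      ![-c₀₃ / c₂₃, -c₁₃ / c₂₃, 0, -1 / c₂₃, c₃₄ / c₂₃],
      ![c₀₂ / c₂₃, c₁₂ / c₂₃, 1, 0, -c₂₄ / c₂₃], ![0, 0, 0, 0, 1]] fun i l => ?_
    fin_cases i <;> simp [Fin.sum_univ_five, hp, hq] <;> field_simp <;> ring
  by_cases h₀ : d₀₄ = 0
  · by_cases h₁ : d₁₄ = 0
    · refine ⟨.A2, !![1, d₀₁ - 1; 0, 1], ![x₄, x₀, p, x₁, q], by simp, ?_, ?_, ?_⟩
      · refine hy.of_forall_exists fun i => ?_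
        fin_cases i
        exacts [⟨1, rfl⟩, ⟨3, rfl⟩, ⟨2, rfl⟩, ⟨4, rfl⟩, ⟨0, rfl⟩]
      · ext i j
        simp [skewPair, skewRep, skew_apply, h₀, h₁]
        ring
      · ext i j
        simp [skewPair, skewRep, skew_apply]
    · refine ⟨.A2_A1, !![1, d₀₁; 0, 1], ![(1 / d₁₄) • x₀, d₁₄ • x₁, p, x₄, q], by simp, ?_, ?_, ?_⟩
      · refine hy.of_coeff ![![d₁₄, 0, 0, 0, 0], ![0, 1 / d₁₄, 0, 0, 0], ![0, 0, 1, 0, 0],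
          ![0, 0, 0, 0, 1], ![0, 0, 0, 1, 0]] fun i l => ?_
        fin_cases i <;> simp [Fin.sum_univ_five] <;> field_simp
      · ext i j
        simp [skewPair, skewRep, skew_apply, h₀]
        field_simp
        ring
      · ext i j
        simp [skewPair, skewRep, skew_apply]
        field_simp
  -- The terms in `x₄` combine to one product with factor `d₀₄ • x₀ + d₁₄ • x₁`. The scalar on `x₁`
  -- keeps the second form equal to `skew x₀ x₁`.
  · refine ⟨.A2_A1, !![1, d₀₁; 0, 1], ![(-1 / d₀₄) • x₁, d₀₄ • x₀ + d₁₄ • x₁, p, x₄, q],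
      by simp, ?_, ?_, ?_⟩
    · refine hy.of_coeff ![![d₁₄, 1 / d₀₄, 0, 0, 0], ![-d₀₄, 0, 0, 0, 0], ![0, 0, 1, 0, 0],
          ![0, 0, 0, 0, 1], ![0, 0, 0, 1, 0]] fun i l => ?_
      fin_cases i <;> simp [Fin.sum_univ_five] <;> field_simp
      ring
    · ext i j
      simp [skewPair, skewRep, skew_apply]
      field_simp
      ring
    · ext i j
      simp [skewPair, skewRep, skew_apply]
      field_simp
      ring

/-- A pair of alternating matrices the second of which has rank two is tabulated. -/
theorem isTabulated_skew {x₀ x₁ x₂ x₃ x₄ : Fin 5 → k} (hx : IsFrame ![x₀, x₁, x₂, x₃, x₄])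
    {A : Fin 5 → Fin 5 → k} (h₀ : ∀ i, A i i = 0) (h₁ : ∀ i j, A j i = -A i j) :
    IsTabulated A (skew x₀ x₁) := by
  obtain ⟨c₀₁, c₀₂, c₀₃, c₀₄, c₁₂, c₁₃, c₁₄, c₂₃, c₂₄, c₃₄, hA⟩ := exists_skew_expansion hx h₀ h₁
  simp only [Matrix.cons_val] at hA
  by_cases h₂₃ : c₂₃ ≠ 0
  · rw [hA]
    exact isTabulated_of_pivot_complement hx _ _ _ _ _ _ _ _ _ _ h₂₃
  by_cases h₂₄ : c₂₄ ≠ 0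
  · have hy : IsFrame ![x₀, x₁, x₂, x₄, x₃] := by
      refine hx.of_forall_exists fun i => ?_
      fin_cases i
      exacts [⟨0, rfl⟩, ⟨1, rfl⟩, ⟨2, rfl⟩, ⟨4, rfl⟩, ⟨3, rfl⟩]
    convert isTabulated_of_pivot_complement hy c₀₁ c₀₂ c₀₄ c₀₃ c₁₂ c₁₄ c₁₃ c₂₄ c₂₃ (-c₃₄) h₂₄
      using 1
    rw [hA]
    ext i j
    simp [skew_apply]
    ring
  by_cases h₃₄ : c₃₄ ≠ 0
  · have hy : IsFrame ![x₀, x₁, x₃, x₄, x₂] := by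
      refine hx.of_forall_exists fun i => ?_
      fin_cases i
      exacts [⟨0, rfl⟩, ⟨1, rfl⟩, ⟨4, rfl⟩, ⟨2, rfl⟩, ⟨3, rfl⟩]
    convert isTabulated_of_pivot_complement hy c₀₁ c₀₃ c₀₄ c₀₂ c₁₃ c₁₄ c₁₂ c₃₄ (-c₂₃) (-c₂₄) h₃₄
      using 1
    rw [hA]
    ext i j
    simp [skew_apply]
    ring
  -- From here on the form `A` lies in the ideal generated by `x₀` and `x₁`.
  push Not at h₂₃ h₂₄ h₃₄
  have hneg : skew x₁ (-x₀) = skew x₀ x₁ := by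
    ext i j
    simp [skew_apply]
    ring
  by_cases h₀₂ : c₀₂ ≠ 0
  · convert isTabulated_of_pivot hx c₀₁ c₀₂ c₀₃ c₀₄ c₁₂ c₁₃ c₁₄ h₀₂ using 1
    simp [hA, h₂₃, h₂₄, h₃₄]
  by_cases h₀₃ : c₀₃ ≠ 0
  · have hy : IsFrame ![x₀, x₁, x₃, x₂, x₄] := by
      refine hx.of_forall_exists fun i => ?_
      fin_cases i
      exacts [⟨0, rfl⟩, ⟨1, rfl⟩, ⟨3, rfl⟩, ⟨2, rfl⟩, ⟨4, rfl⟩]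
    convert isTabulated_of_pivot hy c₀₁ c₀₃ c₀₂ c₀₄ c₁₃ c₁₂ c₁₄ h₀₃ using 1
    simp only [hA, h₂₃, h₂₄, h₃₄]
    module
  by_cases h₀₄ : c₀₄ ≠ 0
  · have hy : IsFrame ![x₀, x₁, x₄, x₃, x₂] := by
      refine hx.of_forall_exists fun i => ?_
      fin_cases i
      exacts [⟨0, rfl⟩, ⟨1, rfl⟩, ⟨4, rfl⟩, ⟨3, rfl⟩, ⟨2, rfl⟩]
    convert isTabulated_of_pivot hy c₀₁ c₀₄ c₀₃ c₀₂ c₁₄ c₁₃ c₁₂ h₀₄ using 1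
    simp only [hA, h₂₃, h₂₄, h₃₄]
    module
  push Not at h₀₂ h₀₃ h₀₄
  have hswap : ∀ {y z t : Fin 5 → k} (_ : IsFrame ![x₀, x₁, y, z, t]),
      IsFrame ![x₁, -x₀, y, z, t] := by
    intro y z t hy
    refine hy.of_coeff ![![0, -1, 0, 0, 0], ![1, 0, 0, 0, 0], ![0, 0, 1, 0, 0],
      ![0, 0, 0, 1, 0], ![0, 0, 0, 0, 1]] fun i l => ?_
    fin_cases i <;> simp [Fin.sum_univ_five]
  by_cases h₁₂ : c₁₂ ≠ 0
  · convert isTabulated_of_pivot (hswap hx) c₀₁ c₁₂ c₁₃ c₁₄ 0 0 0 h₁₂ using 1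
    · simp only [hA, h₂₃, h₂₄, h₃₄, h₀₂, h₀₃, h₀₄, hneg]
      module
    · exact hneg.symm
  by_cases h₁₃ : c₁₃ ≠ 0
  · have hy : IsFrame ![x₀, x₁, x₃, x₂, x₄] := by
      refine hx.of_forall_exists fun i => ?_
      fin_cases i
      exacts [⟨0, rfl⟩, ⟨1, rfl⟩, ⟨3, rfl⟩, ⟨2, rfl⟩, ⟨4, rfl⟩]
    convert isTabulated_of_pivot (hswap hy) c₀₁ c₁₃ c₁₂ c₁₄ 0 0 0 h₁₃ using 1
    · simp only [hA, h₂₃, h₂₄, h₃₄, h₀₂, h₀₃, h₀₄, hneg]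
      module
    · exact hneg.symm
  by_cases h₁₄ : c₁₄ ≠ 0
  · have hy : IsFrame ![x₀, x₁, x₄, x₃, x₂] := by
      refine hx.of_forall_exists fun i => ?_
      fin_cases i
      exacts [⟨0, rfl⟩, ⟨1, rfl⟩, ⟨4, rfl⟩, ⟨3, rfl⟩, ⟨2, rfl⟩]
    convert isTabulated_of_pivot (hswap hy) c₀₁ c₁₄ c₁₃ c₁₂ 0 0 0 h₁₄ using 1
    · simp only [hA, h₂₃, h₂₄, h₃₄, h₀₂, h₀₃, h₀₄, hneg]
      module
    · exact hneg.symm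
  push Not at h₁₂ h₁₃ h₁₄
  convert isTabulated_smul_smul (ω := skew x₀ x₁) (i := .twoA1) c₀₁ 1 hx rfl rfl using 1
  · simp only [hA, h₂₃, h₂₄, h₃₄, h₀₂, h₀₃, h₀₄, h₁₂, h₁₃, h₁₄]
    module
  · simp

end Classification

/-! ### Normal form of one alternating form, and pairs containing a form of rank four -/

section Classification

variable {k : Type*} [Field k]

/-- A skew form is zero, of rank two, or of rank four. -/
def HasSkewNormalForm (A : Fin 5 → Fin 5 → k) : Prop :=
  ∃ x₀ x₁ x₂ x₃ x₄ : Fin 5 → k, IsFrame ![x₀, x₁, x₂, x₃, x₄] ∧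
    (A = 0 ∨ A = skew x₀ x₁ ∨ A = skew x₀ x₁ + skew x₂ x₃)

theorem hasSkewNormalForm_of_pivots {x₀ x₁ x₂ x₃ x₄ : Fin 5 → k}
    (hx : IsFrame ![x₀, x₁, x₂, x₃, x₄]) {b c d : k} (hb : b ≠ 0) :
    HasSkewNormalForm (skew x₀ x₁ + b • skew x₂ x₃ + c • skew x₂ x₄ + d • skew x₃ x₄) := by
  refine ⟨x₀, x₁, (1 / b) • (b • x₃ + c • x₄), -b • x₂ + d • x₄, x₄, ?_, .inr (.inr ?_)⟩
  · refine hx.of_coeff ![![1, 0, 0, 0, 0], ![0, 1, 0, 0, 0], ![0, 0, 0, -1 / b, d / b],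
      ![0, 0, 1, 0, -c / b], ![0, 0, 0, 0, 1]] fun i l => ?_
    fin_cases i <;> simp [Fin.sum_univ_five] <;> field_simp <;> ring
  · ext i j
    simp [skew_apply]
    field_simp
    ring

/-- One step of symplectic elimination: the two contractions indexed by the pivot split off a
product. The rest is a form in three variables, which is always decomposable. -/
theorem hasSkewNormalForm_of_pivot {x₀ x₁ x₂ x₃ x₄ : Fin 5 → k}
    (hx : IsFrame ![x₀, x₁, x₂, x₃, x₄]) (c₀₁ c₀₂ c₀₃ c₀₄ c₁₂ c₁₃ c₁₄ c₂₃ c₂₄ c₃₄ : k)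
    (h : c₀₁ ≠ 0) :
    HasSkewNormalForm (c₀₁ • skew x₀ x₁ + c₀₂ • skew x₀ x₂ + c₀₃ • skew x₀ x₃ + c₀₄ • skew x₀ x₄
      + c₁₂ • skew x₁ x₂ + c₁₃ • skew x₁ x₃ + c₁₄ • skew x₁ x₄ + c₂₃ • skew x₂ x₃
      + c₂₄ • skew x₂ x₄ + c₃₄ • skew x₃ x₄) := by
  obtain ⟨p, hp⟩ : ∃ p, p = (1 / c₀₁) • (c₀₁ • x₁ + c₀₂ • x₂ + c₀₃ • x₃ + c₀₄ • x₄) := ⟨_, rfl⟩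
  obtain ⟨q, hq⟩ : ∃ q, q = -c₀₁ • x₀ + c₁₂ • x₂ + c₁₃ • x₃ + c₁₄ • x₄ := ⟨_, rfl⟩
  obtain ⟨b, c, d, hA⟩ : ∃ b c d : k,
      c₀₁ • skew x₀ x₁ + c₀₂ • skew x₀ x₂ + c₀₃ • skew x₀ x₃ + c₀₄ • skew x₀ x₄
      + c₁₂ • skew x₁ x₂ + c₁₃ • skew x₁ x₃ + c₁₄ • skew x₁ x₄ + c₂₃ • skew x₂ x₃
      + c₂₄ • skew x₂ x₄ + c₃₄ • skew x₃ x₄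
      = skew p q + b • skew x₂ x₃ + c • skew x₂ x₄ + d • skew x₃ x₄ := by
    refine ⟨c₂₃ - (c₀₂ * c₁₃ - c₁₂ * c₀₃) / c₀₁, c₂₄ - (c₀₂ * c₁₄ - c₁₂ * c₀₄) / c₀₁,
      c₃₄ - (c₀₃ * c₁₄ - c₁₃ * c₀₄) / c₀₁, ?_⟩
    ext i j
    simp [skew_apply, hp, hq]
    field_simp
    ring
  rw [hA]
  have hy : IsFrame ![p, q, x₂, x₃, x₄] := by
    refine hx.of_coeff ![![0, -1 / c₀₁, c₁₂ / c₀₁, c₁₃ / c₀₁, c₁₄ / c₀₁],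
      ![1, 0, -c₀₂ / c₀₁, -c₀₃ / c₀₁, -c₀₄ / c₀₁], ![0, 0, 1, 0, 0],
      ![0, 0, 0, 1, 0], ![0, 0, 0, 0, 1]] fun i l => ?_
    fin_cases i <;> simp [Fin.sum_univ_five, hp, hq] <;> field_simp <;> ring
  by_cases hb : b ≠ 0
  · exact hasSkewNormalForm_of_pivots hy hb
  by_cases hc : c ≠ 0
  · have hz : IsFrame ![p, q, x₂, x₄, x₃] := by
      refine hy.of_forall_exists fun i => ?_
      fin_cases i
      exacts [⟨0, rfl⟩, ⟨1, rfl⟩, ⟨2, rfl⟩, ⟨4, rfl⟩, ⟨3, rfl⟩]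
    convert hasSkewNormalForm_of_pivots hz (c := b) (d := -d) hc using 1
    ext i j
    simp [skew_apply]
    ring
  by_cases hd : d ≠ 0
  · have hz : IsFrame ![p, q, x₃, x₄, x₂] := by
      refine hy.of_forall_exists fun i => ?_
      fin_cases i
      exacts [⟨0, rfl⟩, ⟨1, rfl⟩, ⟨4, rfl⟩, ⟨2, rfl⟩, ⟨3, rfl⟩]
    convert hasSkewNormalForm_of_pivots hz (c := -b) (d := -c) hd using 1
    ext i j
    simp [skew_apply]
    ring
  push Not at hb hc hd
  exact ⟨_, _, _, _, _, hy, .inr (.inl (by simp [hb, hc, hd]))⟩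

theorem isFrame_standard :
    IsFrame ![Pi.single 0 (1 : k), Pi.single 1 1, Pi.single 2 1, Pi.single 3 1, Pi.single 4 1] := by
  have h := (Pi.basisFun k (Fin 5)).span_eq
  refine IsFrame.of_forall_exists (φ := Pi.basisFun k (Fin 5)) h fun i => ⟨i, ?_⟩
  rw [Pi.basisFun_apply]
  fin_cases i <;> rfl

theorem hasSkewNormalForm {A : Fin 5 → Fin 5 → k} (h₀ : ∀ i, A i i = 0)
    (h₁ : ∀ i j, A j i = -A i j) : HasSkewNormalForm A := by
  have hx := isFrame_standard (k := k)
  obtain ⟨c₀₁, c₀₂, c₀₃, c₀₄, c₁₂, c₁₃, c₁₄, c₂₃, c₂₄, c₃₄, hA⟩ := exists_skew_expansion hx h₀ h₁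
  generalize (Pi.single 0 1 : Fin 5 → k) = x₀ at hx hA
  generalize (Pi.single 1 1 : Fin 5 → k) = x₁ at hx hA
  generalize (Pi.single 2 1 : Fin 5 → k) = x₂ at hx hA
  generalize (Pi.single 3 1 : Fin 5 → k) = x₃ at hx hA
  generalize (Pi.single 4 1 : Fin 5 → k) = x₄ at hx hA
  simp only [Matrix.cons_val] at hA
  by_cases h₀₁ : c₀₁ ≠ 0
  · rw [hA]
    exact hasSkewNormalForm_of_pivot hx _ _ _ _ _ _ _ _ _ _ h₀₁
  by_cases h₀₂ : c₀₂ ≠ 0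
  · have hy : IsFrame ![x₀, x₂, x₁, x₃, x₄] := by
      refine hx.of_forall_exists fun i => ?_
      fin_cases i
      exacts [⟨0, rfl⟩, ⟨2, rfl⟩, ⟨1, rfl⟩, ⟨3, rfl⟩, ⟨4, rfl⟩]
    convert hasSkewNormalForm_of_pivot hy c₀₂ c₀₁ c₀₃ c₀₄ (-c₁₂) c₂₃ c₂₄ c₁₃ c₁₄ c₃₄
      h₀₂ using 1
    rw [hA]
    ext i j
    simp [skew_apply]
    ring
  by_cases h₀₃ : c₀₃ ≠ 0
  · have hy : IsFrame ![x₀, x₃, x₁, x₂, x₄] := by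
      refine hx.of_forall_exists fun i => ?_
      fin_cases i
      exacts [⟨0, rfl⟩, ⟨2, rfl⟩, ⟨3, rfl⟩, ⟨1, rfl⟩, ⟨4, rfl⟩]
    convert hasSkewNormalForm_of_pivot hy c₀₃ c₀₁ c₀₂ c₀₄ (-c₁₃) (-c₂₃) c₃₄ c₁₂ c₁₄ c₂₄
      h₀₃ using 1
    rw [hA]
    ext i j
    simp [skew_apply]
    ring
  by_cases h₀₄ : c₀₄ ≠ 0
  · have hy : IsFrame ![x₀, x₄, x₁, x₂, x₃] := by
      refine hx.of_forall_exists fun i => ?_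
      fin_cases i
      exacts [⟨0, rfl⟩, ⟨2, rfl⟩, ⟨3, rfl⟩, ⟨4, rfl⟩, ⟨1, rfl⟩]
    convert hasSkewNormalForm_of_pivot hy c₀₄ c₀₁ c₀₂ c₀₃ (-c₁₄) (-c₂₄) (-c₃₄) c₁₂ c₁₃ c₂₃
      h₀₄ using 1
    rw [hA]
    ext i j
    simp [skew_apply]
    ring
  by_cases h₁₂ : c₁₂ ≠ 0
  · have hy : IsFrame ![x₁, x₂, x₀, x₃, x₄] := by
      refine hx.of_forall_exists fun i => ?_
      fin_cases i
      exacts [⟨2, rfl⟩, ⟨0, rfl⟩, ⟨1, rfl⟩, ⟨3, rfl⟩, ⟨4, rfl⟩]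
    convert hasSkewNormalForm_of_pivot hy c₁₂ (-c₀₁) c₁₃ c₁₄ (-c₀₂) c₂₃ c₂₄ c₀₃ c₀₄ c₃₄
      h₁₂ using 1
    rw [hA]
    ext i j
    simp [skew_apply]
    ring
  by_cases h₁₃ : c₁₃ ≠ 0
  · have hy : IsFrame ![x₁, x₃, x₀, x₂, x₄] := by
      refine hx.of_forall_exists fun i => ?_
      fin_cases i
      exacts [⟨2, rfl⟩, ⟨0, rfl⟩, ⟨3, rfl⟩, ⟨1, rfl⟩, ⟨4, rfl⟩]
    convert hasSkewNormalForm_of_pivot hy c₁₃ (-c₀₁) c₁₂ c₁₄ (-c₀₃) (-c₂₃) c₃₄ c₀₂ c₀₄ c₂₄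
      h₁₃ using 1
    rw [hA]
    ext i j
    simp [skew_apply]
    ring
  by_cases h₁₄ : c₁₄ ≠ 0
  · have hy : IsFrame ![x₁, x₄, x₀, x₂, x₃] := by
      refine hx.of_forall_exists fun i => ?_
      fin_cases i
      exacts [⟨2, rfl⟩, ⟨0, rfl⟩, ⟨3, rfl⟩, ⟨4, rfl⟩, ⟨1, rfl⟩]
    convert hasSkewNormalForm_of_pivot hy c₁₄ (-c₀₁) c₁₂ c₁₃ (-c₀₄) (-c₂₄) (-c₃₄) c₀₂ c₀₃ c₂₃
      h₁₄ using 1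
    rw [hA]
    ext i j
    simp [skew_apply]
    ring
  by_cases h₂₃ : c₂₃ ≠ 0
  · have hy : IsFrame ![x₂, x₃, x₀, x₁, x₄] := by
      refine hx.of_forall_exists fun i => ?_
      fin_cases i
      exacts [⟨2, rfl⟩, ⟨3, rfl⟩, ⟨0, rfl⟩, ⟨1, rfl⟩, ⟨4, rfl⟩]
    convert hasSkewNormalForm_of_pivot hy c₂₃ (-c₀₂) (-c₁₂) c₂₄ (-c₀₃) (-c₁₃) c₃₄ c₀₁ c₀₄ c₁₄
      h₂₃ using 1
    rw [hA]
    ext i j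
    simp [skew_apply]
    ring
  by_cases h₂₄ : c₂₄ ≠ 0
  · have hy : IsFrame ![x₂, x₄, x₀, x₁, x₃] := by
      refine hx.of_forall_exists fun i => ?_
      fin_cases i
      exacts [⟨2, rfl⟩, ⟨3, rfl⟩, ⟨0, rfl⟩, ⟨4, rfl⟩, ⟨1, rfl⟩]
    convert hasSkewNormalForm_of_pivot hy c₂₄ (-c₀₂) (-c₁₂) c₂₃ (-c₀₄) (-c₁₄) (-c₃₄) c₀₁ c₀₃ c₁₃
      h₂₄ using 1
    rw [hA]
    ext i j
    simp [skew_apply]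
    ring
  by_cases h₃₄ : c₃₄ ≠ 0
  · have hy : IsFrame ![x₃, x₄, x₀, x₁, x₂] := by
      refine hx.of_forall_exists fun i => ?_
      fin_cases i
      exacts [⟨2, rfl⟩, ⟨3, rfl⟩, ⟨4, rfl⟩, ⟨0, rfl⟩, ⟨1, rfl⟩]
    convert hasSkewNormalForm_of_pivot hy c₃₄ (-c₀₃) (-c₁₃) (-c₂₃) (-c₀₄) (-c₁₄) (-c₂₄) c₀₁ c₀₂ c₁₂
      h₃₄ using 1
    rw [hA]
    ext i j
    simp [skew_apply]
    ring
  push Not at h₀₁ h₀₂ h₀₃ h₀₄ h₁₂ h₁₃ h₁₄ h₂₃ h₂₄ h₃₄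
  exact ⟨_, _, _, _, _, hx, .inl (by simp [hA, h₀₁, h₀₂, h₀₃, h₀₄, h₁₂, h₁₃, h₁₄, h₂₃, h₂₄, h₃₄])⟩

/-- The Plücker relation in four variables. -/
theorem exists_skew_of_plucker (x₀ x₁ x₂ x₃ : Fin 5 → k) (c₀₁ c₀₂ c₀₃ c₁₂ c₁₃ c₂₃ : k)
    (h : c₀₁ * c₂₃ - c₀₂ * c₁₃ + c₀₃ * c₁₂ = 0) :
    ∃ y z : Fin 5 → k, c₀₁ • skew x₀ x₁ + c₀₂ • skew x₀ x₂ + c₀₃ • skew x₀ x₃ + c₁₂ • skew x₁ x₂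
      + c₁₃ • skew x₁ x₃ + c₂₃ • skew x₂ x₃ = skew y z := by
  by_cases h₀₁ : c₀₁ ≠ 0
  -- In each case the factors are the contractions with the two dual vectors of the pivot. The
  -- relation cancels what elimination leaves in the complementary two variables.
  · refine ⟨(1 / c₀₁) • (c₀₁ • x₁ + c₀₂ • x₂ + c₀₃ • x₃), -c₀₁ • x₀ + c₁₂ • x₂ + c₁₃ • x₃, ?_⟩
    ext i j
    simp [skew_apply]
    field_simp
    linear_combination ((x₂ i * x₃ j - x₂ j * x₃ i)) * h
  by_cases h₀₂ : c₀₂ ≠ 0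
  · refine ⟨(1 / c₀₂) • (c₀₁ • x₁ + c₀₂ • x₂ + c₀₃ • x₃), -c₀₂ • x₀ + -c₁₂ • x₁ + c₂₃ • x₃, ?_⟩
    ext i j
    simp [skew_apply]
    field_simp
    linear_combination (-(x₁ i * x₃ j - x₁ j * x₃ i)) * h
  by_cases h₀₃ : c₀₃ ≠ 0
  · refine ⟨(1 / c₀₃) • (c₀₁ • x₁ + c₀₂ • x₂ + c₀₃ • x₃), -c₀₃ • x₀ + -c₁₃ • x₁ + -c₂₃ • x₂, ?_⟩
    ext i j
    simp [skew_apply]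
    field_simp
    linear_combination ((x₁ i * x₂ j - x₁ j * x₂ i)) * h
  by_cases h₁₂ : c₁₂ ≠ 0
  · refine ⟨(1 / c₁₂) • (-c₀₁ • x₀ + c₁₂ • x₂ + c₁₃ • x₃), -c₀₂ • x₀ + -c₁₂ • x₁ + c₂₃ • x₃, ?_⟩
    ext i j
    simp [skew_apply]
    field_simp
    linear_combination ((x₀ i * x₃ j - x₀ j * x₃ i)) * h
  by_cases h₁₃ : c₁₃ ≠ 0
  · refine ⟨(1 / c₁₃) • (-c₀₁ • x₀ + c₁₂ • x₂ + c₁₃ • x₃), -c₀₃ • x₀ + -c₁₃ • x₁ + -c₂₃ • x₂, ?_⟩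
    ext i j
    simp [skew_apply]
    field_simp
    linear_combination (-(x₀ i * x₂ j - x₀ j * x₂ i)) * h
  by_cases h₂₃ : c₂₃ ≠ 0
  · refine ⟨(1 / c₂₃) • (-c₀₂ • x₀ + -c₁₂ • x₁ + c₂₃ • x₃), -c₀₃ • x₀ + -c₁₃ • x₁ + -c₂₃ • x₂, ?_⟩
    ext i j
    simp [skew_apply]
    field_simp
    linear_combination ((x₀ i * x₁ j - x₀ j * x₁ i)) * h
  push Not at h₀₁ h₀₂ h₀₃ h₁₂ h₁₃ h₂₃
  refine ⟨0, 0, ?_⟩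
  ext i j
  simp [skew_apply, h₀₁, h₀₂, h₀₃, h₁₂, h₁₃, h₂₃]

/-- A pair of alternating matrices a combination of which has rank at most two is tabulated. -/
theorem isTabulated_of_sub_smul_eq_skew {A B : Fin 5 → Fin 5 → k} (hA₀ : ∀ i, A i i = 0)
    (hA₁ : ∀ i j, A j i = -A i j) {t : k} {y z : Fin 5 → k} (h : B - t • A = skew y z) :
    IsTabulated A B := by
  have hB : B = t • A + skew y z := by rw [← h]; abel
  by_cases hyz : skew y z = 0
  · rw [hyz, add_zero] at hB
    obtain ⟨x₀, x₁, x₂, x₃, x₄, hx, rfl | rfl | rfl⟩ := hasSkewNormalForm hA₀ hA₁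
    · rw [hB]
      convert isTabulated_smul_smul (ω := (0 : Fin 5 → Fin 5 → k)) (i := .A1) 1 t hx rfl rfl using 1
      simp
    · rw [hB]
      convert isTabulated_smul_smul (ω := skew x₀ x₁) (i := .twoA1) 1 t hx rfl rfl using 1
      simp
    · have hy : IsFrame ![x₄, x₀, x₂, x₁, x₃] := by
        refine hx.of_forall_exists fun i => ?_
        fin_cases i
        exacts [⟨1, rfl⟩, ⟨3, rfl⟩, ⟨2, rfl⟩, ⟨4, rfl⟩, ⟨0, rfl⟩]
      rw [hB]
      convert isTabulated_smul_smul (ω := skew x₀ x₁ + skew x₂ x₃) (i := .threeA1c) 1 t hy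
        rfl rfl using 1
      simp
  · obtain ⟨x₂, x₃, x₄, hx⟩ := exists_isFrame_of_skew_ne_zero hyz
    -- Replaces the pair by `A` and `B - t • A`, the second of which has rank two.
    refine .of_mix 1 0 (-t) 1 (by simp) ?_
    convert isTabulated_skew hx hA₀ hA₁ using 1
    · module
    · rw [hB]
      module

theorem isTabulated_generic {x₀ x₁ x₂ x₃ x₄ : Fin 5 → k} (hx : IsFrame ![x₀, x₁, x₂, x₃, x₄])
    (t : k) :
    IsTabulated (skew x₀ x₁ + skew x₂ x₃) (t • (skew x₀ x₁ + skew x₂ x₃) + skew x₀ x₄ + skew x₁ x₂) := by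
  refine ⟨.A2_2A1, !![1, 0; t, 1], ![-x₄, x₃, -x₁, -x₂, x₀], by simp, ?_, ?_, ?_⟩
  · refine hx.of_coeff ![![0, 0, 0, 0, 1], ![0, 0, -1, 0, 0], ![0, 0, 0, -1, 0],
      ![0, 1, 0, 0, 0], ![-1, 0, 0, 0, 0]] fun i l => ?_
    fin_cases i <;> simp [Fin.sum_univ_five]
  · ext i j
    simp [skewPair, skewRep, skew_apply]
    ring
  · ext i j
    simp [skewPair, skewRep, skew_apply]
    ring

theorem skew_add_skew_diag (x₀ x₁ x₂ x₃ : Fin 5 → k) (i : Fin 5) :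
    (skew x₀ x₁ + skew x₂ x₃) i i = 0 := by
  simp [skew_apply]

theorem skew_add_skew_swap (x₀ x₁ x₂ x₃ : Fin 5 → k) (i j : Fin 5) :
    (skew x₀ x₁ + skew x₂ x₃) j i = -(skew x₀ x₁ + skew x₂ x₃) i j := by
  simp [skew_apply]
  ring

/-- Subtracting `c₂₃` times the first form leaves `x₀` wedge something plus `x₁` wedge `c₁₂ • x₂ +
c₁₃ • x₃`. If the latter vector is nonzero, it becomes the new `x₂` by a change of `x₂, x₃` of
determinant one, and the pair is generic. If it is zero, a form of rank at most two remains. -/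
theorem isTabulated_of_contraction_normalized {x₀ x₁ x₂ x₃ x₄ : Fin 5 → k}
    (hx : IsFrame ![x₀, x₁, x₂, x₃, x₄]) (c₀₁ c₀₂ c₀₃ c₁₂ c₁₃ c₂₃ : k) :
    IsTabulated (skew x₀ x₁ + skew x₂ x₃) (skew x₀ x₄ + c₀₁ • skew x₀ x₁ + c₀₂ • skew x₀ x₂
      + c₀₃ • skew x₀ x₃ + c₁₂ • skew x₁ x₂ + c₁₃ • skew x₁ x₃ + c₂₃ • skew x₂ x₃) := by
  by_cases h₁₂ : c₁₂ ≠ 0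
  · have hy : IsFrame ![x₀, x₁, c₁₂ • x₂ + c₁₃ • x₃, (1 / c₁₂) • x₃,
        x₄ + (c₀₁ - c₂₃) • x₁ + c₀₂ • x₂ + c₀₃ • x₃] := by
      refine hx.of_coeff ![![1, 0, 0, 0, 0], ![0, 1, 0, 0, 0], ![0, 0, 1 / c₁₂, -c₁₃, 0],
        ![0, 0, 0, c₁₂, 0],
        ![0, -(c₀₁ - c₂₃), -c₀₂ / c₁₂, -c₀₃ * c₁₂ + c₀₂ * c₁₃, 1]] fun i l => ?_
      fin_cases i <;> simp [Fin.sum_univ_five] <;> field_simp <;> ring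
    convert isTabulated_generic hy c₂₃ using 1
    · ext i j
      simp [skew_apply]
      field_simp
      ring
    · ext i j
      simp [skew_apply]
      field_simp
      ring
  by_cases h₁₃ : c₁₃ ≠ 0
  · have hy : IsFrame ![x₀, x₁, c₁₃ • x₃, (-1 / c₁₃) • x₂,
        x₄ + (c₀₁ - c₂₃) • x₁ + c₀₂ • x₂ + c₀₃ • x₃] := by
      refine hx.of_coeff ![![1, 0, 0, 0, 0], ![0, 1, 0, 0, 0], ![0, 0, 0, -c₁₃, 0],
        ![0, 0, 1 / c₁₃, 0, 0],
        ![0, -(c₀₁ - c₂₃), -c₀₃ / c₁₃, c₀₂ * c₁₃, 1]] fun i l => ?_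
      fin_cases i <;> simp [Fin.sum_univ_five] <;> (field_simp; try ring)
    push Not at h₁₂
    convert isTabulated_generic hy c₂₃ using 1
    · ext i j
      simp [skew_apply]
      field_simp
      ring
    · ext i j
      simp [skew_apply, h₁₂]
      field_simp
      ring
  push Not at h₁₂ h₁₃
  refine isTabulated_of_sub_smul_eq_skew (skew_add_skew_diag _ _ _ _) (skew_add_skew_swap _ _ _ _)
    (t := c₂₃) (y := x₀) (z := x₄ + (c₀₁ - c₂₃) • x₁ + c₀₂ • x₂ + c₀₃ • x₃) ?_
  ext i j
  simp [skew_apply, h₁₂, h₁₃]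
  ring

/-- The dual vector of `x₄` spans the kernel of the first form. Up to sign, its contraction with the
second is taken as the new `x₀`, and `x₁, x₂, x₃` are corrected so that the first form stays
unchanged. -/
theorem isTabulated_of_contraction_ne_zero {x₀ x₁ x₂ x₃ x₄ : Fin 5 → k}
    (hx : IsFrame ![x₀, x₁, x₂, x₃, x₄]) (c₀₁ c₀₂ c₀₃ c₀₄ c₁₂ c₁₃ c₁₄ c₂₃ c₂₄ c₃₄ : k)
    (h : c₀₄ ≠ 0) :
    IsTabulated (skew x₀ x₁ + skew x₂ x₃)
      (c₀₁ • skew x₀ x₁ + c₀₂ • skew x₀ x₂ + c₀₃ • skew x₀ x₃ + c₀₄ • skew x₀ x₄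
      + c₁₂ • skew x₁ x₂ + c₁₃ • skew x₁ x₃ + c₁₄ • skew x₁ x₄ + c₂₃ • skew x₂ x₃
      + c₂₄ • skew x₂ x₄ + c₃₄ • skew x₃ x₄) := by
  have hy : IsFrame ![c₀₄ • x₀ + c₁₄ • x₁ + c₂₄ • x₂ + c₃₄ • x₃, (1 / c₀₄) • x₁,
      x₂ + (c₃₄ / c₀₄) • x₁, x₃ - (c₂₄ / c₀₄) • x₁, x₄] := by
    refine hx.of_coeff ![![1 / c₀₄, -c₁₄, -c₂₄ / c₀₄, -c₃₄ / c₀₄, 0], ![0, c₀₄, 0, 0, 0],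
      ![0, -c₃₄, 1, 0, 0], ![0, c₂₄, 0, 1, 0], ![0, 0, 0, 0, 1]] fun i l => ?_
    fin_cases i <;> simp [Fin.sum_univ_five] <;> field_simp <;> ring
  convert isTabulated_of_contraction_normalized hy
    (c₀₁ - c₀₂ * c₃₄ / c₀₄ + c₀₃ * c₂₄ / c₀₄) (c₀₂ / c₀₄) (c₀₃ / c₀₄)
    (c₀₁ * c₂₄ + c₀₂ * (-c₁₄ - c₂₄ * c₃₄ / c₀₄) + c₀₃ * c₂₄ ^ 2 / c₀₄ + c₁₂ * c₀₄ - c₂₃ * c₂₄)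
    (c₀₁ * c₃₄ - c₀₂ * c₃₄ ^ 2 / c₀₄ + c₀₃ * (-c₁₄ + c₂₄ * c₃₄ / c₀₄) + c₁₃ * c₀₄ - c₂₃ * c₃₄)
    (c₀₂ * c₃₄ / c₀₄ - c₀₃ * c₂₄ / c₀₄ + c₂₃) using 1
  · ext i j
    simp [skew_apply]
    field_simp
    ring
  · ext i j
    simp [skew_apply]
    field_simp
    ring

theorem isTabulated_of_rank_four [IsAlgClosed k] {x₀ x₁ x₂ x₃ x₄ : Fin 5 → k}
    (hx : IsFrame ![x₀, x₁, x₂, x₃, x₄]) {B : Fin 5 → Fin 5 → k} (h₀ : ∀ i, B i i = 0)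
    (h₁ : ∀ i j, B j i = -B i j) : IsTabulated (skew x₀ x₁ + skew x₂ x₃) B := by
  obtain ⟨c₀₁, c₀₂, c₀₃, c₀₄, c₁₂, c₁₃, c₁₄, c₂₃, c₂₄, c₃₄, hB⟩ := exists_skew_expansion hx h₀ h₁
  simp only [Matrix.cons_val] at hB
  by_cases h₀₄ : c₀₄ ≠ 0
  · rw [hB]
    exact isTabulated_of_contraction_ne_zero hx _ _ _ _ _ _ _ _ _ _ h₀₄
  by_cases h₁₄ : c₁₄ ≠ 0
  · have hy : IsFrame ![x₁, -x₀, x₂, x₃, x₄] := by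
      refine hx.of_coeff ![![0, -1, 0, 0, 0], ![1, 0, 0, 0, 0], ![0, 0, 1, 0, 0], ![0, 0, 0, 1, 0], ![0, 0, 0, 0, 1]]
        fun i l => ?_
      fin_cases i <;> simp [Fin.sum_univ_five]
    convert isTabulated_of_contraction_ne_zero hy c₀₁ c₁₂ c₁₃ c₁₄ (-c₀₂) (-c₀₃) (-c₀₄) c₂₃ c₂₄ c₃₄
      h₁₄ using 1
    · ext i j
      simp [skew_apply]
      ring
    · rw [hB]
      ext i j
      simp [skew_apply]
      ring
  by_cases h₂₄ : c₂₄ ≠ 0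
  · have hy : IsFrame ![x₂, x₃, x₀, x₁, x₄] := by
      refine hx.of_coeff ![![0, 0, 1, 0, 0], ![0, 0, 0, 1, 0], ![1, 0, 0, 0, 0], ![0, 1, 0, 0, 0], ![0, 0, 0, 0, 1]]
        fun i l => ?_
      fin_cases i <;> simp [Fin.sum_univ_five]
    convert isTabulated_of_contraction_ne_zero hy c₂₃ (-c₀₂) (-c₁₂) c₂₄ (-c₀₃) (-c₁₃) c₃₄ c₀₁ c₀₄ c₁₄
      h₂₄ using 1
    · ext i j
      simp [skew_apply]
      ring
    · rw [hB]
      ext i j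
      simp [skew_apply]
      ring
  by_cases h₃₄ : c₃₄ ≠ 0
  · have hy : IsFrame ![x₃, -x₂, x₀, x₁, x₄] := by
      refine hx.of_coeff ![![0, 0, 1, 0, 0], ![0, 0, 0, 1, 0], ![0, -1, 0, 0, 0], ![1, 0, 0, 0, 0], ![0, 0, 0, 0, 1]]
        fun i l => ?_
      fin_cases i <;> simp [Fin.sum_univ_five]
    convert isTabulated_of_contraction_ne_zero hy c₂₃ (-c₀₃) (-c₁₃) c₃₄ c₀₂ c₁₂ (-c₂₄) c₀₁ c₀₄ c₁₄
      h₃₄ using 1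
    · ext i j
      simp [skew_apply]
      ring
    · rw [hB]
      ext i j
      simp [skew_apply]
      ring
  push Not at h₀₄ h₁₄ h₂₄ h₃₄
  -- With all contractions zero, both forms live in four variables. The polynomial is the Pfaffian
  -- of `B` minus `t` times the form of rank four.
  obtain ⟨t, ht⟩ : ∃ t, (c₀₁ - t) * (c₂₃ - t) - c₀₂ * c₁₃ + c₀₃ * c₁₂ = 0 := by
    obtain ⟨t, ht⟩ := IsAlgClosed.exists_root
      ((.C c₀₁ - .X) * (.C c₂₃ - .X) - .C (c₀₂ * c₁₃) + .C (c₀₃ * c₁₂) : Polynomial k) (by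
        have : ((.C c₀₁ - .X) * (.C c₂₃ - .X) - .C (c₀₂ * c₁₃) + .C (c₀₃ * c₁₂) : Polynomial k)
            = .C 1 * .X ^ 2 + .C (-(c₀₁ + c₂₃)) * .X + .C (c₀₁ * c₂₃ - c₀₂ * c₁₃ + c₀₃ * c₁₂) := by
          simp only [map_add, map_sub, map_neg, map_mul, map_one]
          ring
        rw [this, Polynomial.degree_quadratic one_ne_zero]
        decide)
    exact ⟨t, by simpa [Polynomial.IsRoot] using ht⟩
  obtain ⟨y, z, hyz⟩ := exists_skew_of_plucker x₀ x₁ x₂ x₃ _ _ _ _ _ _ ht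
  refine isTabulated_of_sub_smul_eq_skew (skew_add_skew_diag _ _ _ _) (skew_add_skew_swap _ _ _ _)
    (t := t) (y := y) (z := z) ?_
  rw [← hyz, hB, h₀₄, h₁₄, h₂₄, h₃₄]
  module

/-- Every pair of alternating `5 × 5` matrices has one of the shapes in the table. -/
theorem isTabulated [IsAlgClosed k] {A B : Fin 5 → Fin 5 → k} (hA₀ : ∀ i, A i i = 0)
    (hA₁ : ∀ i j, A j i = -A i j) (hB₀ : ∀ i, B i i = 0) (hB₁ : ∀ i j, B j i = -B i j) :
    IsTabulated A B := by
  obtain ⟨x₀, x₁, x₂, x₃, x₄, hx, h⟩ := hasSkewNormalForm hA₀ hA₁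
  have hswap : IsTabulated B A → IsTabulated A B := fun h =>
    .of_mix 0 1 1 0 (by simp) (by simpa using h)
  obtain rfl | rfl | rfl := h
  · refine hswap (isTabulated_of_sub_smul_eq_skew hB₀ hB₁ (t := 0) (y := 0) (z := 0) ?_)
    ext i j
    simp [skew_apply]
  · exact hswap (isTabulated_skew hx hB₀ hB₁)
  · exact isTabulated_of_rank_four hx hB₀ hB₁

end Classification

/-! ### Passage from ∧²F* to matrices, and orbits in coordinates -/

section Coordinates

variable {k : Type*} [Field k] {F : Type*} [AddCommGroup F] [Module k F]
  (e : Module.Basis (Fin 5) k (Module.Dual k F))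

theorem update_zero_pair {α : Type*} (x y z : α) : Function.update ![x, y] 0 z = ![z, y] := by
  funext i
  fin_cases i <;> rfl

theorem update_one_pair {α : Type*} (x y z : α) : Function.update ![x, y] 1 z = ![x, z] := by
  funext i
  fin_cases i <;> rfl

theorem wedge_add_left (φ φ' ψ : Module.Dual k F) :
    wedge (φ + φ') ψ = wedge φ ψ + wedge φ' ψ := by
  have h := (exteriorPower.ιMulti k 2 (M := Module.Dual k F)).map_update_add ![φ, ψ] 0 φ φ'
  rwa [update_zero_pair, update_zero_pair, update_zero_pair] at h

theorem wedge_add_right (φ ψ ψ' : Module.Dual k F) :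
    wedge φ (ψ + ψ') = wedge φ ψ + wedge φ ψ' := by
  have h := (exteriorPower.ιMulti k 2 (M := Module.Dual k F)).map_update_add ![φ, ψ] 1 ψ ψ'
  rwa [update_one_pair, update_one_pair, update_one_pair] at h

theorem wedge_smul_left (c : k) (φ ψ : Module.Dual k F) : wedge (c • φ) ψ = c • wedge φ ψ := by
  have h := (exteriorPower.ιMulti k 2 (M := Module.Dual k F)).map_update_smul ![φ, ψ] 0 c φ
  rwa [update_zero_pair, update_zero_pair] at h

theorem wedge_smul_right (c : k) (φ ψ : Module.Dual k F) : wedge φ (c • ψ) = c • wedge φ ψ := by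
  have h := (exteriorPower.ιMulti k 2 (M := Module.Dual k F)).map_update_smul ![φ, ψ] 1 c ψ
  rwa [update_one_pair, update_one_pair] at h

theorem wedge_self (φ : Module.Dual k F) : wedge φ φ = 0 :=
  (exteriorPower.ιMulti k 2 (M := Module.Dual k F)).map_eq_zero_of_eq ![φ, φ] (i := 0) (j := 1)
    rfl (by decide)

theorem wedge_swap (φ ψ : Module.Dual k F) : wedge ψ φ = -wedge φ ψ := by
  have h := wedge_self (φ + ψ)
  rw [wedge_add_left, wedge_add_right, wedge_add_right, wedge_self, wedge_self, zero_add,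
    add_zero] at h
  exact eq_neg_of_add_eq_zero_right h

/-- The exterior product as a bilinear map. -/
def wedgeBilin : Module.Dual k F →ₗ[k] Module.Dual k F →ₗ[k] ⋀[k]^2 (Module.Dual k F) :=
  LinearMap.mk₂ k wedge wedge_add_left wedge_smul_left wedge_add_right wedge_smul_right

/-- The matrix of an element of `∧² F*`. -/
def skewCoord : ⋀[k]^2 (Module.Dual k F) →ₗ[k] (Fin 5 → Fin 5 → k) :=
  exteriorPower.alternatingMapLinearEquiv
    { toFun := fun v => skew (e.equivFun (v 0)) (e.equivFun (v 1))
      map_update_add' := by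
        intro inst v i x y
        obtain rfl := Subsingleton.elim inst (instDecidableEqFin 2)
        fin_cases i <;> ext a b <;> simp [skew_apply] <;> ring
      map_update_smul' := by
        intro inst v i c x
        obtain rfl := Subsingleton.elim inst (instDecidableEqFin 2)
        fin_cases i <;> ext a b <;> simp [skew_apply] <;> ring
      map_eq_zero_of_eq' := by
        intro v i j hij hne
        have h : v 0 = v 1 := by
          fin_cases i <;> fin_cases j
          exacts [absurd rfl hne, hij, hij.symm, absurd rfl hne]
        ext a b
        simp [skew_apply, h, mul_comm] }

theorem skewCoord_wedge (φ ψ : Module.Dual k F) :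
    skewCoord e (wedge φ ψ) = skew (e.equivFun φ) (e.equivFun ψ) := by
  rw [skewCoord, wedge, exteriorPower.alternatingMapLinearEquiv_apply_ιMulti]
  rfl

/-- The element of `∧² F*` with the given matrix. -/
def ofSkew : (Fin 5 → Fin 5 → k) →ₗ[k] ⋀[k]^2 (Module.Dual k F) :=
  let p (i j : Fin 5) : (Fin 5 → Fin 5 → k) →ₗ[k] k :=
    (LinearMap.proj j).comp (LinearMap.proj (R := k) (φ := fun _ : Fin 5 => Fin 5 → k) i)
  (p 0 1).smulRight (wedge (e 0) (e 1)) + (p 0 2).smulRight (wedge (e 0) (e 2))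
    + (p 0 3).smulRight (wedge (e 0) (e 3)) + (p 0 4).smulRight (wedge (e 0) (e 4))
    + (p 1 2).smulRight (wedge (e 1) (e 2)) + (p 1 3).smulRight (wedge (e 1) (e 3))
    + (p 1 4).smulRight (wedge (e 1) (e 4)) + (p 2 3).smulRight (wedge (e 2) (e 3))
    + (p 2 4).smulRight (wedge (e 2) (e 4)) + (p 3 4).smulRight (wedge (e 3) (e 4))

theorem ofSkew_apply (A : Fin 5 → Fin 5 → k) :
    ofSkew e A = A 0 1 • wedge (e 0) (e 1) + A 0 2 • wedge (e 0) (e 2)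
      + A 0 3 • wedge (e 0) (e 3) + A 0 4 • wedge (e 0) (e 4) + A 1 2 • wedge (e 1) (e 2)
      + A 1 3 • wedge (e 1) (e 3) + A 1 4 • wedge (e 1) (e 4) + A 2 3 • wedge (e 2) (e 3)
      + A 2 4 • wedge (e 2) (e 4) + A 3 4 • wedge (e 3) (e 4) := rfl

theorem ofSkew_skew (φ ψ : Module.Dual k F) :
    ofSkew e (skew (e.equivFun φ) (e.equivFun ψ)) = wedge φ ψ := by
  rw [ofSkew_apply]
  conv_rhs => rw [← e.sum_equivFun φ, ← e.sum_equivFun ψ]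
  change _ = wedgeBilin _ _
  generalize e.equivFun φ = x
  generalize e.equivFun ψ = y
  simp only [Fin.sum_univ_five, map_add, map_smul, LinearMap.add_apply, LinearMap.smul_apply]
  simp only [wedgeBilin, LinearMap.mk₂_apply, skew_apply, wedge_self,
    wedge_swap (e 0) (e 1), wedge_swap (e 0) (e 2), wedge_swap (e 0) (e 3), wedge_swap (e 0) (e 4),
    wedge_swap (e 1) (e 2), wedge_swap (e 1) (e 3), wedge_swap (e 1) (e 4),
    wedge_swap (e 2) (e 3), wedge_swap (e 2) (e 4), wedge_swap (e 3) (e 4)]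
  module

theorem ofSkew_skewCoord (x : ⋀[k]^2 (Module.Dual k F)) : ofSkew e (skewCoord e x) = x := by
  have h : (ofSkew e).comp (skewCoord e) = LinearMap.id := by
    refine exteriorPower.linearMap_ext ?_
    ext1 v
    have hv : v = ![v 0, v 1] := by ext i; fin_cases i <;> rfl
    rw [hv]
    change ofSkew e (skewCoord e (wedge (v 0) (v 1))) = wedge (v 0) (v 1)
    rw [skewCoord_wedge, ofSkew_skew]
  exact LinearMap.congr_fun h x

theorem skewCoord_diag (x : ⋀[k]^2 (Module.Dual k F)) (i : Fin 5) : skewCoord e x i i = 0 := by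
  rw [← ofSkew_skewCoord e x, ofSkew_apply]
  simp [skewCoord_wedge, skew_apply, mul_comm]

theorem skewCoord_swap (x : ⋀[k]^2 (Module.Dual k F)) (i j : Fin 5) :
    skewCoord e x j i = -skewCoord e x i j := by
  rw [← ofSkew_skewCoord e x, ofSkew_apply]
  simp only [map_add, map_smul, skewCoord_wedge, skew_apply, Pi.add_apply, Pi.smul_apply,
    smul_eq_mul]
  ring

theorem skewCoord_ofSkew_skew (x y : Fin 5 → k) : skewCoord e (ofSkew e (skew x y)) = skew x y := by
  obtain ⟨φ, rfl⟩ := e.equivFun.surjective x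
  obtain ⟨ψ, rfl⟩ := e.equivFun.surjective y
  rw [ofSkew_skew, skewCoord_wedge]

theorem pencil_single_zero (α β : ⋀[k]^2 (Module.Dual k F)) :
    pencil α β (Pi.single 0 1) = α := by
  have := (Pi.basisFun k (Fin 2)).constr_basis k ![α, β] 0
  rwa [Pi.basisFun_apply] at this

theorem pencil_single_one (α β : ⋀[k]^2 (Module.Dual k F)) :
    pencil α β (Pi.single 1 1) = β := by
  have := (Pi.basisFun k (Fin 2)).constr_basis k ![α, β] 1
  rwa [Pi.basisFun_apply] at this

theorem pencil_ext {f f' : PencilSpace k F} (h₀ : f (Pi.single 0 1) = f' (Pi.single 0 1))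
    (h₁ : f (Pi.single 1 1) = f' (Pi.single 1 1)) : f = f' := by
  refine (Pi.basisFun k (Fin 2)).ext fun i => ?_
  rw [Pi.basisFun_apply]
  fin_cases i
  exacts [h₀, h₁]

/-- The pair of matrices of an element of `Hom(k², ∧² F*)`. -/
def pencilCoord : PencilSpace k F →ₗ[k] (Fin 2 → Fin 5 → Fin 5 → k) :=
  LinearMap.pi fun r => (skewCoord e).comp (LinearMap.applyₗ (Pi.single r 1))

theorem pencilCoord_apply (f : PencilSpace k F) (r : Fin 2) :
    pencilCoord e f r = skewCoord e (f (Pi.single r 1)) := rfl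

/-- The element of `Hom(k², ∧² F*)` with the given pair of matrices. -/
def ofPair : (Fin 2 → Fin 5 → Fin 5 → k) →ₗ[k] PencilSpace k F :=
  ((Pi.basisFun k (Fin 2)).constr k).toLinearMap.comp
    (LinearMap.pi fun r => (ofSkew e).comp (LinearMap.proj r))

theorem ofPair_single (T : Fin 2 → Fin 5 → Fin 5 → k) (r : Fin 2) :
    ofPair e T (Pi.single r 1) = ofSkew e (T r) := by
  have := (Pi.basisFun k (Fin 2)).constr_basis k (fun r => ofSkew e (T r)) r
  rwa [Pi.basisFun_apply] at this

theorem ofPair_pencilCoord (f : PencilSpace k F) : ofPair e (pencilCoord e f) = f := by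
  refine pencil_ext ?_ ?_ <;> rw [ofPair_single, pencilCoord_apply, ofSkew_skewCoord]

/-- The element of `Hom(k², ∧² F*)` whose pair of matrices is `skewPair i m φ`. -/
def tabulated (i : OrbitLabel) (m : Matrix (Fin 2) (Fin 2) k) (φ : Fin 5 → Fin 5 → k) :
    PencilSpace k F :=
  ofPair e (skewPair i m φ)

theorem skewCoord_ofSkew_skewRep (i : OrbitLabel) (φ : Fin 5 → Fin 5 → k) (r : Fin 2) :
    skewCoord e (ofSkew e (skewRep φ i r)) = skewRep φ i r := by
  cases i <;> fin_cases r <;> simp [skewRep, skewCoord_ofSkew_skew]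

theorem pencilCoord_tabulated (i : OrbitLabel) (m : Matrix (Fin 2) (Fin 2) k)
    (φ : Fin 5 → Fin 5 → k) : pencilCoord e (tabulated e i m φ) = skewPair i m φ := by
  ext1 r
  rw [pencilCoord_apply, tabulated, ofPair_single]
  simp only [skewPair, map_add, map_smul, skewCoord_ofSkew_skewRep]

theorem exists_eq_tabulated [IsAlgClosed k] (f : PencilSpace k F) :
    ∃ i m φ, Matrix.det m ≠ 0 ∧ IsFrame φ ∧ f = tabulated e i m φ := by
  obtain ⟨i, m, φ, hm, hφ, h₀, h₁⟩ := isTabulated (A := pencilCoord e f 0) (B := pencilCoord e f 1)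
    (skewCoord_diag e _) (skewCoord_swap e _) (skewCoord_diag e _) (skewCoord_swap e _)
  refine ⟨i, m, φ, hm, hφ, ?_⟩
  rw [← ofPair_pencilCoord e f, tabulated]
  congr 1
  ext1 r
  fin_cases r
  exacts [h₀.symm, h₁.symm]

theorem rep_single (ψ : Module.Basis (Fin 5) k (Module.Dual k F)) (i : OrbitLabel) (r : Fin 2) :
    OrbitLabel.rep ψ i (Pi.single r 1) = ofSkew e (skewRep (fun a => e.equivFun (ψ a)) i r) := by
  cases i <;> fin_cases r <;>
    simp [-Module.Basis.equivFun_apply, OrbitLabel.rep, skewRep, pencil_single_zero,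
      pencil_single_one, ofSkew_skew]

theorem pencilRep_apply (x : PencilGroup k F) (f : PencilSpace k F) (v : Fin 2 → k) :
    pencilRep k F x f v =
      exteriorPower.map 2 ((spaceRep k F).dual x) (f (x⁻¹.1.1 v)) := rfl

theorem dual_spaceRep_apply (x : PencilGroup k F) (φ : Module.Dual k F) (v : F) :
    (spaceRep k F).dual x φ v = φ (x⁻¹.2.1 v) := rfl

theorem map_wedge (L : Module.Dual k F →ₗ[k] Module.Dual k F) (φ ψ : Module.Dual k F) :
    exteriorPower.map 2 L (wedge φ ψ) = wedge (L φ) (L ψ) := by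
  rw [wedge, exteriorPower.map_apply_ιMulti, wedge]
  congr 1
  ext i
  fin_cases i <;> rfl

theorem map_rep_single (ψ : Module.Basis (Fin 5) k (Module.Dual k F))
    (L : Module.Dual k F ≃ₗ[k] Module.Dual k F) (i : OrbitLabel) (r : Fin 2) :
    exteriorPower.map 2 (L : Module.Dual k F →ₗ[k] Module.Dual k F)
      (OrbitLabel.rep ψ i (Pi.single r 1)) = OrbitLabel.rep (ψ.map L) i (Pi.single r 1) := by
  cases i <;> fin_cases r <;>
    simp [OrbitLabel.rep, pencil_single_zero, pencil_single_one, map_wedge]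

/-- The transformed representative in coordinates. -/
theorem pencilRep_rep (x : PencilGroup k F) (L : Module.Dual k F ≃ₗ[k] Module.Dual k F)
    (hL : (spaceRep k F).dual x = L) (i : OrbitLabel) :
    pencilRep k F x (OrbitLabel.rep e i) =
      tabulated e i (LinearMap.toMatrix' x⁻¹.1.1).transpose (fun a => e.equivFun (L (e a))) := by
  have h : ∀ r, pencilRep k F x (OrbitLabel.rep e i) (Pi.single r 1) =
      (tabulated e i (LinearMap.toMatrix' x⁻¹.1.1).transpose (fun a => e.equivFun (L (e a)))
        : PencilSpace k F) (Pi.single r 1) := by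
    intro r
    rw [pencilRep_apply, hL, tabulated, ofPair_single]
    have hv : x⁻¹.1.1 (Pi.single r 1) = x⁻¹.1.1 (Pi.single r 1) 0 • Pi.single 0 1
        + x⁻¹.1.1 (Pi.single r 1) 1 • (Pi.single 1 1 : Fin 2 → k) := by
      ext a
      fin_cases a <;> simp
    rw [hv]
    simp only [map_add, map_smul, map_rep_single]
    simp only [rep_single e, skewPair, Matrix.transpose_apply, LinearMap.toMatrix'_apply,
      Module.Basis.map_apply, map_add, map_smul]
  exact pencil_ext (h 0) (h 1)

theorem isFrame_equivFun (ψ : Module.Basis (Fin 5) k (Module.Dual k F)) :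
    IsFrame fun a => e.equivFun (ψ a) := by
  have := (ψ.map e.equivFun).span_eq
  exact this

/-- The group acts on `m` and `φ` through all invertible matrices and all bases, since every
automorphism of F* is dual to one of F. This removes the group from the rest of the argument. -/
theorem mem_orbit_rep_iff [FiniteDimensional k F] {i : OrbitLabel} {f : PencilSpace k F} :
    f ∈ orbit k (OrbitLabel.rep e i) ↔
      ∃ m φ, Matrix.det m ≠ 0 ∧ IsFrame φ ∧ f = tabulated e i m φ := by
  constructor
  · rintro ⟨x, rfl⟩
    let L : Module.Dual k F ≃ₗ[k] Module.Dual k F :=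
      LinearEquiv.ofLinearMap ((spaceRep k F).dual x) ((spaceRep k F).dual x⁻¹)
        (by rw [← Module.End.mul_eq_comp, ← map_mul, mul_inv_cancel, map_one]; rfl)
        (by rw [← Module.End.mul_eq_comp, ← map_mul, inv_mul_cancel, map_one]; rfl)
    refine ⟨_, _, ?_, ?_, pencilRep_rep e x L rfl i⟩
    · rw [Matrix.det_transpose, LinearMap.det_toMatrix']
      exact ((x⁻¹.1).isUnit.map LinearMap.det).ne_zero
    · exact isFrame_equivFun e (e.map L)
  · rintro ⟨m, φ, hm, hφ, rfl⟩
    have hmu : IsUnit m.transpose := by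
      rw [Matrix.isUnit_iff_isUnit_det, Matrix.det_transpose]
      exact hm.isUnit
    have hg : IsUnit (Matrix.toLin' m.transpose) := hmu.map Matrix.toLinAlgEquiv'
    obtain ⟨g, hg⟩ := hg
    have hφi : LinearIndependent k φ := by
      rw [linearIndependent_iff_card_eq_finrank_span, Set.finrank, hφ]
      simp
    let b : Module.Basis (Fin 5) k (Fin 5 → k) := Module.Basis.mk hφi hφ.ge
    let L : Module.Dual k F ≃ₗ[k] Module.Dual k F := e.equiv (b.map e.equivFun.symm) (Equiv.refl _)
    have hL : ∀ a, L (e a) = e.equivFun.symm (φ a) := by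
      intro a
      simp [L, b]
    -- The automorphism of `F` with transpose `L`, obtained by reflexivity. The group element uses
    -- its inverse because the dual action inverts.
    let u : F ≃ₗ[k] F :=
      (Module.evalEquiv k F).trans (L.dualMap.trans (Module.evalEquiv k F).symm)
    refine ⟨⟨g⁻¹, (LinearMap.GeneralLinearGroup.generalLinearEquiv k F).symm u.symm⟩, ?_⟩
    have hd : (spaceRep k F).dual
        ⟨g⁻¹, (LinearMap.GeneralLinearGroup.generalLinearEquiv k F).symm u.symm⟩ = L := by
      ext ψ v
      rw [dual_spaceRep_apply]
      change ψ (u v) = L ψ v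
      simp [u]
    refine (pencilRep_rep e _ L hd i).trans ?_
    have h1 : (fun a => e.equivFun (L (e a))) = φ := by
      ext1 a
      rw [hL, LinearEquiv.apply_symm_apply]
    rw [h1]
    congr 1
    simp [hg]

theorem mem_orbit_symm {f f' : PencilSpace k F} (h : f ∈ orbit k f') : f' ∈ orbit k f := by
  obtain ⟨x, rfl⟩ := h
  exact ⟨x⁻¹, by simp⟩

theorem orbit_eq_of_mem {f f' : PencilSpace k F} (h : f ∈ orbit k f') :
    orbit k f = orbit k f' := by
  obtain ⟨x, rfl⟩ := h
  ext v
  constructor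
  · rintro ⟨y, rfl⟩
    exact ⟨y * x, by simp⟩
  · rintro ⟨y, rfl⟩
    exact ⟨y * x⁻¹, by simp⟩

theorem self_mem_orbit (f : PencilSpace k F) : f ∈ orbit k f := ⟨1, by simp⟩

end Coordinates

/-! ### Criteria for dimension and closure in terms of parametrizations -/

section Charts

variable {k : Type*} [Field k]

section

variable {V W U : Type*} [AddCommGroup V] [Module k V] [AddCommGroup W] [Module k W]
  [AddCommGroup U] [Module k U]

theorem isPolynomialMap_id : IsPolynomialMap k fun v : V => v :=
  isPolynomialMap_linear LinearMap.id

theorem IsPolynomialMap.fst {P : W → V × U} (hP : IsPolynomialMap k P) :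
    IsPolynomialMap k fun w => (P w).1 :=
  (isPolynomialMap_linear (LinearMap.fst k V U)).comp hP

theorem IsPolynomialMap.snd {P : W → V × U} (hP : IsPolynomialMap k P) :
    IsPolynomialMap k fun w => (P w).2 :=
  (isPolynomialMap_linear (LinearMap.snd k V U)).comp hP

theorem isPolynomialMap_proj {ι : Type*} (i : ι) : IsPolynomialMap k fun x : ι → V => x i :=
  isPolynomialMap_linear (LinearMap.proj (R := k) (φ := fun _ : ι => V) i)

theorem IsPolynomialMap.pi {ι : Type*} [Finite ι] {P : W → ι → V}
    (hP : ∀ i, IsPolynomialMap k fun w => P w i) : IsPolynomialMap k P := by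
  classical
  have := Fintype.ofFinite ι
  have h : P = fun w => ∑ i, LinearMap.single k (fun _ : ι => V) i (P w i) := by
    funext w
    exact (Finset.univ_sum_single (P w)).symm
  rw [h]
  exact .sum fun i _ => (isPolynomialMap_linear _).comp (hP i)

end

attribute [fun_prop] IsPolynomialMap isPolynomialMap_id isPolynomialMap_const IsPolynomialMap.comp
  isPolynomialMap_proj IsPolynomialMap.pi IsPolynomialMap.add IsPolynomialMap.sub
  IsPolynomialMap.neg IsPolynomialMap.mul IsPolynomialMap.smul IsPolynomialMap.fst
  IsPolynomialMap.snd

variable {W : Type*} [AddCommGroup W] [Module k W]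

theorem IsPolynomialMap.skew {x y : W → Fin 5 → k} (hx : IsPolynomialMap k x)
    (hy : IsPolynomialMap k y) : IsPolynomialMap k fun w => skew (x w) (y w) := by
  refine .pi fun i => .pi fun j => ?_
  simp only [skew_apply]
  fun_prop

attribute [fun_prop] IsPolynomialMap.skew

theorem IsPolynomialMap.skewRep (i : OrbitLabel) (r : Fin 2) {φ : W → Fin 5 → Fin 5 → k}
    (hφ : IsPolynomialMap k φ) : IsPolynomialMap k fun w => skewRep (φ w) i r := by
  cases i <;> fin_cases r <;> simp [SkewPencil.skewRep] <;> fun_prop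

theorem IsPolynomialMap.skewPair (i : OrbitLabel) {m : W → Fin 2 → Fin 2 → k}
    (hm : IsPolynomialMap k m) {φ : W → Fin 5 → Fin 5 → k} (hφ : IsPolynomialMap k φ) :
    IsPolynomialMap k fun w => skewPair i (Matrix.of (m w)) (φ w) := by
  refine .pi fun r => ?_
  have h₀ := hφ.skewRep i 0
  have h₁ := hφ.skewRep i 1
  simp only [SkewPencil.skewPair, Matrix.of_apply]
  fun_prop

theorem IsPolynomialMap.det_mul_det {m : W → Fin 2 → Fin 2 → k}
    (hm : IsPolynomialMap k m) {φ : W → Fin 5 → Fin 5 → k} (hφ : IsPolynomialMap k φ) :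
    IsPolynomialMap k fun w => (Matrix.of (m w)).det * (Matrix.of (φ w)).det := by
  refine .mul (.det fun i j => ?_) (.det fun i j => ?_) <;> simp only [Matrix.of_apply] <;> fun_prop

variable {F : Type*} [AddCommGroup F] [Module k F]
  (e : Module.Basis (Fin 5) k (Module.Dual k F))

theorem isPolynomialMap_ofPair : IsPolynomialMap k (ofPair e) := isPolynomialMap_linear _

theorem isPolynomialMap_pencilCoord : IsPolynomialMap k (pencilCoord e) := isPolynomialMap_linear _

theorem isPolynomialMap_tabulated (i : OrbitLabel) {m : W → Fin 2 → Fin 2 → k}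
    (hm : IsPolynomialMap k m) {φ : W → Fin 5 → Fin 5 → k} (hφ : IsPolynomialMap k φ) :
    IsPolynomialMap k fun w => (tabulated e i (Matrix.of (m w)) (φ w) : PencilSpace k F) :=
  (isPolynomialMap_ofPair e).comp (hm.skewPair i hφ)

variable [FiniteDimensional k F]

theorem tabulated_mem_orbit {i : OrbitLabel} {m : Matrix (Fin 2) (Fin 2) k}
    {φ : Fin 5 → Fin 5 → k} (h : m.det * (Matrix.of φ).det ≠ 0) :
    tabulated e i m φ ∈ orbit k (OrbitLabel.rep e i) :=
  (mem_orbit_rep_iff e).mpr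
    ⟨m, φ, left_ne_zero_of_mul h, isFrame_iff_det_ne_zero.mpr (right_ne_zero_of_mul h), rfl⟩

/-- Singular matrices and dependent vectors are allowed, since the nondegenerate parameters form a
nonempty principal open set. This is the source of most degenerations. -/
theorem tabulated_mem_closure [Infinite k] (i : OrbitLabel) (m : Fin 2 → Fin 2 → k)
    (φ : Fin 5 → Fin 5 → k) :
    tabulated e i (Matrix.of m) φ ∈ zariskiClosure k (orbit k (OrbitLabel.rep e i)) := by
  have hP : IsPolynomialMap k fun w : (Fin 2 → Fin 2 → k) × (Fin 5 → Fin 5 → k) =>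
      tabulated e i (Matrix.of w.1) w.2 :=
    isPolynomialMap_tabulated e i (.fst isPolynomialMap_id) (.snd isPolynomialMap_id)
  refine hP.mem_zariskiClosure_of_forall
    (IsPolynomialMap.det_mul_det (.fst isPolynomialMap_id) (.snd isPolynomialMap_id))
    (w₀ := ((1 : Matrix (Fin 2) (Fin 2) k), (1 : Matrix (Fin 5) (Fin 5) k))) ?_
    (fun w hw => subset_zariskiClosure _ (tabulated_mem_orbit e hw)) (m, φ)
  change Matrix.det 1 * Matrix.det 1 ≠ 0
  simp

/-- The orbit with label `i` lies in the closure of the image of a polynomial map from `kᵈ`. -/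
def HasDominantChart (i : OrbitLabel) (d : ℕ) : Prop :=
  ∃ Q : (Fin d → k) → PencilSpace k F, IsPolynomialMap k Q ∧
    orbit k (OrbitLabel.rep e i) ⊆ zariskiClosure k (Set.range Q)

/-- It is enough to reach the parameters outside a hypersurface, so any chosen minors may be assumed
nonzero. -/
theorem hasDominantChart [Infinite k] (i : OrbitLabel) {d : ℕ}
    {Q : (Fin d → k) → Fin 2 → Fin 5 → Fin 5 → k} (hQ : IsPolynomialMap k Q)
    {g : (Fin 2 → Fin 2 → k) × (Fin 5 → Fin 5 → k) → k} (hg : IsPolynomialMap k g)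
    {m₀ : Fin 2 → Fin 2 → k} {φ₀ : Fin 5 → Fin 5 → k} (h₀ : g (m₀, φ₀) ≠ 0)
    (h : ∀ m φ, g (m, φ) ≠ 0 → ∃ u, Q u = skewPair i (Matrix.of m) φ) :
    HasDominantChart e i d := by
  refine ⟨fun u => ofPair e (Q u), (isPolynomialMap_ofPair e).comp hQ, fun f hf => ?_⟩
  obtain ⟨m, φ, -, -, rfl⟩ := (mem_orbit_rep_iff e).mp hf
  have hP : IsPolynomialMap k fun w : (Fin 2 → Fin 2 → k) × (Fin 5 → Fin 5 → k) =>
      tabulated e i (Matrix.of w.1) w.2 :=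
    isPolynomialMap_tabulated e i (.fst isPolynomialMap_id) (.snd isPolynomialMap_id)
  refine hP.mem_zariskiClosure_of_forall hg h₀ (fun w hw => subset_zariskiClosure _ ?_) (m, φ)
  obtain ⟨u, hu⟩ := h w.1 w.2 hw
  exact ⟨u, by rw [tabulated, ← hu]⟩

theorem HasDominantChart.zariskiDim_le [Infinite k] {i : OrbitLabel} {d : ℕ}
    (h : HasDominantChart e i d) {S : Set (PencilSpace k F)}
    (hS : S ⊆ zariskiClosure k (orbit k (OrbitLabel.rep e i))) : zariskiDim k S ≤ d := by
  obtain ⟨Q, hQ, hi⟩ := h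
  exact SkewPencil.zariskiDim_le hQ (hS.trans (zariskiClosure_subset_of_subset hi))

theorem le_zariskiDim_orbit [Infinite k] (i : OrbitLabel) {d : ℕ}
    {m : (Fin d → k) → Fin 2 → Fin 2 → k} (hm : IsPolynomialMap k m)
    {φ : (Fin d → k) → Fin 5 → Fin 5 → k} (hφ : IsPolynomialMap k φ)
    (h₀ : (Matrix.of (m 0)).det * (Matrix.of (φ 0)).det ≠ 0)
    (N : Fin d → (Fin 2 → Fin 5 → Fin 5 → k) → k) (hN : ∀ j, IsPolynomialMap k (N j))
    (h₁ : ∀ j x, (∀ l, j ≤ l → x l = 0) → N j (skewPair i (Matrix.of (m x)) (φ x)) = 0)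
    (h₂ : ∀ j, N j (skewPair i (Matrix.of (m (Pi.single j 1))) (φ (Pi.single j 1))) ≠ 0) :
    d ≤ zariskiDim k (orbit k (OrbitLabel.rep e i)) := by
  have hP : IsPolynomialMap k fun x => (tabulated e i (Matrix.of (m x)) (φ x) : PencilSpace k F) :=
    isPolynomialMap_tabulated e i hm hφ
  refine le_zariskiDim hP (hm.det_mul_det hφ) h₀
    (fun x hx => tabulated_mem_orbit e hx) fun j => ⟨fun f => N j (pencilCoord e f),
      (hN j).comp (isPolynomialMap_pencilCoord e), fun x hx => ?_, ?_⟩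
  · simp only [pencilCoord_tabulated]
    exact h₁ j x hx
  · simp only [pencilCoord_tabulated]
    exact h₂ j

end Charts

/-! ### Explicit charts and lower bounds for the dimensions -/

section LowerBounds

variable {k : Type*} [Field k]

/-- The Pfaffian of the leading `4 × 4` block. -/
def leadingPfaffian (A : Fin 5 → Fin 5 → k) : k :=
  A 0 1 * A 2 3 - A 0 2 * A 1 3 + A 0 3 * A 1 2

/-- The matrix part of a chart of the orbit `A₂ + A₁`. -/
def chartMatrixA2A1 (x : Fin 18 → k) : Fin 2 → Fin 2 → k := ![![1, 0], ![x 17, -1]]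

/-- The frame part of a chart of the orbit `A₂ + A₁`. -/
def chartFrameA2A1 (x : Fin 18 → k) : Fin 5 → Fin 5 → k :=
  ![![0, x 13, x 14, x 15, 1 + x 16], ![1, x 6, x 7, x 8, x 0],
    ![0, 1 + x 1, 0, (1 + x 1) * x 2, (1 + x 1) * x 3], ![0, x 9, x 10, 1 + x 11, x 12],
    ![0, 0, 1, x 4, x 5]]

/-- The matrix part of a chart of the orbit `A₂`. -/
def chartMatrixA2 (x : Fin 16 → k) : Fin 2 → Fin 2 → k :=
  ![![x 14, 1 + x 12 - x 14], ![1 + x 13, x 15 - (1 + x 13)]]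

/-- The frame part of a chart of the orbit `A₂`. -/
def chartFrameA2 (x : Fin 16 → k) : Fin 5 → Fin 5 → k :=
  ![![0, 0, 0, 0, 1], ![1, 0, x 0, x 1, x 2], ![x 6, x 7, 1, 0, x 8], ![0, 1, x 3, x 4, x 5],
    ![x 9, x 10, 0, 1, x 11]]

/-- The matrix part of a chart of the orbit `3A_{1,a}`. -/
def chartMatrixThreeA1a (x : Fin 15 → k) : Fin 2 → Fin 2 → k := ![![1, 0], ![x 14, 1 + x 12]]

/-- The frame part of a chart of the orbit `3A_{1,a}`. -/
def chartFrameThreeA1a (x : Fin 15 → k) : Fin 5 → Fin 5 → k :=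
  ![![0, 0, 0, 0, 1], ![1, 0, x 0, x 1, x 2], ![0, 1, x 3, x 4, x 5],
    ![0, x 13, x 13 * x 3 + (1 + x 6), x 13 * x 4 + x 7, x 13 * x 5 + x 8],
    ![0, 0, x 9, 1 + x 10, x 11]]

/-- The frame part of a chart of the orbit `3A_{1,b}`. -/
def chartFrameThreeA1b (x : Fin 12 → k) : Fin 5 → Fin 5 → k :=
  ![![1, x 0, x 1, x 2, x 3], ![0, 1 + x 4, x 5, x 6, x 7], ![0, x 8, 1 + x 9, x 10, x 11],
    ![0, 0, 0, 1, 0], ![0, 0, 0, 0, 1]]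

/-- The matrix part of a chart of the orbit `3A_{1,c}`. -/
def chartMatrixThreeA1c (x : Fin 11 → k) : Fin 2 → Fin 2 → k := ![![1 + x 9, 0], ![0, 1 + x 10]]

/-- The frame part of a chart of the orbit `3A_{1,c}`. -/
def chartFrameThreeA1c (x : Fin 11 → k) : Fin 5 → Fin 5 → k :=
  ![![0, 0, 1, 0, 0], ![1, 0, x 3, x 4, x 5], ![0, 0, x 2, 1 + x 1, 0], ![0, 1, x 6, x 7, x 8],
    ![0, 0, x 0, 0, 1]]

/-- The matrix part of a chart of the orbit `2A₁`. -/
def chartMatrixTwoA1 (x : Fin 8 → k) : Fin 2 → Fin 2 → k := ![![1 + x 6, 0], ![0, 1 + x 7]]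

/-- The frame part of a chart of the orbit `2A₁`. -/
def chartFrameTwoA1 (x : Fin 8 → k) : Fin 5 → Fin 5 → k :=
  ![![1, 0, x 0, x 1, x 2], ![0, 1, x 3, x 4, x 5], ![0, 0, 1, 0, 0], ![0, 0, 0, 1, 0],
    ![0, 0, 0, 0, 1]]

attribute [fun_prop] isPolynomialMap_apply

theorem isPolynomialMap_chartMatrixA2A1 : IsPolynomialMap k (chartMatrixA2A1 (k := k)) := by
  refine .pi fun i => .pi fun j => ?_
  fin_cases i <;> fin_cases j <;> simp [chartMatrixA2A1] <;> fun_prop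

theorem isPolynomialMap_chartFrameA2A1 : IsPolynomialMap k (chartFrameA2A1 (k := k)) := by
  refine .pi fun i => .pi fun j => ?_
  fin_cases i <;> fin_cases j <;> simp [chartFrameA2A1] <;> fun_prop

theorem isPolynomialMap_chartMatrixA2 : IsPolynomialMap k (chartMatrixA2 (k := k)) := by
  refine .pi fun i => .pi fun j => ?_
  fin_cases i <;> fin_cases j <;> simp [chartMatrixA2] <;> fun_prop

theorem isPolynomialMap_chartFrameA2 : IsPolynomialMap k (chartFrameA2 (k := k)) := by
  refine .pi fun i => .pi fun j => ?_
  fin_cases i <;> fin_cases j <;> simp [chartFrameA2] <;> fun_prop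

theorem isPolynomialMap_chartMatrixThreeA1a : IsPolynomialMap k (chartMatrixThreeA1a (k := k)) := by
  refine .pi fun i => .pi fun j => ?_
  fin_cases i <;> fin_cases j <;> simp [chartMatrixThreeA1a] <;> fun_prop

theorem isPolynomialMap_chartFrameThreeA1a : IsPolynomialMap k (chartFrameThreeA1a (k := k)) := by
  refine .pi fun i => .pi fun j => ?_
  fin_cases i <;> fin_cases j <;> simp [chartFrameThreeA1a] <;> fun_prop

theorem isPolynomialMap_chartFrameThreeA1b : IsPolynomialMap k (chartFrameThreeA1b (k := k)) := by
  refine .pi fun i => .pi fun j => ?_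
  fin_cases i <;> fin_cases j <;> simp [chartFrameThreeA1b] <;> fun_prop

theorem isPolynomialMap_chartMatrixThreeA1c : IsPolynomialMap k (chartMatrixThreeA1c (k := k)) := by
  refine .pi fun i => .pi fun j => ?_
  fin_cases i <;> fin_cases j <;> simp [chartMatrixThreeA1c] <;> fun_prop

theorem isPolynomialMap_chartFrameThreeA1c : IsPolynomialMap k (chartFrameThreeA1c (k := k)) := by
  refine .pi fun i => .pi fun j => ?_
  fin_cases i <;> fin_cases j <;> simp [chartFrameThreeA1c] <;> fun_prop

theorem isPolynomialMap_chartMatrixTwoA1 : IsPolynomialMap k (chartMatrixTwoA1 (k := k)) := by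
  refine .pi fun i => .pi fun j => ?_
  fin_cases i <;> fin_cases j <;> simp [chartMatrixTwoA1] <;> fun_prop

theorem isPolynomialMap_chartFrameTwoA1 : IsPolynomialMap k (chartFrameTwoA1 (k := k)) := by
  refine .pi fun i => .pi fun j => ?_
  fin_cases i <;> fin_cases j <;> simp [chartFrameTwoA1] <;> fun_prop

variable [Infinite k] {F : Type*} [AddCommGroup F] [Module k F] [FiniteDimensional k F]
  (e : Module.Basis (Fin 5) k (Module.Dual k F))

/-- The listed functions are matrix entries minus their value at the base point, each detecting one
chart coordinate once the later ones vanish. The Pfaffian detects the mixing coordinate: without it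
the second form has rank two. -/
theorem le_zariskiDim_A2A1 :
    ((18 : ℕ) : WithBot ℕ∞) ≤ zariskiDim k (orbit k (OrbitLabel.rep e .A2_A1)) := by
  refine le_zariskiDim_orbit e .A2_A1 isPolynomialMap_chartMatrixA2A1
    isPolynomialMap_chartFrameA2A1 ?_
    ![fun T => T 0 3 4, fun T => T 0 1 2 - 1, fun T => T 0 2 3, fun T => T 0 2 4, fun T => T 0
      1 3, fun T => T 0 1 4, fun T => T 1 1 4, fun T => T 1 2 4, fun T => T 1 3 4, fun T => T
      0 0 1, fun T => T 0 0 2, fun T => T 0 0 3 - 1, fun T => T 0 0 4, fun T => T 1 0 1, fun T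
      => T 1 0 2, fun T => T 1 0 3, fun T => T 1 0 4 - 1, fun T => leadingPfaffian (T 1)]
    ?_ ?_ ?_
  · simp [chartMatrixA2A1, chartFrameA2A1, Matrix.det_succ_row_zero, Fin.sum_univ_succ,
      Fin.succAbove]
  · intro j
    fin_cases j <;> simp [leadingPfaffian] <;> fun_prop
  · intro j x hx
    fin_cases j <;>
      simp [skewPair, skewRep, skew_apply, chartMatrixA2A1, chartFrameA2A1, leadingPfaffian, hx]
    all_goals ring
  · intro j
    fin_cases j <;>
      simp [skewPair, skewRep, skew_apply, chartMatrixA2A1, chartFrameA2A1, leadingPfaffian]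

/-- At the base point the two forms are the two products `skew (φ 1) (φ 3)` and `skew (φ 2) (φ 4)`,
in this order. The Pfaffians detect the admixture of each product to the other. -/
theorem le_zariskiDim_A2 :
    ((16 : ℕ) : WithBot ℕ∞) ≤ zariskiDim k (orbit k (OrbitLabel.rep e .A2)) := by
  refine le_zariskiDim_orbit e .A2 isPolynomialMap_chartMatrixA2
    isPolynomialMap_chartFrameA2 ?_
    ![fun T => T 0 1 2, fun T => T 0 1 3, fun T => T 0 1 4, fun T => T 0 0 2, fun T => T 0 0
      3, fun T => T 0 0 4, fun T => T 1 0 3, fun T => T 1 1 3, fun T => T 1 3 4, fun T => T 1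
      0 2, fun T => T 1 1 2, fun T => T 1 2 4, fun T => T 0 0 1 - 1, fun T => T 1 2 3 - 1, fun
      T => leadingPfaffian (T 0), fun T => leadingPfaffian (T 1)]
    ?_ ?_ ?_
  · simp [chartMatrixA2, chartFrameA2, Matrix.det_succ_row_zero, Fin.sum_univ_succ,
      Fin.succAbove]
  · intro j
    fin_cases j <;> simp [leadingPfaffian] <;> fun_prop
  · intro j x hx
    fin_cases j <;>
      simp [skewPair, skewRep, skew_apply, chartMatrixA2, chartFrameA2, leadingPfaffian, hx]
    all_goals ring
  · intro j
    fin_cases j <;>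
      simp [skewPair, skewRep, skew_apply, chartMatrixA2, chartFrameA2, leadingPfaffian]

theorem le_zariskiDim_threeA1a :
    ((15 : ℕ) : WithBot ℕ∞) ≤ zariskiDim k (orbit k (OrbitLabel.rep e .threeA1a)) := by
  refine le_zariskiDim_orbit e .threeA1a isPolynomialMap_chartMatrixThreeA1a
    isPolynomialMap_chartFrameThreeA1a ?_
    ![fun T => T 1 1 2, fun T => T 1 1 3, fun T => T 1 1 4, fun T => T 1 0 2, fun T => T 1 0
      3, fun T => T 1 0 4, fun T => T 0 0 2 - 1, fun T => T 0 0 3, fun T => T 0 0 4, fun T =>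
      T 0 1 2, fun T => T 0 1 3 - 1, fun T => T 0 1 4, fun T => T 1 0 1 - 1, fun T => T 0 0 1,
      fun T => leadingPfaffian (T 1)]
    ?_ ?_ ?_
  · simp [chartMatrixThreeA1a, chartFrameThreeA1a, Matrix.det_succ_row_zero, Fin.sum_univ_succ,
      Fin.succAbove]
  · intro j
    fin_cases j <;> simp [leadingPfaffian] <;> fun_prop
  · intro j x hx
    fin_cases j <;>
      simp [skewPair, skewRep, skew_apply, chartMatrixThreeA1a, chartFrameThreeA1a, leadingPfaffian, hx]
    all_goals ring
  · intro j
    fin_cases j <;>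
      simp [skewPair, skewRep, skew_apply, chartMatrixThreeA1a, chartFrameThreeA1a, leadingPfaffian]

theorem le_zariskiDim_threeA1b :
    ((12 : ℕ) : WithBot ℕ∞) ≤ zariskiDim k (orbit k (OrbitLabel.rep e .threeA1b)) := by
  refine le_zariskiDim_orbit e .threeA1b (isPolynomialMap_const ![![1, 0], ![0, 1]])
    isPolynomialMap_chartFrameThreeA1b ?_
    ![fun T => T 1 1 2, fun T => T 0 1 2, fun T => T 0 1 3, fun T => T 0 1 4, fun T => T 0 0 1
      - 1, fun T => T 0 0 2, fun T => T 0 0 3, fun T => T 0 0 4, fun T => T 1 0 1, fun T => T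
      1 0 2 - 1, fun T => T 1 0 3, fun T => T 1 0 4]
    ?_ ?_ ?_
  · simp [chartFrameThreeA1b, Matrix.det_succ_row_zero, Fin.sum_univ_succ,
      Fin.succAbove]
  · intro j
    fin_cases j <;> simp <;> fun_prop
  · intro j x hx
    fin_cases j <;>
      simp [skewPair, skewRep, skew_apply, chartFrameThreeA1b, hx]
  · intro j
    fin_cases j <;>
      simp [skewPair, skewRep, skew_apply, chartFrameThreeA1b]

theorem le_zariskiDim_threeA1c :
    ((11 : ℕ) : WithBot ℕ∞) ≤ zariskiDim k (orbit k (OrbitLabel.rep e .threeA1c)) := by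
  refine le_zariskiDim_orbit e .threeA1c isPolynomialMap_chartMatrixThreeA1c
    isPolynomialMap_chartFrameThreeA1c ?_
    ![fun T => T 0 2 3, fun T => T 0 3 4 - 1, fun T => T 0 2 4, fun T => T 0 1 2, fun T => T 0
      1 3, fun T => T 0 1 4, fun T => T 0 0 2, fun T => T 0 0 3, fun T => T 0 0 4, fun T => T
      0 0 1 - 1, fun T => T 1 0 1 - 1]
    ?_ ?_ ?_
  · simp [chartMatrixThreeA1c, chartFrameThreeA1c, Matrix.det_succ_row_zero, Fin.sum_univ_succ,
      Fin.succAbove]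
  · intro j
    fin_cases j <;> simp <;> fun_prop
  · intro j x hx
    fin_cases j <;>
      simp [skewPair, skewRep, skew_apply, chartMatrixThreeA1c, chartFrameThreeA1c, hx]
  · intro j
    fin_cases j <;>
      simp [skewPair, skewRep, skew_apply, chartMatrixThreeA1c, chartFrameThreeA1c]

theorem le_zariskiDim_twoA1 :
    ((8 : ℕ) : WithBot ℕ∞) ≤ zariskiDim k (orbit k (OrbitLabel.rep e .twoA1)) := by
  refine le_zariskiDim_orbit e .twoA1 isPolynomialMap_chartMatrixTwoA1
    isPolynomialMap_chartFrameTwoA1 ?_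
    ![fun T => T 0 1 2, fun T => T 0 1 3, fun T => T 0 1 4, fun T => T 0 0 2, fun T => T 0 0
      3, fun T => T 0 0 4, fun T => T 0 0 1 - 1, fun T => T 1 0 1 - 1]
    ?_ ?_ ?_
  · simp [chartMatrixTwoA1, chartFrameTwoA1, Matrix.det_succ_row_zero, Fin.sum_univ_succ,
      Fin.succAbove]
  · intro j
    fin_cases j <;> simp <;> fun_prop
  · intro j x hx
    fin_cases j <;>
      simp [skewPair, skewRep, skew_apply, chartMatrixTwoA1, chartFrameTwoA1, hx]
  · intro j
    fin_cases j <;>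
      simp [skewPair, skewRep, skew_apply, chartMatrixTwoA1, chartFrameTwoA1]

end LowerBounds

/-! ### Dominant charts for `2A₁`, `3A_{1,b}` and `3A_{1,c}` -/

section UpperBounds

variable {k : Type*} [Field k]

/-- Normalization of a basis of a plane by a nonvanishing Plücker coordinate. -/
theorem exists_normalized_pair {a b : Fin 5 → k} {i j : Fin 5} {δ : k}
    (hδ : δ = a i * b j - a j * b i) (h : δ ≠ 0) :
    ∃ f g : Fin 5 → k, f i = 1 ∧ f j = 0 ∧ g i = 0 ∧ g j = 1 ∧
      a = a i • f + a j • g ∧ b = b i • f + b j • g ∧ skew a b = δ • skew f g ∧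
      ∀ l, a l = 0 → b l = 0 → f l = 0 ∧ g l = 0 := by
  refine ⟨(1 / δ) • (b j • a - a j • b), (1 / δ) • (a i • b - b i • a), ?_, ?_, ?_, ?_, ?_, ?_,
    ?_, ?_⟩
  · simp
    field_simp
    linear_combination -hδ
  · simp
    right
    ring
  · simp
    right
    ring
  · simp
    field_simp
    linear_combination -hδ
  · ext l
    simp
    field_simp
    linear_combination (a l) * hδ
  · ext l
    simp
    field_simp
    linear_combination (b l) * hδ
  · ext l l'
    simp [skew_apply]
    field_simp
    linear_combination (a l * b l' - a l' * b l) * hδ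
  · intro l ha hb
    simp [ha, hb]

theorem vec_eq {α : Type*} (x : Fin 5 → α) : ![x 0, x 1, x 2, x 3, x 4] = x := by
  ext i
  fin_cases i <;> rfl

/-- A polynomial map with dense image in the pencils spanned by one form of rank four. -/
def chartThreeA1c (x : Fin 11 → k) : Fin 2 → Fin 5 → Fin 5 → k :=
  let ω := skew ![1, 0, x 0, x 1, x 2] ![0, 1, x 3, x 4, x 5]
    + x 6 • skew ![0, 0, 1, 0, 0] ![0, 0, 0, 1, 0] + x 7 • skew ![0, 0, 1, 0, 0] ![0, 0, 0, 0, 1]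
    + x 8 • skew ![0, 0, 0, 1, 0] ![0, 0, 0, 0, 1]
  ![x 9 • ω, x 10 • ω]

theorem isPolynomialMap_chartThreeA1c : IsPolynomialMap k (chartThreeA1c (k := k)) := by
  refine .pi fun r => .pi fun i => .pi fun j => ?_
  fin_cases r <;> fin_cases i <;> fin_cases j <;> simp [chartThreeA1c, skew_apply] <;> fun_prop

variable [Infinite k] {F : Type*} [AddCommGroup F] [Module k F] [FiniteDimensional k F]
  (e : Module.Basis (Fin 5) k (Module.Dual k F))

theorem hasDominantChart_twoA1 : HasDominantChart e .twoA1 8 := by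
  refine hasDominantChart e .twoA1
    (isPolynomialMap_chartMatrixTwoA1.skewPair .twoA1 isPolynomialMap_chartFrameTwoA1)
    (g := fun w => w.2 0 0 * w.2 1 1 - w.2 0 1 * w.2 1 0) (by fun_prop)
    (m₀ := chartMatrixTwoA1 0) (φ₀ := chartFrameTwoA1 0) (by simp [chartFrameTwoA1]) ?_
  intro m φ h
  obtain ⟨f, g, hf0, hf1, hg0, hg1, -, -, hfg, -⟩ := exists_normalized_pair rfl h
  dsimp only at h hfg
  generalize φ 0 0 * φ 1 1 - φ 0 1 * φ 1 0 = δ at h hfg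
  refine ⟨![f 2, f 3, f 4, g 2, g 3, g 4, (m 0 0 + m 0 1) * δ - 1, (m 1 0 + m 1 1) * δ - 1], ?_⟩
  have h0 : chartFrameTwoA1 ![f 2, f 3, f 4, g 2, g 3, g 4, (m 0 0 + m 0 1) * δ - 1,
      (m 1 0 + m 1 1) * δ - 1] 0 = f := by
    rw [← vec_eq f]
    simp [chartFrameTwoA1, hf0, hf1]
  have h1 : chartFrameTwoA1 ![f 2, f 3, f 4, g 2, g 3, g 4, (m 0 0 + m 0 1) * δ - 1,
      (m 1 0 + m 1 1) * δ - 1] 1 = g := by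
    rw [← vec_eq g]
    simp [chartFrameTwoA1, hg0, hg1]
  ext r a b
  fin_cases r
  · simp [skewPair, skewRep, chartMatrixTwoA1, h0, h1, hfg]
    ring
  · simp [skewPair, skewRep, chartMatrixTwoA1, h0, h1, hfg]
    ring

theorem hasDominantChart_threeA1b : HasDominantChart e .threeA1b 12 := by
  refine hasDominantChart e .threeA1b
    ((isPolynomialMap_const ![![1, 0], ![0, 1]]).skewPair .threeA1b
      isPolynomialMap_chartFrameThreeA1b)
    (g := fun w => w.2 0 0) (by fun_prop)
    (m₀ := ![![1, 0], ![0, 1]]) (φ₀ := chartFrameThreeA1b 0) (by simp [chartFrameThreeA1b]) ?_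
  intro m φ h
  dsimp only at h
  obtain ⟨f, hf⟩ : ∃ f, f = (1 / φ 0 0) • φ 0 := ⟨_, rfl⟩
  have hf0 : f 0 = 1 := by simp [hf, h]
  have hφ : φ 0 = φ 0 0 • f := by
    rw [hf, smul_smul, mul_one_div_cancel h, one_smul]
  obtain ⟨y', hy'⟩ : ∃ y', y' = φ 0 0 • (m 0 0 • φ 1 + m 0 1 • φ 2) := ⟨_, rfl⟩
  obtain ⟨z', hz'⟩ : ∃ z', z' = φ 0 0 • (m 1 0 • φ 1 + m 1 1 • φ 2) := ⟨_, rfl⟩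
  obtain ⟨y, hy⟩ : ∃ y, y = y' - y' 0 • f := ⟨_, rfl⟩
  obtain ⟨z, hz⟩ : ∃ z, z = z' - z' 0 • f := ⟨_, rfl⟩
  have hy0 : y 0 = 0 := by simp [hy, hf0]
  have hz0 : z 0 = 0 := by simp [hz, hf0]
  obtain ⟨u, hu⟩ : ∃ u : Fin 12 → k, u = ![f 1, f 2, f 3, f 4, y 1 - 1, y 2, y 3, y 4,
    z 1, z 2 - 1, z 3, z 4] := ⟨_, rfl⟩
  have h0 : chartFrameThreeA1b u 0 = f := by
    rw [← vec_eq f]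
    simp [chartFrameThreeA1b, hf0, hu]
  have h1 : chartFrameThreeA1b u 1 = y := by
    rw [← vec_eq y]
    simp [chartFrameThreeA1b, hy0, hu]
  have h2 : chartFrameThreeA1b u 2 = z := by
    rw [← vec_eq z]
    simp [chartFrameThreeA1b, hz0, hu]
  refine ⟨u, ?_⟩
  ext r a b
  have ha := congrFun hφ a
  have hb := congrFun hφ b
  simp only [Pi.smul_apply, smul_eq_mul] at ha hb
  fin_cases r
  · simp [skewPair, skewRep, h0, h1, h2, skew_apply, hy, hy']
    rw [ha, hb]
    ring
  · simp [skewPair, skewRep, h0, h1, h2, skew_apply, hz, hz']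
    rw [ha, hb]
    ring

theorem hasDominantChart_threeA1c : HasDominantChart e .threeA1c 11 := by
  refine hasDominantChart e .threeA1c isPolynomialMap_chartThreeA1c
    (g := fun w => skewRep w.2 .threeA1c 0 0 1)
    (by simp only [skewRep, Matrix.cons_val_zero]; fun_prop)
    (m₀ := chartMatrixThreeA1c 0) (φ₀ := chartFrameThreeA1c 0)
    (by simp [chartFrameThreeA1c, skewRep, skew_apply]) ?_
  intro m φ h
  obtain ⟨ω, hω⟩ : ∃ ω, ω = skewRep φ .threeA1c 0 := ⟨_, rfl⟩
  have hω' : skewRep φ .threeA1c 1 = ω := hω.symm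
  have hd : ∀ i, ω i i = 0 := fun i => by
    rw [hω]
    exact skew_add_skew_diag _ _ _ _ i
  have hs : ∀ i j, ω j i = -ω i j := fun i j => by
    rw [hω]
    exact skew_add_skew_swap _ _ _ _ i j
  dsimp only at h
  rw [← hω] at h
  -- Elimination with pivot `ω 0 1`: the first two rows give the two vectors, and the Schur
  -- complement gives the three remaining coefficients.
  refine ⟨![-ω 1 2 / ω 0 1, -ω 1 3 / ω 0 1, -ω 1 4 / ω 0 1, ω 0 2 / ω 0 1, ω 0 3 / ω 0 1,
    ω 0 4 / ω 0 1, ω 2 3 / ω 0 1 + (ω 1 2 * ω 0 3 - ω 1 3 * ω 0 2) / ω 0 1 ^ 2,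
    ω 2 4 / ω 0 1 + (ω 1 2 * ω 0 4 - ω 1 4 * ω 0 2) / ω 0 1 ^ 2,
    ω 3 4 / ω 0 1 + (ω 1 3 * ω 0 4 - ω 1 4 * ω 0 3) / ω 0 1 ^ 2,
    (m 0 0 + m 0 1) * ω 0 1, (m 1 0 + m 1 1) * ω 0 1], ?_⟩
  have key : ∀ c : k, (c * ω 0 1) • (skew ![1, 0, -ω 1 2 / ω 0 1, -ω 1 3 / ω 0 1, -ω 1 4 / ω 0 1]
      ![0, 1, ω 0 2 / ω 0 1, ω 0 3 / ω 0 1, ω 0 4 / ω 0 1]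
      + (ω 2 3 / ω 0 1 + (ω 1 2 * ω 0 3 - ω 1 3 * ω 0 2) / ω 0 1 ^ 2)
        • skew ![0, 0, 1, 0, 0] ![0, 0, 0, 1, 0]
      + (ω 2 4 / ω 0 1 + (ω 1 2 * ω 0 4 - ω 1 4 * ω 0 2) / ω 0 1 ^ 2)
        • skew ![0, 0, 1, 0, 0] ![0, 0, 0, 0, 1]
      + (ω 3 4 / ω 0 1 + (ω 1 3 * ω 0 4 - ω 1 4 * ω 0 3) / ω 0 1 ^ 2)
        • skew ![0, 0, 0, 1, 0] ![0, 0, 0, 0, 1]) = c • ω := by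
    intro c
    have hs' : ω 1 0 = -ω 0 1 ∧ ω 2 0 = -ω 0 2 ∧ ω 3 0 = -ω 0 3 ∧ ω 4 0 = -ω 0 4 ∧ ω 2 1 = -ω 1 2
      ∧ ω 3 1 = -ω 1 3 ∧ ω 4 1 = -ω 1 4 ∧ ω 3 2 = -ω 2 3 ∧ ω 4 2 = -ω 2 4 ∧ ω 4 3 = -ω 3 4 :=
      ⟨hs _ _, hs _ _, hs _ _, hs _ _, hs _ _, hs _ _, hs _ _, hs _ _, hs _ _, hs _ _⟩
    ext i j
    fin_cases i <;> fin_cases j <;> simp [skew_apply, hd, hs'] <;> field_simp <;> ring_nf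
  ext1 r
  fin_cases r
  · simp only [skewPair, hω', ← hω, ← add_smul]
    exact key _
  · simp only [skewPair, hω', ← hω, ← add_smul]
    exact key _

end UpperBounds

/-! ### Dominant charts for `A₂`, `3A_{1,a}` and `A₂ + A₁` -/

section UpperBounds

variable {k : Type*} [Field k]

theorem exists_chart_threeA1a {f g u v : Fin 5 → k} (hf0 : f 0 = 1) (hf1 : f 1 = 0)
    (hg0 : g 0 = 0) (hg1 : g 1 = 1) (hu0 : u 0 = 0) (hu1 : u 1 = 0) (hv0 : v 0 = 0)
    (hv1 : v 1 = 0) (α l b : k) :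
    ∃ x, skewPair .threeA1a (Matrix.of (chartMatrixThreeA1a x)) (chartFrameThreeA1a x) =
      ![α • skew f g + skew f u + skew g v,
        l • (α • skew f g + skew f u + skew g v) + b • skew f g] := by
  obtain ⟨x, hx⟩ : ∃ x : Fin 15 → k, x = ![f 2, f 3, f 4, g 2, g 3, g 4, u 2 - 1, u 3, u 4, v 2,
    v 3 - 1, v 4, b - 1, α, l] := ⟨_, rfl⟩
  have hM : chartMatrixThreeA1a x = ![![1, 0], ![l, b]] := by simp [chartMatrixThreeA1a, hx]
  have h1 : chartFrameThreeA1a x 1 = f := by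
    rw [← vec_eq f]
    simp [chartFrameThreeA1a, hf0, hf1, hx]
  have h2 : chartFrameThreeA1a x 2 = g := by
    rw [← vec_eq g]
    simp [chartFrameThreeA1a, hg0, hg1, hx]
  have h3 : chartFrameThreeA1a x 3 = α • g + u := by
    rw [← vec_eq (α • g + u)]
    simp [chartFrameThreeA1a, hg0, hg1, hu0, hu1, hx]
  have h4 : chartFrameThreeA1a x 4 = v := by
    rw [← vec_eq v]
    simp [chartFrameThreeA1a, hv0, hv1, hx]
  refine ⟨x, ?_⟩
  ext r a b
  fin_cases r
  · simp [skewPair, skewRep, hM, h1, h2, h3, h4, skew_apply]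
    ring
  · simp [skewPair, skewRep, hM, h1, h2, h3, h4, skew_apply]
    ring

theorem exists_chart_A2A1 {f α β p q : Fin 5 → k} (hf0 : f 0 = 1) (hα0 : α 0 = 0) (hβ0 : β 0 = 0)
    (hp0 : p 0 = 0) (hp1 : p 1 = 1) (hp2 : p 2 = 0) (hq0 : q 0 = 0) (hq1 : q 1 = 0)
    (hq2 : q 2 = 1) (c l : k) :
    ∃ x, skewPair .A2_A1 (Matrix.of (chartMatrixA2A1 x)) (chartFrameA2A1 x) =
      ![skew f α + c • skew p q, l • (skew f α + c • skew p q) + skew f β] := by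
  obtain ⟨x, hx⟩ : ∃ x : Fin 18 → k, x = ![f 4, c - 1, p 3, p 4, q 3, q 4, f 1, f 2, f 3, α 1, α 2,
    α 3 - 1, α 4, β 1, β 2, β 3, β 4 - 1, l] := ⟨_, rfl⟩
  have hM : chartMatrixA2A1 x = ![![1, 0], ![l, -1]] := by simp [chartMatrixA2A1, hx]
  have h0 : chartFrameA2A1 x 0 = β := by
    rw [← vec_eq β]
    simp [chartFrameA2A1, hβ0, hx]
  have h1 : chartFrameA2A1 x 1 = f := by
    rw [← vec_eq f]
    simp [chartFrameA2A1, hf0, hx]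
  have h2 : chartFrameA2A1 x 2 = c • p := by
    rw [← vec_eq (c • p)]
    simp [chartFrameA2A1, hp0, hp1, hp2, hx]
  have h3 : chartFrameA2A1 x 3 = α := by
    rw [← vec_eq α]
    simp [chartFrameA2A1, hα0, hx]
  have h4 : chartFrameA2A1 x 4 = q := by
    rw [← vec_eq q]
    simp [chartFrameA2A1, hq0, hq1, hq2, hx]
  refine ⟨x, ?_⟩
  ext r a b
  fin_cases r
  · simp [skewPair, skewRep, hM, h0, h1, h2, h3, h4, skew_apply]
    ring
  · simp [skewPair, skewRep, hM, h0, h1, h2, h3, h4, skew_apply]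
    ring

variable [Infinite k] {F : Type*} [AddCommGroup F] [Module k F] [FiniteDimensional k F]
  (e : Module.Basis (Fin 5) k (Module.Dual k F))

/-- Such a pair is spanned by two products. Each of the two planes has six affine coordinates, and
four scalars express the pair through the products. -/
theorem hasDominantChart_A2 : HasDominantChart e .A2 16 := by
  refine hasDominantChart e .A2
    (isPolynomialMap_chartMatrixA2.skewPair .A2 isPolynomialMap_chartFrameA2)
    (g := fun w => (w.2 1 0 * w.2 3 1 - w.2 1 1 * w.2 3 0)
      * (w.2 2 2 * w.2 4 3 - w.2 2 3 * w.2 4 2)) (by fun_prop)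
    (m₀ := chartMatrixA2 0) (φ₀ := chartFrameA2 0) (by simp [chartFrameA2]) ?_
  intro m φ h
  dsimp only at h
  obtain ⟨f, g, hf0, hf1, hg0, hg1, -, -, hfg, -⟩ :=
    exists_normalized_pair rfl (left_ne_zero_of_mul h)
  obtain ⟨p, q, hp2, hp3, hq2, hq3, -, -, hpq, -⟩ :=
    exists_normalized_pair rfl (right_ne_zero_of_mul h)
  generalize φ 1 0 * φ 3 1 - φ 1 1 * φ 3 0 = δ at hfg
  generalize φ 2 2 * φ 4 3 - φ 2 3 * φ 4 2 = ε at hpq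
  obtain ⟨u, hu⟩ : ∃ u : Fin 16 → k, u = ![f 2, f 3, f 4, g 2, g 3, g 4, p 0, p 1, p 4, q 0, q 1,
    q 4, (m 0 0 + m 0 1) * δ - 1, m 1 0 * ε - 1, m 0 0 * ε, (m 1 0 + m 1 1) * δ] := ⟨_, rfl⟩
  have hM : chartMatrixA2 u = ![![m 0 0 * ε, (m 0 0 + m 0 1) * δ - m 0 0 * ε],
      ![m 1 0 * ε, (m 1 0 + m 1 1) * δ - m 1 0 * ε]] := by
    simp [chartMatrixA2, hu]
  have h1 : chartFrameA2 u 1 = f := by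
    rw [← vec_eq f]
    simp [chartFrameA2, hf0, hf1, hu]
  have h2 : chartFrameA2 u 2 = p := by
    rw [← vec_eq p]
    simp [chartFrameA2, hp2, hp3, hu]
  have h3 : chartFrameA2 u 3 = g := by
    rw [← vec_eq g]
    simp [chartFrameA2, hg0, hg1, hu]
  have h4 : chartFrameA2 u 4 = q := by
    rw [← vec_eq q]
    simp [chartFrameA2, hq2, hq3, hu]
  refine ⟨u, ?_⟩
  ext r a b
  fin_cases r
  · simp [skewPair, skewRep, hM, h1, h2, h3, h4, hfg, hpq]
    ring
  · simp [skewPair, skewRep, hM, h1, h2, h3, h4, hfg, hpq]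
    ring

/-- The plane of `φ 1, φ 2` gets an echelon basis `f, g`, and `ω₁` becomes `f ∧ U + g ∧ V`. Removing
the components of `U, V` along `f, g` costs only a multiple of `f ∧ g`. This leaves twelve vector
entries and three scalars. -/
theorem hasDominantChart_threeA1a : HasDominantChart e .threeA1a 15 := by
  refine hasDominantChart e .threeA1a
    (isPolynomialMap_chartMatrixThreeA1a.skewPair .threeA1a isPolynomialMap_chartFrameThreeA1a)
    (g := fun w => w.1 0 0 * (w.2 1 0 * w.2 2 1 - w.2 1 1 * w.2 2 0)) (by fun_prop)
    (m₀ := chartMatrixThreeA1a 0) (φ₀ := chartFrameThreeA1a 0)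
    (by simp [chartMatrixThreeA1a, chartFrameThreeA1a]) ?_
  intro m φ h
  dsimp only at h
  have hm := left_ne_zero_of_mul h
  obtain ⟨f, g, hf0, hf1, hg0, hg1, hφ1, hφ2, hfg, -⟩ :=
    exists_normalized_pair rfl (right_ne_zero_of_mul h)
  generalize φ 1 0 * φ 2 1 - φ 1 1 * φ 2 0 = δ at hfg
  generalize φ 1 0 = c₁₀ at hφ1 hφ2
  generalize φ 1 1 = c₁₁ at hφ1 hφ2
  generalize φ 2 0 = c₂₀ at hφ1 hφ2
  generalize φ 2 1 = c₂₁ at hφ1 hφ2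
  generalize hm00 : m 0 0 = m₀₀ at hm
  obtain ⟨U, hU⟩ : ∃ U, U = c₁₀ • φ 3 + c₂₀ • φ 4 := ⟨_, rfl⟩
  obtain ⟨V, hV⟩ : ∃ V, V = c₁₁ • φ 3 + c₂₁ • φ 4 := ⟨_, rfl⟩
  have hω : skew (φ 1) (φ 3) + skew (φ 2) (φ 4) = skew f U + skew g V := by
    rw [hφ1, hφ2, hU, hV]
    ext a b
    simp [skew_apply]
    ring
  obtain ⟨x, hx⟩ := exists_chart_threeA1a hf0 hf1 hg0 hg1
    (u := m₀₀ • (U - U 0 • f - U 1 • g)) (v := m₀₀ • (V - V 0 • f - V 1 • g))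
    (by simp [hf0, hg0]) (by simp [hf1, hg1]) (by simp [hf0, hg0]) (by simp [hf1, hg1])
    (m₀₀ * (U 1 - V 0) + m 0 1 * δ) (m 1 0 / m₀₀) ((m 1 1 - m 1 0 * m 0 1 / m₀₀) * δ)
  refine ⟨x, hx.trans ?_⟩
  ext r a b
  fin_cases r
  · simp [skewPair, skewRep, hω, hfg, hm00]
    simp [skew_apply]
    ring
  · simp [skewPair, skewRep, hω, hfg]
    simp [skew_apply]
    field_simp
    ring

/-- All cross terms with the vector `φ 1`, scaled to `f`, are gathered as `f ∧ α` and `f ∧ β`, and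
what remains is a product of a plane in coordinates 1 to 4. The last factor of `g` is the minor of
`φ 1, φ 2, φ 4` in the first three columns. -/
theorem hasDominantChart_A2A1 : HasDominantChart e .A2_A1 18 := by
  refine hasDominantChart e .A2_A1
    (isPolynomialMap_chartMatrixA2A1.skewPair .A2_A1 isPolynomialMap_chartFrameA2A1)
    (g := fun w => w.1 0 0 * w.2 1 0 *
      (w.2 1 0 * (w.2 2 1 * w.2 4 2 - w.2 2 2 * w.2 4 1)
        - w.2 1 1 * (w.2 2 0 * w.2 4 2 - w.2 2 2 * w.2 4 0)
        + w.2 1 2 * (w.2 2 0 * w.2 4 1 - w.2 2 1 * w.2 4 0))) (by fun_prop)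
    (m₀ := chartMatrixA2A1 0) (φ₀ := chartFrameA2A1 0)
    (by simp [chartMatrixA2A1, chartFrameA2A1]) ?_
  intro m φ h
  dsimp only at h
  have hm := left_ne_zero_of_mul (left_ne_zero_of_mul h)
  have hc := right_ne_zero_of_mul (left_ne_zero_of_mul h)
  have hd := right_ne_zero_of_mul h
  obtain ⟨f, hf⟩ : ∃ f, f = (1 / φ 1 0) • φ 1 := ⟨_, rfl⟩
  have hf0 : f 0 = 1 := by simp [hf, hc]
  have hφ1 : φ 1 = φ 1 0 • f := by
    rw [hf, smul_smul, mul_one_div_cancel hc, one_smul]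
  obtain ⟨P, hP⟩ : ∃ P, P = φ 2 - φ 2 0 • f := ⟨_, rfl⟩
  obtain ⟨Q, hQ⟩ : ∃ Q, Q = φ 4 - φ 4 0 • f := ⟨_, rfl⟩
  have hPQ : P 1 * Q 2 - P 2 * Q 1 ≠ 0 := by
    refine right_ne_zero_of_mul (a := φ 1 0) (ne_of_eq_of_ne ?_ hd)
    simp [hP, hQ, hf]
    field_simp
    ring
  obtain ⟨p, q, hp1, hp2, hq1, hq2, -, -, hpq, h0⟩ := exists_normalized_pair rfl hPQ
  obtain ⟨hp0, hq0⟩ := h0 0 (by simp [hP, hf0]) (by simp [hQ, hf0])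
  generalize P 1 * Q 2 - P 2 * Q 1 = δ at hpq
  have hφ2 : φ 2 = P + φ 2 0 • f := by simp [hP]
  have hφ4 : φ 4 = Q + φ 4 0 • f := by simp [hQ]
  generalize φ 1 0 = c at hφ1 hc
  generalize φ 2 0 = s at hφ2
  generalize φ 4 0 = t at hφ4
  generalize hm00 : m 0 0 = m₀₀ at hm
  obtain ⟨α, hα⟩ : ∃ α, α = c • (m₀₀ • φ 3 - m 0 1 • φ 0) + m₀₀ • (s • Q - t • P) := ⟨_, rfl⟩
  -- The second form minus `m 1 0 / m₀₀` times the first is a multiple of `skew (φ 0) (φ 1)`, here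
  -- written as `f ∧ β`.
  obtain ⟨β, hβ⟩ : ∃ β, β = (c * (m 1 0 * m 0 1 / m₀₀ - m 1 1)) • φ 0 := ⟨_, rfl⟩
  obtain ⟨x, hx⟩ := exists_chart_A2A1 (α := α - α 0 • f) (β := β - β 0 • f) hf0 (by simp [hf0])
    (by simp [hf0]) hp0 hp1 hp2 hq0 hq1 hq2 (m₀₀ * δ) (m 1 0 / m₀₀)
  refine ⟨x, hx.trans ?_⟩
  have hA : skew f (α - α 0 • f) + (m₀₀ * δ) • skew p q
      = m₀₀ • (skew (φ 1) (φ 3) + skew (φ 2) (φ 4)) + m 0 1 • skew (φ 0) (φ 1) := by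
    rw [hφ1, hφ2, hφ4, mul_smul, ← hpq]
    generalize α 0 = α₀
    rw [hα]
    ext a b
    simp [skew_apply]
    ring
  ext1 r
  fin_cases r
  · simpa [skewPair, skewRep, hm00] using hA
  · have hB : (m 1 0 / m₀₀) • (skew f (α - α 0 • f) + (m₀₀ * δ) • skew p q)
        + skew f (β - β 0 • f)
        = m 1 0 • (skew (φ 1) (φ 3) + skew (φ 2) (φ 4)) + m 1 1 • skew (φ 0) (φ 1) := by
      rw [hA, hφ1]
      generalize β 0 = β₀
      rw [hβ]
      ext a b
      simp [skew_apply]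
      field_simp
      ring
    simpa [skewPair, skewRep] using hB

end UpperBounds

/-! ### The open orbit, the dimensions and the disjointness of the orbits -/

section Orbits

variable {k : Type*} [Field k] {F : Type*} [AddCommGroup F] [Module k F]
  (e : Module.Basis (Fin 5) k (Module.Dual k F))

theorem finrank_pencilSpace (hF : Module.finrank k F = 5) :
    Module.finrank k (PencilSpace k F) = 20 := by
  have : FiniteDimensional k F := Module.finite_of_finrank_pos (by omega)
  rw [Module.finrank_linearMap, exteriorPower.finrank_eq, Subspace.dual_finrank_eq, hF]
  simp [Nat.choose]

/-- Linear coordinates on `Hom(k², ∧² F*)`. -/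
def pencilEquiv (hF : Module.finrank k F = 5) : (Fin 20 → k) ≃ₗ[k] PencilSpace k F :=
  have : FiniteDimensional k F := Module.finite_of_finrank_pos (by omega)
  LinearEquiv.ofFinrankEq _ _ (by rw [finrank_pencilSpace hF]; simp)

theorem isPolynomialMap_pencilEquiv (hF : Module.finrank k F = 5) :
    IsPolynomialMap k (pencilEquiv (k := k) (F := F) hF) :=
  show IsPolynomialMap k (pencilEquiv hF).toLinearMap from isPolynomialMap_linear _

theorem isPolynomialMap_pencilEquiv_symm (hF : Module.finrank k F = 5) :
    IsPolynomialMap k (pencilEquiv (k := k) (F := F) hF).symm :=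
  show IsPolynomialMap k (pencilEquiv hF).symm.toLinearMap from isPolynomialMap_linear _

theorem hasDominantChart_A2_2A1 (hF : Module.finrank k F = 5) :
    HasDominantChart e .A2_2A1 20 := by
  refine ⟨pencilEquiv hF, isPolynomialMap_pencilEquiv hF, fun f _ => ?_⟩
  exact subset_zariskiClosure _ ((pencilEquiv hF).surjective f)

theorem le_zariskiDim_of_ne_zero [Infinite k] (hF : Module.finrank k F = 5)
    {S : Set (PencilSpace k F)} {g : PencilSpace k F → k} (hg : IsPolynomialMap k g)
    {v₀ : PencilSpace k F} (h₀ : g v₀ ≠ 0) (hS : ∀ v, g v ≠ 0 → v ∈ S) :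
    ((20 : ℕ) : WithBot ℕ∞) ≤ zariskiDim k S := by
  have hP : IsPolynomialMap k fun x => v₀ + pencilEquiv hF x :=
    (isPolynomialMap_const v₀).add (isPolynomialMap_pencilEquiv hF)
  refine le_zariskiDim hP (hg.comp hP) (by simpa using h₀) (fun x hx => hS _ hx) fun i =>
    ⟨fun v => (pencilEquiv hF).symm (v - v₀) i, ?_, fun x hx => ?_, ?_⟩
  · exact ((isPolynomialMap_apply i).comp
      (isPolynomialMap_pencilEquiv_symm hF)).comp
      (isPolynomialMap_id.sub (isPolynomialMap_const v₀))
  · have : v₀ + pencilEquiv hF x - v₀ = pencilEquiv hF x :=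
      add_sub_cancel_left v₀ (pencilEquiv hF x)
    simp only [this, LinearEquiv.symm_apply_apply]
    exact hx i le_rfl
  · have : v₀ + pencilEquiv hF (Pi.single i 1) - v₀ = pencilEquiv hF (Pi.single i 1) :=
      add_sub_cancel_left v₀ (pencilEquiv hF (Pi.single i 1))
    simp only [this, LinearEquiv.symm_apply_apply]
    simp

variable [FiniteDimensional k F]

theorem hasDominantChart_A1 [Infinite k] : HasDominantChart e .A1 0 := by
  refine hasDominantChart e .A1 (isPolynomialMap_const 0) (isPolynomialMap_const 1)
    (m₀ := 0) (φ₀ := 0) one_ne_zero fun m φ _ => ⟨0, ?_⟩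
  ext r a b
  fin_cases r <;> simp [skewPair, skewRep]

theorem hasDominantChart_dim [Infinite k] (hF : Module.finrank k F = 5) (i : OrbitLabel) :
    HasDominantChart e i i.dim := by
  cases i
  exacts [hasDominantChart_A2_2A1 e hF, hasDominantChart_A2A1 e, hasDominantChart_A2 e,
    hasDominantChart_threeA1a e, hasDominantChart_threeA1b e, hasDominantChart_threeA1c e,
    hasDominantChart_twoA1 e, hasDominantChart_A1 e]

/-- Otherwise the orbit would be dense, and its dominant chart in fewer than 20 variables would
bound the dimension of the whole space. -/
theorem exists_vanishing_on_orbit [Infinite k] (hF : Module.finrank k F = 5) {i : OrbitLabel}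
    (hi : i ≠ .A2_2A1) :
    ∃ g ∈ polynomialFunctions k (PencilSpace k F),
      (∃ v, g v ≠ 0) ∧ ∀ v ∈ orbit k (OrbitLabel.rep e i), g v = 0 := by
  by_contra! h
  have hcl : Set.univ ⊆ zariskiClosure k (orbit k (OrbitLabel.rep e i)) := by
    refine fun v _ => mem_zariskiClosure.mpr fun g hg hgi => ?_
    by_contra hv
    obtain ⟨w, hw, hgw⟩ := h g hg ⟨v, hv⟩
    exact hgw (hgi w hw)
  have h1 := (hasDominantChart_dim e hF i).zariskiDim_le e hcl
  have h2 := le_zariskiDim_of_ne_zero hF (S := Set.univ) (isPolynomialMap_const (1 : k)) (v₀ := 0)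
    one_ne_zero (fun v _ => Set.mem_univ v)
  have h3 : 20 ≤ i.dim := by exact_mod_cast h2.trans h1
  cases i <;> simp [OrbitLabel.dim] at h3 hi

theorem exists_vanishing_on_orbits [Infinite k] (hF : Module.finrank k F = 5)
    (l : List OrbitLabel) (hl : ∀ i ∈ l, i ≠ .A2_2A1) :
    ∃ g ∈ polynomialFunctions k (PencilSpace k F),
      (∃ v, g v ≠ 0) ∧ ∀ i ∈ l, ∀ v ∈ orbit k (OrbitLabel.rep e i), g v = 0 := by
  induction l with
  | nil => exact ⟨_, const_mem_polynomialFunctions 1, ⟨0, one_ne_zero⟩, by simp⟩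
  | cons i l ih =>
    obtain ⟨g, hg, ⟨v, hv⟩, hgl⟩ := ih fun j hj => hl j (List.mem_cons_of_mem _ hj)
    obtain ⟨g', hg', ⟨v', hv'⟩, hgi⟩ := exists_vanishing_on_orbit e hF (hl i List.mem_cons_self)
    refine ⟨g * g', (polynomialFunctions k _).mul_mem hg hg', ?_, fun j hj w hw => ?_⟩
    · by_contra! h
      refine hv (eq_zero_of_forall_ne_zero hg hg' hv' (fun w hw => ?_) v)
      exact (mul_eq_zero.mp (h w)).resolve_right hw
    · rw [Pi.mul_apply]
      rcases List.mem_cons.mp hj with rfl | hj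
      · rw [hgi w hw, mul_zero]
      · rw [hgl j hj w hw, zero_mul]

theorem orbit_subset_closure [Infinite k] {i j : OrbitLabel}
    (h : ∀ m φ, ∃ m' φ', skewPair i m' φ' = skewPair j (k := k) m φ) :
    orbit k (OrbitLabel.rep e j) ⊆ zariskiClosure k (orbit k (OrbitLabel.rep e i)) := by
  intro f hf
  obtain ⟨m, φ, -, -, rfl⟩ := (mem_orbit_rep_iff e).mp hf
  obtain ⟨m', φ', h'⟩ := h m φ
  rw [tabulated, ← h']
  exact tabulated_mem_closure e i m' φ'

variable [IsAlgClosed k]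

theorem exists_mem_orbit_rep (f : PencilSpace k F) :
    ∃ i, f ∈ orbit k (OrbitLabel.rep e i) := by
  obtain ⟨i, m, φ, hm, hφ, hf⟩ := exists_eq_tabulated e f
  exact ⟨i, (mem_orbit_rep_iff e).mpr ⟨m, φ, hm, hφ, hf⟩⟩

/-- The generic orbit contains a nonempty principal open set. -/
theorem exists_principal_open_subset (hF : Module.finrank k F = 5) :
    ∃ g ∈ polynomialFunctions k (PencilSpace k F), (∃ v, g v ≠ 0) ∧
      ∀ v, g v ≠ 0 → v ∈ orbit k (OrbitLabel.rep e .A2_2A1) := by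
  have : Infinite k := IsAlgClosed.instInfinite
  -- Off the zeros of a polynomial vanishing on the seven other orbits, the classification leaves
  -- only the generic one.
  obtain ⟨g, hg, hv, h⟩ := exists_vanishing_on_orbits e hF
    [.A2_A1, .A2, .threeA1a, .threeA1b, .threeA1c, .twoA1, .A1] (by simp)
  refine ⟨g, hg, hv, fun v hgv => ?_⟩
  obtain ⟨i, hi⟩ := exists_mem_orbit_rep e v
  by_cases hi' : i = .A2_2A1
  · rwa [hi'] at hi
  · refine absurd (h i ?_ v hi) hgv
    cases i <;> simp at hi' ⊢

theorem zariskiDim_orbit_rep (hF : Module.finrank k F = 5) (i : OrbitLabel) :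
    zariskiDim k (orbit k (OrbitLabel.rep e i)) = (i.dim : WithBot ℕ∞) := by
  have : Infinite k := IsAlgClosed.instInfinite
  refine le_antisymm
    ((hasDominantChart_dim e hF i).zariskiDim_le e (subset_zariskiClosure _)) ?_
  cases i
  · obtain ⟨g, hg, ⟨v, hv⟩, h⟩ := exists_principal_open_subset e hF
    exact le_zariskiDim_of_ne_zero hF (isPolynomialMap_of_mem hg) hv h
  · exact le_zariskiDim_A2A1 e
  · exact le_zariskiDim_A2 e
  · exact le_zariskiDim_threeA1a e
  · exact le_zariskiDim_threeA1b e
  · exact le_zariskiDim_threeA1c e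
  · exact le_zariskiDim_twoA1 e
  · exact le_zariskiDim (isPolynomialMap_const (OrbitLabel.rep e .A1)) (isPolynomialMap_const (1 : k))
      one_ne_zero (fun _ _ => self_mem_orbit _) fun i => i.elim0

/-- The eight dimensions are pairwise distinct. -/
theorem eq_of_rep_mem_orbit (hF : Module.finrank k F = 5) {i j : OrbitLabel}
    (h : OrbitLabel.rep e i ∈ orbit k (OrbitLabel.rep e j)) : i = j := by
  have h1 := zariskiDim_orbit_rep e hF i
  rw [orbit_eq_of_mem h, zariskiDim_orbit_rep e hF j] at h1
  have h2 : j.dim = i.dim := by exact_mod_cast h1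
  cases i <;> cases j <;> first | rfl | simp [OrbitLabel.dim] at h2

theorem orbit_subset_closure_generic (hF : Module.finrank k F = 5) (S : Set (PencilSpace k F)) :
    S ⊆ zariskiClosure k (orbit k (OrbitLabel.rep e .A2_2A1)) := by
  have : Infinite k := IsAlgClosed.instInfinite
  obtain ⟨g, hg, ⟨v, hv⟩, h⟩ := exists_principal_open_subset e hF
  exact fun w _ => isPolynomialMap_id.mem_zariskiClosure_of_forall (isPolynomialMap_of_mem hg) hv
    (fun x hx => subset_zariskiClosure _ (h x hx)) w

end Orbits

/-! ### Degenerations and the one obstruction -/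

section Closures

variable {k : Type*} [Field k] {F : Type*} [AddCommGroup F] [Module k F] [FiniteDimensional k F]
  (e : Module.Basis (Fin 5) k (Module.Dual k F))

/-- The Plücker relations separate the orbit `3A_{1,c}` from the closure of `3A_{1,b}`. -/
theorem not_orbit_threeA1c_subset_closure :
    ¬ orbit k (OrbitLabel.rep e .threeA1c) ⊆
      zariskiClosure k (orbit k (OrbitLabel.rep e .threeA1b)) := by
  intro h
  -- The Pfaffian of the first form on the last four coordinates. It vanishes on `3A_{1,b}`, where
  -- that form is divisible by `φ 0`, but not on `ω₁`.
  let n : (Fin 2 → Fin 5 → Fin 5 → k) → k := fun T =>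
    T 0 1 2 * T 0 3 4 - T 0 1 3 * T 0 2 4 + T 0 1 4 * T 0 2 3
  have hn : IsPolynomialMap k n := by fun_prop
  have h1 := mem_zariskiClosure.mp (h (tabulated_mem_orbit e (i := .threeA1c)
    (m := (1 : Matrix (Fin 2) (Fin 2) k)) (φ := (1 : Matrix (Fin 5) (Fin 5) k)) ?_))
    _ (hn.comp (isPolynomialMap_pencilCoord e)).mem ?_
  · have h2 := pencilCoord_tabulated e .threeA1c (1 : Matrix (Fin 2) (Fin 2) k)
      (1 : Matrix (Fin 5) (Fin 5) k)
    erw [h2] at h1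
    simp [n, skewPair, skewRep, skew_apply] at h1
  · change Matrix.det 1 * Matrix.det 1 ≠ 0
    simp
  · intro f hf
    obtain ⟨m, φ, -, -, rfl⟩ := (mem_orbit_rep_iff e).mp hf
    rw [pencilCoord_tabulated]
    simp [n, skewPair, skewRep, skew_apply]
    ring

variable [Infinite k]

theorem orbit_A2_subset_closure :
    orbit k (OrbitLabel.rep e .A2) ⊆ zariskiClosure k (orbit k (OrbitLabel.rep e .A2_A1)) := by
  refine orbit_subset_closure e fun m φ => ⟨m, ![-φ 3, φ 1, φ 2, φ 3, φ 4], ?_⟩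
  ext r a b
  simp [skewPair, skewRep, skew_apply]
  left
  ring

/-- A pencil of type `A2` joins two products, a secant of the Grassmannian; one of type `threeA1a`
is a tangent line. The pair is moved by a term linear in `t` so as to be of the closure of `A2` type
for `t ≠ 0`, and then `t = 0` follows by density. -/
theorem orbit_threeA1a_subset_closure :
    orbit k (OrbitLabel.rep e .threeA1a) ⊆ zariskiClosure k (orbit k (OrbitLabel.rep e .A2)) := by
  intro f hf
  obtain ⟨m, φ, -, -, rfl⟩ := (mem_orbit_rep_iff e).mp hf
  have hP : IsPolynomialMap k fun t : k =>
      ofPair e (skewPair .threeA1a m φ + t • fun r => m r 0 • skew (φ 3) (φ 4)) :=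
    (isPolynomialMap_ofPair e).comp ((isPolynomialMap_const _).add
      (isPolynomialMap_id.smul (isPolynomialMap_const _)))
  have := hP.mem_zariskiClosure_of_forall isPolynomialMap_id (w₀ := (1 : k)) one_ne_zero
    (S := orbit k (OrbitLabel.rep e .A2)) (fun t ht => ?_) 0
  · simpa [tabulated] using this
  -- The second product `(φ 1 - t φ 4) ∧ (φ 2 + t φ 3)` equals `φ 1 ∧ φ 2 + t ω₁ + t² φ 3 ∧ φ 4`.
  -- The matrix divides by `t` and cancels the two copies of `φ 1 ∧ φ 2` so produced.
  · have h := tabulated_mem_closure e .A2 (fun r => ![m r 0 / t, m r 1 - 2 * m r 0 / t])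
      ![φ 0, φ 1, φ 1 - t • φ 4, φ 2, φ 2 + t • φ 3]
    rw [tabulated] at h
    convert h using 2
    ext r a b
    simp [skewPair, skewRep, skew_apply]
    field_simp
    ring

theorem orbit_threeA1b_subset_closure :
    orbit k (OrbitLabel.rep e .threeA1b) ⊆
      zariskiClosure k (orbit k (OrbitLabel.rep e .threeA1a)) := by
  refine orbit_subset_closure e fun m φ => ⟨m, ![0, φ 0, φ 2, φ 1, 0], ?_⟩
  ext r a b
  simp [skewPair, skewRep, skew_apply]

theorem orbit_threeA1c_subset_closure :
    orbit k (OrbitLabel.rep e .threeA1c) ⊆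
      zariskiClosure k (orbit k (OrbitLabel.rep e .threeA1a)) := by
  refine orbit_subset_closure e fun m φ => ⟨Matrix.of fun r => ![m r 0 + m r 1, 0], φ, ?_⟩
  ext r a b
  simp [skewPair, skewRep, skew_apply]
  ring

theorem orbit_twoA1_subset_closure_threeA1b :
    orbit k (OrbitLabel.rep e .twoA1) ⊆
      zariskiClosure k (orbit k (OrbitLabel.rep e .threeA1b)) := by
  refine orbit_subset_closure e fun m φ => ⟨m, ![φ 0, φ 1, φ 1, 0, 0], ?_⟩
  ext r a b
  simp [skewPair, skewRep, skew_apply]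

theorem orbit_twoA1_subset_closure_threeA1c :
    orbit k (OrbitLabel.rep e .twoA1) ⊆
      zariskiClosure k (orbit k (OrbitLabel.rep e .threeA1c)) := by
  refine orbit_subset_closure e fun m φ => ⟨m, ![0, φ 0, 0, φ 1, 0], ?_⟩
  ext r a b
  simp [skewPair, skewRep, skew_apply]

theorem orbit_A1_subset_closure (i : OrbitLabel) :
    orbit k (OrbitLabel.rep e .A1) ⊆ zariskiClosure k (orbit k (OrbitLabel.rep e i)) := by
  refine orbit_subset_closure e fun m φ => ⟨0, φ, ?_⟩
  ext r a b
  fin_cases r <;> simp [skewPair, skewRep]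

end Closures

/-- The combinatorial half: a transitive relation with these basic degenerations contains all the
claimed ones. -/
theorem OrbitLabel.rel_of_row_le {C : OrbitLabel → OrbitLabel → Prop} (refl : ∀ a, C a a)
    (trans : ∀ {a b c}, C a b → C b c → C a c) (generic : ∀ a, C .A2_2A1 a)
    (zero : ∀ a, C a .A1) (h23 : C .A2_A1 .A2) (h34 : C .A2 .threeA1a)
    (h45 : C .threeA1a .threeA1b) (h46 : C .threeA1a .threeA1c) (h57 : C .threeA1b .twoA1)
    (h67 : C .threeA1c .twoA1) {i j : OrbitLabel} (h : i.row ≤ j.row)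
    (hn : ¬(i = .threeA1b ∧ j = .threeA1c)) : C i j := by
  have h24 := trans h23 h34
  have h25 := trans h24 h45
  have h26 := trans h24 h46
  have h35 := trans h34 h45
  have h36 := trans h34 h46
  have h47 := trans h45 h57
  have h37 := trans h34 h47
  have h27 := trans h24 h47
  cases i <;> cases j <;> first
    | exact generic _
    | exact zero _
    | exact refl _
    | assumption
    | exact absurd ⟨rfl, rfl⟩ hn
    | exact absurd h (by simp [OrbitLabel.row])

theorem natCard_orbitLabel : Nat.card OrbitLabel = 8 := by
  let f : Fin 8 → OrbitLabel :=
    ![.A2_2A1, .A2_A1, .A2, .threeA1a, .threeA1b, .threeA1c, .twoA1, .A1]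
  have hf : Function.Bijective f := by
    constructor
    · intro a b h
      have hrow : ∀ c, (f c).row = c + 1 := by
        intro c
        fin_cases c <;> rfl
      have := congrArg OrbitLabel.row h
      rw [hrow, hrow] at this
      omega
    · intro i
      cases i
      exacts [⟨0, rfl⟩, ⟨1, rfl⟩, ⟨2, rfl⟩, ⟨3, rfl⟩, ⟨4, rfl⟩, ⟨5, rfl⟩, ⟨6, rfl⟩, ⟨7, rfl⟩]
  rw [← Nat.card_congr (Equiv.ofBijective f hf), Nat.card_eq_fintype_card, Fintype.card_fin]

/-! ### Assembly of the closure order and the orbit count -/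

section Closures

variable {k : Type*} [Field k] [IsAlgClosed k] {F : Type*} [AddCommGroup F] [Module k F]
  [FiniteDimensional k F] (e : Module.Basis (Fin 5) k (Module.Dual k F))

theorem orbit_subset_closure_iff (hF : Module.finrank k F = 5) (i j : OrbitLabel) :
    orbit k (OrbitLabel.rep e j) ⊆ zariskiClosure k (orbit k (OrbitLabel.rep e i)) ↔
      i.row ≤ j.row ∧ ¬(i = .threeA1b ∧ j = .threeA1c) := by
  have : Infinite k := IsAlgClosed.instInfinite
  constructor
  · intro h
    -- Dimensions strictly decrease down the table, so comparing them compares rows.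
    have hd : j.dim ≤ i.dim := by
      have := (hasDominantChart_dim e hF i).zariskiDim_le e h
      rw [zariskiDim_orbit_rep e hF j] at this
      exact_mod_cast this
    refine ⟨?_, ?_⟩
    · cases i <;> cases j <;> simp [OrbitLabel.dim, OrbitLabel.row] at hd ⊢
    · rintro ⟨rfl, rfl⟩
      exact not_orbit_threeA1c_subset_closure e h
  · rintro ⟨h, hn⟩
    exact OrbitLabel.rel_of_row_le
      (C := fun a b => orbit k (OrbitLabel.rep e b) ⊆ zariskiClosure k (orbit k (OrbitLabel.rep e a)))
      (fun _ => subset_zariskiClosure _) (fun h h' => h'.trans (zariskiClosure_subset_of_subset h))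
      (fun _ => orbit_subset_closure_generic e hF _) (orbit_A1_subset_closure e)
      (orbit_A2_subset_closure e) (orbit_threeA1a_subset_closure e)
      (orbit_threeA1b_subset_closure e) (orbit_threeA1c_subset_closure e)
      (orbit_twoA1_subset_closure_threeA1b e) (orbit_twoA1_subset_closure_threeA1c e) h hn

theorem ncard_range_orbit (e : Module.Basis (Fin 5) k (Module.Dual k F))
    (hF : Module.finrank k F = 5) :
    (Set.range (orbit k (F := F))).ncard = 8 := by
  have hr : Set.range (orbit k (F := F)) =
      Set.range fun i : OrbitLabel => orbit k (OrbitLabel.rep e i) := by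
    ext S
    constructor
    · rintro ⟨f, rfl⟩
      obtain ⟨i, hi⟩ := exists_mem_orbit_rep e f
      exact ⟨i, (orbit_eq_of_mem hi).symm⟩
    · rintro ⟨i, rfl⟩
      exact ⟨_, rfl⟩
  have hinj : Function.Injective fun i : OrbitLabel => orbit k (OrbitLabel.rep e i) := by
    intro i j hij
    refine eq_of_rep_mem_orbit e hF (i := i) (j := j) ?_
    have h := self_mem_orbit (OrbitLabel.rep e i)
    rwa [show orbit k (OrbitLabel.rep e i) = orbit k (OrbitLabel.rep e j) from hij] at h
  rw [hr, ← Nat.card_coe_set_eq, Nat.card_range_of_injective hinj, natCard_orbitLabel]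

theorem existsUnique_rep_mem_orbit (hF : Module.finrank k F = 5) (f : PencilSpace k F) :
    ∃! i, OrbitLabel.rep e i ∈ orbit k f := by
  obtain ⟨i, hi⟩ := exists_mem_orbit_rep e f
  refine ⟨i, mem_orbit_symm hi, fun j hj => eq_of_rep_mem_orbit e hF ?_⟩
  rwa [← orbit_eq_of_mem hi]

end Closures

end SkewPencil

end

theorem mainTheorem11 {k : Type*} [Field k] [IsAlgClosed k]
    {F : Type*} [AddCommGroup F] [Module k F] (hF : Module.finrank k F = 5)
    (e : Module.Basis (Fin 5) k (Module.Dual k F)) :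
    -- there are exactly eight orbits
    (Set.range (SkewPencil.orbit k (F := F))).ncard = 8 ∧
    -- every orbit contains exactly one of the eight listed elements
    (∀ f : SkewPencil.PencilSpace k F,
      ∃! i : SkewPencil.OrbitLabel, SkewPencil.OrbitLabel.rep e i ∈ SkewPencil.orbit k f) ∧
    -- the dimensions are the listed ones
    (∀ i : SkewPencil.OrbitLabel,
      SkewPencil.zariskiDim k (SkewPencil.orbit k (SkewPencil.OrbitLabel.rep e i)) =
        (i.dim : WithBot ℕ∞)) ∧
    -- the closure relations
    (∀ i j : SkewPencil.OrbitLabel,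
      SkewPencil.orbit k (SkewPencil.OrbitLabel.rep e j) ⊆
          SkewPencil.zariskiClosure k (SkewPencil.orbit k (SkewPencil.OrbitLabel.rep e i)) ↔
        i.row ≤ j.row ∧
          ¬(i = SkewPencil.OrbitLabel.threeA1b ∧ j = SkewPencil.OrbitLabel.threeA1c)) := by
  have : FiniteDimensional k F := Module.finite_of_finrank_pos (by omega)
  exact ⟨SkewPencil.ncard_range_orbit e hF, SkewPencil.existsUnique_rep_mem_orbit e hF,
    SkewPencil.zariskiDim_orbit_rep e hF, SkewPencil.orbit_subset_closure_iff e hF⟩
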